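/- A vertex set $M$ of a finite simple graph $G$ is an MEG-set (monitoring edge-geodetic set) if for every edge $e$ of $G$ there are $u,v\in M$, joined by a path in $G$, such that $e$ lies on all shortest paths between $u$ and $v$; let $\mathrm{meg}(G)$ be the smallest size of an MEG-set of $G$. Let $\mathrm{tw}(G)$ be the treewidth of $G$ (with value $0$ for the graph without vertices). The problem MEG-set asks, given a graph $G$ and an integer $k\ge 0$, whether $\mathrm{meg}(G)\le k$. Theorem. On chordal graphs, MEG-set is fixed-parameter tractable when parameterized by treewidth, in time $2^{2^{O(\mathrm{tw})}}\cdot n$. Precisely: there are a (deterministic) random access machine program $P$, a computable function $f:\mathbb{N}\to\mathbb{N}$ and constants $c,d\in\mathbb{N}$ with $f(t)\le 2^{2^{c(t+1)}}$ for all $t$, such that for every chordal graph $G$ with $n\ge 0$ vertices, given by adjacency lists in arbitrary order, and every integer $k\ge 0$, the program $P$ on input $(G,k)$ halts after at most $f(\mathrm{tw}(G))\cdot(n+1)$ elementary steps and accepts if and only if $\mathrm{meg}(G)\le k$. Each elementary step (an arithmetic operation $+,-,\cdot,\div,\bmod$, a comparison, a memory access with indirect addressing, or a branch) has unit cost, and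 all numbers occurring in the computation are at most $(f(\mathrm{tw}(G))\cdot(n+1)+k)^d$. The program is not given $\mathrm{tw}(G)$ or a tree decomposition. -/

import Mathlib

/-! ### Graph notions -/

namespace MEG

/-- The vertices `u`, `v` monitor the edge `e`: there is a path from `u` to `v`, and `e` lies on
every shortest path between them. (A walk whose length is the distance is a shortest path. For `u`
and `v` in different components nothing is monitored.) -/
def Monitors {V : Type*} (G : SimpleGraph V) (u v : V) (e : Sym2 V) : Prop :=
  G.Reachable u v ∧ ∀ p : G.Walk u v, p.length = G.dist u v → e ∈ p.edges

/-- `M` is a monitoring edge-geodetic set of `G`. -/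
def IsMEGSet {V : Type*} (G : SimpleGraph V) (M : Finset V) : Prop :=
  ∀ e ∈ G.edgeSet, ∃ u ∈ M, ∃ v ∈ M, Monitors G u v e

/-- In a finite graph the set of all vertices is an MEG-set, so the minimum below is over a
nonempty set. -/
theorem isMEGSet_univ {V : Type*} [Fintype V] (G : SimpleGraph V) :
    IsMEGSet G Finset.univ := by
  intro e he
  induction e with
  | _ u v =>
    rw [SimpleGraph.mem_edgeSet] at he
    refine ⟨u, Finset.mem_univ _, v, Finset.mem_univ _, he.reachable, fun p hp => ?_⟩
    rw [SimpleGraph.dist_eq_one_iff_adj.mpr he] at hp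
    cases p with
    | nil => simp at hp
    | cons h q =>
      cases q with
      | nil => simp
      | cons h' r => simp at hp

/-- The monitoring edge-geodetic number: the smallest size of an MEG-set. -/
noncomputable def megNumber {V : Type*} (G : SimpleGraph V) : ℕ :=
  sInf {m : ℕ | ∃ M : Finset V, IsMEGSet G M ∧ M.card = m}

/-- `G` is chordal: every cycle of length at least four has a chord, that is, an edge joining two
vertices of the cycle that is not an edge of the cycle. -/
def IsChordal {V : Type*} (G : SimpleGraph V) : Prop :=
  ∀ (v : V) (c : G.Walk v v), c.IsCycle → 4 ≤ c.length →
    ∃ x ∈ c.support, ∃ y ∈ c.support, G.Adj x y ∧ s(x, y) ∉ c.edges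

/-- `(T, X)` is a tree decomposition of `G`: `T` is a tree, the nodes whose bags contain a given
vertex induce a nonempty connected subgraph of `T`, and any two adjacent vertices share a bag. -/
structure IsTreeDecomposition {V ι : Type*} (G : SimpleGraph V) (T : SimpleGraph ι)
    (X : ι → Finset V) : Prop where
  isTree : T.IsTree
  connected : ∀ v : V, (T.induce {t | v ∈ X t}).Connected
  adj : ∀ u v : V, G.Adj u v → ∃ t, u ∈ X t ∧ v ∈ X t

/-- The treewidth: the least `w` such that some (finite) tree decomposition has all bags of size at
most `w + 1`. (The graph without vertices gets `0`.) -/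
noncomputable def treewidth {V : Type*} (G : SimpleGraph V) : ℕ :=
  sInf {w : ℕ | ∃ (m : ℕ) (T : SimpleGraph (Fin m)) (X : Fin m → Finset V),
    IsTreeDecomposition G T X ∧ ∀ t, (X t).card ≤ w + 1}

/-- `adj` is an adjacency-list representation of `G`: `adj v` lists every neighbour of `v` exactly
once, in an arbitrary order. -/
def IsAdjList {n : ℕ} (G : SimpleGraph (Fin n)) (adj : Fin n → List (Fin n)) : Prop :=
  ∀ v, (adj v).Nodup ∧ ∀ w, w ∈ adj v ↔ G.Adj v w

end MEG

/-! ### Random access machine with bounded words -/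

namespace RAM

/-- The memory: scalar variables and arrays, each cell holding a natural number. A program mentions
only finitely many variables and arrays. -/
structure State where
  var : ℕ → ℕ
  arr : ℕ → ℕ → ℕ

/-- The elementary binary operations. -/
inductive BinOp
  | add | sub | mul | div | mod | lt | eq

/-- Value of an elementary operation. Subtraction is truncated at `0`, division by zero gives `0`,
the remainder modulo zero is the dividend; comparisons give `1` for true and `0` for false. -/
def BinOp.apply : BinOp → ℕ → ℕ → ℕ
  | .add, a, b => a + b
  | .sub, a, b => a - b
  | .mul, a, b => a * b
  | .div, a, b => a / b
  | .mod, a, b => a % b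
  | .lt, a, b => if a < b then 1 else 0
  | .eq, a, b => if a = b then 1 else 0

/-- Expressions: constants, variables, array cells (indirect addressing), elementary operations. -/
inductive Expr
  | const (c : ℕ)
  | var (x : ℕ)
  | read (a : ℕ) (i : Expr)
  | bin (o : BinOp) (e₁ e₂ : Expr)

/-- Value of an expression. -/
def Expr.eval (s : State) : Expr → ℕ
  | .const c => c
  | .var x => s.var x
  | .read a i => s.arr a (i.eval s)
  | .bin o e₁ e₂ => o.apply (e₁.eval s) (e₂.eval s)

/-- Time for evaluating an expression: one unit for each constant, variable access, array access
and operation in it. -/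
def Expr.cost : Expr → ℕ
  | .const _ => 1
  | .var _ => 1
  | .read _ i => i.cost + 1
  | .bin _ e₁ e₂ => e₁.cost + e₂.cost + 1

/-- All values (addresses included) that arise in evaluating the expression are at most `W`. -/
def Expr.Fits (W : ℕ) (s : State) : Expr → Prop
  | .const c => c ≤ W
  | .var x => s.var x ≤ W
  | .read a i => i.Fits W s ∧ s.arr a (i.eval s) ≤ W
  | .bin o e₁ e₂ => e₁.Fits W s ∧ e₂.Fits W s ∧ o.apply (e₁.eval s) (e₂.eval s) ≤ W

/-- Programs. Conditions are true when nonzero. -/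
inductive Cmd
  | skip
  | assign (x : ℕ) (e : Expr)
  | write (a : ℕ) (i e : Expr)
  | seq (p q : Cmd)
  | cond (e : Expr) (p q : Cmd)
  | loop (e : Expr) (p : Cmd)

/-- The memory after `x := v`. -/
def State.setVar (s : State) (x v : ℕ) : State :=
  { s with var := Function.update s.var x v }

/-- The memory after `a[i] := v`. -/
def State.setArr (s : State) (a i v : ℕ) : State :=
  { s with arr := Function.update s.arr a (Function.update (s.arr a) i v) }

/-- `Exec W p s s' T`: started in memory `s`, the program `p` halts in memory `s'` after exactly `T`
time units, and no value exceeding `W` is computed on the way. -/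
inductive Exec (W : ℕ) : Cmd → State → State → ℕ → Prop
  | skip (s : State) : Exec W .skip s s 1
  | assign (s : State) (x : ℕ) (e : Expr) (he : e.Fits W s) :
      Exec W (.assign x e) s (s.setVar x (e.eval s)) (e.cost + 1)
  | write (s : State) (a : ℕ) (i e : Expr) (hi : i.Fits W s) (he : e.Fits W s) :
      Exec W (.write a i e) s (s.setArr a (i.eval s) (e.eval s)) (i.cost + e.cost + 1)
  | seq {p q : Cmd} {s₁ s₂ s₃ : State} {T₁ T₂ : ℕ} (hp : Exec W p s₁ s₂ T₁)
      (hq : Exec W q s₂ s₃ T₂) : Exec W (.seq p q) s₁ s₃ (T₁ + T₂)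
  | condTrue {e : Expr} {p q : Cmd} {s s' : State} {T : ℕ} (he : e.Fits W s)
      (h : e.eval s ≠ 0) (hp : Exec W p s s' T) : Exec W (.cond e p q) s s' (e.cost + T + 1)
  | condFalse {e : Expr} {p q : Cmd} {s s' : State} {T : ℕ} (he : e.Fits W s)
      (h : e.eval s = 0) (hq : Exec W q s s' T) : Exec W (.cond e p q) s s' (e.cost + T + 1)
  | loopDone {e : Expr} {p : Cmd} {s : State} (he : e.Fits W s)
      (h : e.eval s = 0) : Exec W (.loop e p) s s (e.cost + 1)
  | loopStep {e : Expr} {p : Cmd} {s₁ s₂ s₃ : State} {T₁ T₂ : ℕ} (he : e.Fits W s₁)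
      (h : e.eval s₁ ≠ 0) (hp : Exec W p s₁ s₂ T₁) (hr : Exec W (.loop e p) s₂ s₃ T₂) :
      Exec W (.loop e p) s₁ s₃ (e.cost + T₁ + T₂ + 1)

/-- The machine is deterministic: final memory and running time are determined by the program and
the initial memory. -/
theorem Exec.deterministic {W W' : ℕ} {p : Cmd} {s s₁ s₂ : State} {T₁ T₂ : ℕ}
    (h₁ : Exec W p s s₁ T₁) (h₂ : Exec W' p s s₂ T₂) : s₁ = s₂ ∧ T₁ = T₂ := by
  induction h₁ generalizing s₂ T₂ with
  | skip s => cases h₂; exact ⟨rfl, rfl⟩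
  | assign s x e he => cases h₂; exact ⟨rfl, rfl⟩
  | write s a i e hi he => cases h₂; exact ⟨rfl, rfl⟩
  | seq _ _ ihp ihq =>
    cases h₂ with
    | seq hp' hq' =>
      obtain ⟨rfl, rfl⟩ := ihp hp'
      obtain ⟨rfl, rfl⟩ := ihq hq'
      exact ⟨rfl, rfl⟩
  | condTrue _ h _ ih =>
    cases h₂ with
    | condTrue _ _ h' => obtain ⟨rfl, rfl⟩ := ih h'; exact ⟨rfl, rfl⟩
    | condFalse _ h' _ => exact absurd h' h
  | condFalse _ h _ ih =>
    cases h₂ with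
    | condTrue _ h' _ => exact absurd h h'
    | condFalse _ _ h' => obtain ⟨rfl, rfl⟩ := ih h'; exact ⟨rfl, rfl⟩
  | loopDone _ h =>
    cases h₂ with
    | loopDone _ _ => exact ⟨rfl, rfl⟩
    | loopStep _ h' _ _ => exact absurd h h'
  | loopStep _ h _ _ ihp ihr =>
    cases h₂ with
    | loopDone _ h' => exact absurd h' h
    | loopStep _ _ hp' hr' =>
      obtain ⟨rfl, rfl⟩ := ihp hp'
      obtain ⟨rfl, rfl⟩ := ihr hr'
      exact ⟨rfl, rfl⟩

/-- The initial memory for a graph on the vertices `0, …, n - 1` given by adjacency lists, and a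
number `k`. Variable `0` holds `n` and variable `1` holds `k`. Array `1` holds the concatenation of
the lists of the vertices `0, …, n - 1`; cell `v` of array `0`, for `v ≤ n`, holds the position in
array `1` at which the list of `v` starts (for `v = n`, the total length). All else is `0`. -/
def input {n : ℕ} (adj : Fin n → List (Fin n)) (k : ℕ) : State where
  var x := if x = 0 then n else if x = 1 then k else 0
  arr a i :=
    if a = 0 then (if i ≤ n then ((List.ofFn adj).take i).flatten.length else 0)
    else if a = 1 then ((List.ofFn adj).flatten.map Fin.val).getD i 0
    else 0

end RAM

/-! Say that u favours x over y, for adjacent x and y, if x is strictly closer to u than y and than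
every common neighbour of x and y. If u and w monitor the edge xy, then one of them favours x over y
and the other favours y over x, since otherwise a shortest path could be rerouted around xy. In a
chordal graph the converse holds (`monitors_of_favours`), because an edge on a cycle lies in a
triangle whose third vertex is on the cycle. So M is an MEG-set iff every ordered adjacent pair is
favoured by some member of M (`isMEGSet_iff`). Pairs of elements of M have disappeared, and a
covering problem for single vertices remains.

On a clique the distances from u differ by at most one. If the clique separates u from a pair, then
whether u favours the pair depends only on the set of vertices of the clique nearest to u, the type
of u (`favours_srcDist_near`). Maximum cardinality search numbers a chordal graph such that the
earlier neighbours of each vertex form a clique (`IsMCS.adj`). Each vertex is attached to its last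
earlier neighbour, and from the last vertex to the first its cluster is merged into that of its
parent. A proper colouring with ω colours names the vertices of a bag, so types are sets of colours.
A partial solution in a cluster is summarised by the types that it provides, the types that it
expects from outside, and the pairs in the bag that it favours: a state of 2^ω + 2^ω + ω² bits.
`spec_of_joins` and `exists_joins` show that partial solutions split and combine exactly as the
local rule `Joins` for states says. So the least sizes per state can be computed by trying all
triples of states at each merge (`IsTable.merge`).

A clique has at most treewidth + 1 vertices (`card_le_treewidth_add_one`). Hence greedy colouring
along the numbering needs at most that many colours, the graph has at most treewidth · n edges, and
all constants are doubly exponential in the treewidth. The search runs in linear time with stacks of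
vertices by label, paid for by a potential.

The program is verified with `Run`, a total correctness statement with time bound on memory bounded
by V. Intermediate values stay polynomial in V because all expressions are short. The rule for
joining states is a formula with bounded quantifiers, compiled to nested loops (`Fm.run_compile`),
so that its correctness reduces to the truth of the formula (`Fm.holds_combine`). -/

namespace RAM

/-! ### Programs on bounded memory -/

@[simp] theorem Expr.eval_const (s : State) (c : ℕ) : (Expr.const c).eval s = c := rfl
@[simp] theorem Expr.eval_var (s : State) (x : ℕ) : (Expr.var x).eval s = s.var x := rfl
@[simp] theorem Expr.eval_read (s : State) (a : ℕ) (i : Expr) :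
    (Expr.read a i).eval s = s.arr a (i.eval s) := rfl
@[simp] theorem Expr.eval_bin (s : State) (o : BinOp) (a b : Expr) :
    (Expr.bin o a b).eval s = o.apply (a.eval s) (b.eval s) := rfl
@[simp] theorem BinOp.apply_add (a b : ℕ) : BinOp.add.apply a b = a + b := rfl
@[simp] theorem BinOp.apply_sub (a b : ℕ) : BinOp.sub.apply a b = a - b := rfl
@[simp] theorem BinOp.apply_mul (a b : ℕ) : BinOp.mul.apply a b = a * b := rfl
@[simp] theorem BinOp.apply_div (a b : ℕ) : BinOp.div.apply a b = a / b := rfl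
@[simp] theorem BinOp.apply_mod (a b : ℕ) : BinOp.mod.apply a b = a % b := rfl
@[simp] theorem BinOp.apply_lt (a b : ℕ) : BinOp.lt.apply a b = if a < b then 1 else 0 := by
  simp only [BinOp.apply]
@[simp] theorem BinOp.apply_eq (a b : ℕ) : BinOp.eq.apply a b = if a = b then 1 else 0 := by
  simp only [BinOp.apply]

theorem BinOp.apply_eq_le (a b : ℕ) : BinOp.eq.apply a b ≤ 1 := by
  simp only [BinOp.apply]; split_ifs <;> omega

/-- The constants in the expression are at most `2`. -/
def Expr.consts : Expr → Bool
  | .const c => decide (c ≤ 2)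
  | .var _ => true
  | .read _ i => i.consts
  | .bin _ a b => a.consts && b.consts

/-- Small expressions, for which a fixed polynomial word size suffices. -/
def Expr.small (e : Expr) : Bool := e.consts && decide (e.cost ≤ 60)

/-- All memory cells hold values at most `V`. -/
structure State.Bdd (V : ℕ) (s : State) : Prop where
  two_le : 2 ≤ V
  var_le : ∀ x, s.var x ≤ V
  arr_le : ∀ a i, s.arr a i ≤ V

theorem Expr.cost_pos (e : Expr) : 1 ≤ e.cost := by
  cases e <;> simp [Expr.cost]

/-- A product adds the exponents, and a sum at most doubles the larger power, which the extra unit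
of cost absorbs because V ≥ 2. -/
theorem Expr.eval_le {V : ℕ} {s : State} (hs : s.Bdd V) (e : Expr) (hc : e.consts = true) :
    e.eval s ≤ V ^ e.cost := by
  have hV := hs.two_le
  have h1 : ∀ m, 1 ≤ V ^ m := fun m => Nat.one_le_pow _ _ (by omega)
  have hle : ∀ {m}, 1 ≤ m → V ≤ V ^ m := fun {m} hm => by
    calc V = V ^ 1 := (pow_one V).symm
      _ ≤ V ^ m := Nat.pow_le_pow_right (by omega) hm
  induction e with
  | const c => simp [Expr.consts] at hc; simp [Expr.eval, Expr.cost]; omega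
  | var x => simpa [Expr.eval, Expr.cost] using hs.var_le x
  | read a i ih => exact (hs.arr_le _ _).trans (hle (by simp [Expr.cost]))
  | bin o a b iha ihb =>
    simp only [Expr.consts, Bool.and_eq_true] at hc
    have ha := iha hc.1
    have hb := ihb hc.2
    have hca := a.cost_pos
    have hcb := b.cost_pos
    have hma : V ^ a.cost ≤ V ^ (a.cost + b.cost) := Nat.pow_le_pow_right (by omega) (by omega)
    have hmb : V ^ b.cost ≤ V ^ (a.cost + b.cost) := Nat.pow_le_pow_right (by omega) (by omega)
    have hsum : V ^ (a.cost + b.cost) + V ^ (a.cost + b.cost) ≤ V ^ (a.cost + b.cost + 1) := by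
      rw [pow_succ]; nlinarith [h1 (a.cost + b.cost)]
    have hone := h1 (a.cost + b.cost)
    simp only [Expr.eval, Expr.cost]
    cases o with
    | add => simp only [BinOp.apply]; omega
    | sub => simp only [BinOp.apply]; omega
    | mul =>
      simp only [BinOp.apply]
      calc _ ≤ V ^ a.cost * V ^ b.cost := Nat.mul_le_mul ha hb
        _ = V ^ (a.cost + b.cost) := (pow_add _ _ _).symm
        _ ≤ _ := by omega
    | div => simp only [BinOp.apply]; exact (Nat.div_le_self _ _).trans (by omega)
    | mod => simp only [BinOp.apply]; exact (Nat.mod_le _ _).trans (by omega)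
    | lt => simp only [BinOp.apply]; split_ifs <;> omega
    | eq => simp only [BinOp.apply]; split_ifs <;> omega

theorem Expr.fits_of_cost_le {V d : ℕ} {s : State} (hs : s.Bdd V) (e : Expr)
    (hc : e.consts = true) (hd : e.cost ≤ d) : e.Fits (V ^ d) s := by
  have hV := hs.two_le
  have key : ∀ e' : Expr, e'.consts = true → e'.cost ≤ d → e'.eval s ≤ V ^ d := fun e' h1 h2 =>
    (e'.eval_le hs h1).trans (Nat.pow_le_pow_right (by omega) h2)
  induction e with
  | const c => exact key _ hc hd
  | var x => exact key (.var x) hc hd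
  | read a i ih =>
    exact ⟨ih hc (by simp [Expr.cost] at hd; omega), key (.read a i) hc hd⟩
  | bin o a b iha ihb =>
    have hc' := hc
    simp only [Expr.consts, Bool.and_eq_true] at hc'
    have hd' := hd
    simp only [Expr.cost] at hd'
    exact ⟨iha hc'.1 (by omega), ihb hc'.2 (by omega), key (.bin o a b) hc hd⟩

/-- The exponent 60 becomes the exponent of the word size in the theorem. -/
theorem Expr.fits {V : ℕ} {s : State} (hs : s.Bdd V) {e : Expr} (he : e.small = true) :
    e.Fits (V ^ 60) s := by
  simp only [Expr.small, Bool.and_eq_true, decide_eq_true_eq] at he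
  exact e.fits_of_cost_le hs he.1 he.2

/-- The variables a program may change. -/
def Cmd.wv : Cmd → List ℕ
  | .skip => []
  | .assign x _ => [x]
  | .write _ _ _ => []
  | .seq p q => p.wv ++ q.wv
  | .cond _ p q => p.wv ++ q.wv
  | .loop _ p => p.wv

/-- The arrays a program may change. -/
def Cmd.wa : Cmd → List ℕ
  | .skip => []
  | .assign _ _ => []
  | .write a _ _ => [a]
  | .seq p q => p.wa ++ q.wa
  | .cond _ p q => p.wa ++ q.wa
  | .loop _ p => p.wa

/-- `s` and `s'` agree outside of what `p` may change. -/
structure Frame (p : Cmd) (s s' : State) : Prop where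
  var : ∀ x, x ∉ p.wv → s'.var x = s.var x
  arr : ∀ a, a ∉ p.wa → s'.arr a = s.arr a

theorem Frame.refl (p : Cmd) (s : State) : Frame p s s := ⟨fun _ _ => rfl, fun _ _ => rfl⟩

theorem Frame.trans {p : Cmd} {s s' s'' : State} (h : Frame p s s') (h' : Frame p s' s'') :
    Frame p s s'' :=
  ⟨fun x hx => (h'.var x hx).trans (h.var x hx), fun x hx => (h'.arr x hx).trans (h.arr x hx)⟩

theorem Exec.frame {W : ℕ} {p : Cmd} {s s' : State} {T : ℕ} (h : Exec W p s s' T) :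
    Frame p s s' := by
  induction h with
  | skip s => exact Frame.refl _ _
  | assign s x e he =>
    exact ⟨fun y hy => by simp [Cmd.wv] at hy; simp [State.setVar, hy], fun _ _ => rfl⟩
  | write s a i e hi he =>
    exact ⟨fun _ _ => rfl, fun b hb => by simp [Cmd.wa] at hb; simp [State.setArr, hb]⟩
  | seq _ _ ihp ihq =>
    refine ⟨fun y hy => ?_, fun b hb => ?_⟩
    · simp only [Cmd.wv, List.mem_append, not_or] at hy
      rw [ihq.var y hy.2, ihp.var y hy.1]
    · simp only [Cmd.wa, List.mem_append, not_or] at hb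
      rw [ihq.arr b hb.2, ihp.arr b hb.1]
  | condTrue _ h _ ih =>
    refine ⟨fun y hy => ?_, fun b hb => ?_⟩
    · simp only [Cmd.wv, List.mem_append, not_or] at hy
      rw [ih.var y hy.1]
    · simp only [Cmd.wa, List.mem_append, not_or] at hb
      rw [ih.arr b hb.1]
  | condFalse _ h _ ih =>
    refine ⟨fun y hy => ?_, fun b hb => ?_⟩
    · simp only [Cmd.wv, List.mem_append, not_or] at hy
      rw [ih.var y hy.2]
    · simp only [Cmd.wa, List.mem_append, not_or] at hb
      rw [ih.arr b hb.2]
  | loopDone _ h => exact Frame.refl _ _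
  | loopStep _ h _ _ ihp ihr =>
    exact Frame.trans (p := Cmd.loop _ _) ⟨ihp.var, ihp.arr⟩ ihr

/-- Total correctness with a time bound, on memory bounded by `V`. -/
def Run (V T : ℕ) (p : Cmd) (s : State) (Q : State → Prop) : Prop :=
  s.Bdd V → ∃ s' T', Exec (V ^ 60) p s s' T' ∧ T' ≤ T ∧ s'.Bdd V ∧ Q s'

theorem Run.mono {V T T' : ℕ} {p : Cmd} {s : State} {Q Q' : State → Prop} (h : Run V T p s Q)
    (hT : T ≤ T') (hQ : ∀ s', s'.Bdd V → Frame p s s' → Q s' → Q' s') : Run V T' p s Q' := by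
  intro hs
  obtain ⟨s', t, he, ht, hb, hq⟩ := h hs
  exact ⟨s', t, he, ht.trans hT, hb, hQ s' hb he.frame hq⟩

theorem Run.bdd {V T : ℕ} {p : Cmd} {s : State} {Q : State → Prop}
    (h : s.Bdd V → Run V T p s Q) : Run V T p s Q := fun hs => h hs hs

theorem Run.skip {V T : ℕ} {s : State} {Q : State → Prop} (hQ : Q s) (hT : 1 ≤ T) :
    Run V T .skip s Q := fun hs => ⟨s, 1, .skip s, hT, hs, hQ⟩

theorem State.Bdd.setVar {V : ℕ} {s : State} (hs : s.Bdd V) {x v : ℕ} (hv : v ≤ V) :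
    (s.setVar x v).Bdd V := by
  refine ⟨hs.two_le, fun y => ?_, hs.arr_le⟩
  by_cases h : y = x
  · subst h; simpa [State.setVar] using hv
  · simpa [State.setVar, h] using hs.var_le y

theorem State.Bdd.setArr {V : ℕ} {s : State} (hs : s.Bdd V) {a i v : ℕ} (hv : v ≤ V) :
    (s.setArr a i v).Bdd V := by
  refine ⟨hs.two_le, hs.var_le, fun b j => ?_⟩
  by_cases h : b = a
  · subst h
    by_cases h' : j = i
    · subst h'; simpa [State.setArr] using hv
    · simpa [State.setArr, h'] using hs.arr_le b j
  · simpa [State.setArr, h] using hs.arr_le b j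

theorem Run.assign {V T : ℕ} {s : State} {Q : State → Prop} {x : ℕ} {e : Expr}
    (he : e.small = true) (hv : e.eval s ≤ V) (hQ : Q (s.setVar x (e.eval s)))
    (hT : e.cost + 1 ≤ T) : Run V T (.assign x e) s Q := fun hs =>
  ⟨_, _, .assign s x e (Expr.fits hs he), hT, hs.setVar hv, hQ⟩

theorem Run.write {V T : ℕ} {s : State} {Q : State → Prop} {a : ℕ} {i e : Expr}
    (hi : i.small = true) (he : e.small = true) (hv : e.eval s ≤ V)
    (hQ : Q (s.setArr a (i.eval s) (e.eval s)))
    (hT : i.cost + e.cost + 1 ≤ T) : Run V T (.write a i e) s Q := fun hs =>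
  ⟨_, _, .write s a i e (Expr.fits hs hi) (Expr.fits hs he), hT, hs.setArr hv, hQ⟩

theorem Run.seq {V T : ℕ} (T₁ T₂ : ℕ) {p q : Cmd} {s : State} {Q : State → Prop}
    (h : Run V T₁ p s (fun s' => Run V T₂ q s' Q)) (hT : T₁ + T₂ ≤ T) :
    Run V T (.seq p q) s Q := by
  intro hs
  obtain ⟨s₁, t₁, he₁, ht₁, hb₁, hq₁⟩ := h hs
  obtain ⟨s₂, t₂, he₂, ht₂, hb₂, hq₂⟩ := hq₁ hb₁
  exact ⟨s₂, _, .seq he₁ he₂, by omega, hb₂, hq₂⟩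

theorem Run.cond {V T : ℕ} (T₁ : ℕ) {e : Expr} {p q : Cmd} {s : State} {Q : State → Prop}
    (he : e.small = true) (hp : e.eval s ≠ 0 → Run V T₁ p s Q)
    (hq : e.eval s = 0 → Run V T₁ q s Q) (hT : e.cost + T₁ + 1 ≤ T) :
    Run V T (.cond e p q) s Q := by
  intro hs
  by_cases h : e.eval s = 0
  · obtain ⟨s₁, t₁, he₁, ht₁, hb₁, hq₁⟩ := hq h hs
    exact ⟨s₁, _, .condFalse (Expr.fits hs he) h he₁, by omega, hb₁, hq₁⟩
  · obtain ⟨s₁, t₁, he₁, ht₁, hb₁, hq₁⟩ := hp h hs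
    exact ⟨s₁, _, .condTrue (Expr.fits hs he) h he₁, by omega, hb₁, hq₁⟩

/-- Loops with a potential `φ` that pays for the iterations. -/
theorem Run.loop {V T : ℕ} (Inv : State → Prop) (φ : State → ℕ) {e : Expr} {p : Cmd} {s : State}
    {Q : State → Prop} (he : e.small = true) (hI : Inv s)
    (hbody : ∀ s', s'.Bdd V → Frame p s s' → Inv s' → e.eval s' ≠ 0 →
      ∃ t, Run V t p s' (fun s'' => Inv s'' ∧ φ s'' + t + e.cost + 1 ≤ φ s'))
    (hdone : ∀ s', s'.Bdd V → Frame p s s' → Inv s' → e.eval s' = 0 → Q s')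
    (hT : φ s + e.cost + 1 ≤ T) : Run V T (.loop e p) s Q := by
  intro hs
  -- Induction on a bound for the potential. At potential zero no iteration is possible, as each one
  -- must be paid for.
  have main : ∀ k s', φ s' ≤ k → s'.Bdd V → Frame p s s' → Inv s' →
      ∃ s'' T', Exec (V ^ 60) (.loop e p) s' s'' T' ∧ T' ≤ φ s' + e.cost + 1 ∧ s''.Bdd V ∧
        Q s'' := by
    intro k
    induction k with
    | zero =>
      intro s' hk hb hf hi
      by_cases h : e.eval s' = 0
      · exact ⟨s', _, .loopDone (Expr.fits hb he) h, by omega, hb, hdone s' hb hf hi h⟩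
      · obtain ⟨t, ht⟩ := hbody s' hb hf hi h
        obtain ⟨s₁, t₁, he₁, ht₁, hb₁, hi₁, hφ₁⟩ := ht hb
        omega
    | succ k ih =>
      intro s' hk hb hf hi
      by_cases h : e.eval s' = 0
      · exact ⟨s', _, .loopDone (Expr.fits hb he) h, by omega, hb, hdone s' hb hf hi h⟩
      · obtain ⟨t, ht⟩ := hbody s' hb hf hi h
        obtain ⟨s₁, t₁, he₁, ht₁, hb₁, hi₁, hφ₁⟩ := ht hb
        obtain ⟨s₂, t₂, he₂, ht₂, hb₂, hq₂⟩ :=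
          ih s₁ (by omega) hb₁ (hf.trans he₁.frame) hi₁
        exact ⟨s₂, _, .loopStep (Expr.fits hb he) h he₁ he₂, by omega, hb₂, hq₂⟩
  obtain ⟨s', t, h1, h2, h3, h4⟩ := main _ s le_rfl hs (Frame.refl _ _) hI
  exact ⟨s', t, h1, h2.trans hT, h3, h4⟩

/-- `for x = a, …, b - 1 do p`. -/
def Cmd.forLoop (x : ℕ) (a b : Expr) (p : Cmd) : Cmd :=
  .seq (.assign x a) (.loop (.bin .lt (.var x) b)
    (.seq p (.assign x (.bin .add (.var x) (.const 1)))))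

/-- The bound may vary with the iteration, so that scanning all adjacency lists costs the sum of the
degrees and not n times the largest one. The invariant for i + 1 is required after the counter has
been increased. -/
theorem Run.forLoopSum {V T : ℕ} (A N : ℕ) (t : ℕ → ℕ) (Inv : ℕ → State → Prop) {x : ℕ} {a b : Expr}
    {p : Cmd}
    {s : State} {Q : State → Prop} (ha : a.small = true)
    (hb : (Expr.bin .lt (.var x) b).small = true)
    (hA : a.eval s = A) (hx : x ∉ p.wv) (hAN : A + N ≤ V)
    (hN : ∀ s', Frame (.seq p (.assign x (.bin .add (.var x) (.const 1)))) s s' →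
      b.eval s' = A + N)
    (h0 : Inv 0 (s.setVar x A))
    (hbody : ∀ i s', i < N → s'.Bdd V →
      Frame (.seq p (.assign x (.bin .add (.var x) (.const 1)))) s s' →
      s'.var x = A + i → Inv i s' →
      Run V (t i) p s' (fun s'' => Inv (i + 1) (s''.setVar x (A + i + 1))))
    (hQ : ∀ s', s'.Bdd V → Frame (.seq p (.assign x (.bin .add (.var x) (.const 1)))) s s' →
      s'.var x = A + N → Inv N s' → Q s')
    (hT : ∑ i ∈ Finset.range N, (t i + b.cost + 7) + a.cost + b.cost + 4 ≤ T) :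
    Run V T (Cmd.forLoop x a b p) s Q := by
  have hfr0 : Frame (.seq p (.assign x (.bin .add (.var x) (.const 1)))) s (s.setVar x A) :=
    ⟨fun y hy => by
      have : y ≠ x := by rintro rfl; simp [Cmd.wv] at hy
      simp [State.setVar, this], fun _ _ => rfl⟩
  refine Run.seq (a.cost + 1) (∑ i ∈ Finset.range N, (t i + b.cost + 7) + b.cost + 3) ?_ (by omega)
  refine Run.assign ha (by omega) ?_ le_rfl
  rw [hA]
  refine Run.loop (fun s' => ∃ i, i ≤ N ∧ s'.var x = A + i ∧ Inv i s')
    (fun s' => ∑ i ∈ Finset.Ico (s'.var x - A) N, (t i + b.cost + 7))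
        hb ⟨0, by omega, by simp [State.setVar], h0⟩
    ?_ ?_ ?_
  · rintro s' hb' hf ⟨i, hi, hxi, hI⟩ he
    have hf' := hfr0.trans hf
    simp only [Expr.eval_bin, Expr.eval_var, BinOp.apply_lt, hN s' hf', hxi] at he
    have hi' : i < N := by
      by_contra hcon
      apply he
      rw [if_neg (by omega)]
    refine ⟨t i + 4, ?_⟩
    refine Run.seq (t i) 4 ((hbody i s' hi' hb' hf' hxi hI).mono le_rfl ?_) le_rfl
    intro s'' hb'' hf'' hI''
    have hx'' : s''.var x = A + i := (hf''.var x hx).trans hxi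
    refine Run.assign rfl ?_ ?_ (by simp [Expr.cost])
    · simp only [Expr.eval_bin, Expr.eval_const, Expr.eval_var, BinOp.apply_add, hx'']; omega
    · simp only [Expr.eval_bin, Expr.eval_const, Expr.eval_var, BinOp.apply_add, hx'']
      refine ⟨⟨i + 1, hi', by simp [State.setVar]; omega, hI''⟩, ?_⟩
      simp only [State.setVar, Function.update_self, Expr.cost, hxi]
      rw [Nat.add_sub_cancel_left, show A + i + 1 - A = i + 1 by omega,
        Finset.sum_eq_sum_Ico_succ_bot hi']
      omega
  · rintro s' hb' hf ⟨i, hi, hxi, hI⟩ he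
    have hf' := hfr0.trans hf
    simp only [Expr.eval_bin, Expr.eval_var, BinOp.apply_lt, hN s' hf', hxi] at he
    have hi' : i = N := by
      by_contra hcon
      rw [if_pos (by omega)] at he
      exact absurd he one_ne_zero
    subst hi'
    exact hQ s' hb' hf' hxi hI
  · simp [State.setVar, Expr.cost]; omega

theorem Run.forLoop {V T : ℕ} (A N t : ℕ) (Inv : ℕ → State → Prop) {x : ℕ} {a b : Expr} {p : Cmd}
    {s : State} {Q : State → Prop} (ha : a.small = true)
    (hb : (Expr.bin .lt (.var x) b).small = true)
    (hA : a.eval s = A) (hx : x ∉ p.wv) (hAN : A + N ≤ V)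
    (hN : ∀ s', Frame (.seq p (.assign x (.bin .add (.var x) (.const 1)))) s s' →
      b.eval s' = A + N)
    (h0 : Inv 0 (s.setVar x A))
    (hbody : ∀ i s', i < N → s'.Bdd V →
      Frame (.seq p (.assign x (.bin .add (.var x) (.const 1)))) s s' →
      s'.var x = A + i → Inv i s' →
      Run V t p s' (fun s'' => Inv (i + 1) (s''.setVar x (A + i + 1))))
    (hQ : ∀ s', s'.Bdd V → Frame (.seq p (.assign x (.bin .add (.var x) (.const 1)))) s s' →
      s'.var x = A + N → Inv N s' → Q s')
    (hT : N * (t + b.cost + 7) + a.cost + b.cost + 4 ≤ T) :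
    Run V T (Cmd.forLoop x a b p) s Q := by
  refine Run.forLoopSum A N (fun _ => t) Inv ha hb hA hx hAN hN h0 hbody hQ ?_
  simpa using hT

theorem State.setVar_var (s : State) (x v y : ℕ) :
    (s.setVar x v).var y = if y = x then v else s.var y := by
  simp only [State.setVar, Function.update_apply]

theorem State.setVar_arr (s : State) (x v : ℕ) : (s.setVar x v).arr = s.arr := rfl

theorem State.setArr_var (s : State) (a i v : ℕ) : (s.setArr a i v).var = s.var := rfl

theorem State.setArr_arr (s : State) (a i v b : ℕ) :
    (s.setArr a i v).arr b = if b = a then Function.update (s.arr a) i v else s.arr b := by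
  simp only [State.setArr, Function.update_apply]

/-! ### Compiling bounded formulas -/

/-- Formulas with quantifiers bounded by variables. The variable bound at quantifier depth `d` is
`100 + d`. -/
inductive Fm
  | atom (e : Expr)
  | not (φ : Fm)
  | and (φ ψ : Fm)
  | all (b : ℕ) (φ : Fm)

namespace Fm

def or (φ ψ : Fm) : Fm := .not (.and (.not φ) (.not ψ))

def imp (φ ψ : Fm) : Fm := .not (.and φ (.not ψ))

def iff (φ ψ : Fm) : Fm := .and (.imp φ ψ) (.imp ψ φ)

def ex (b : ℕ) (φ : Fm) : Fm := .not (.all b (.not φ))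

/-- Truth in a memory. -/
def Holds : ℕ → Fm → State → Prop
  | _, .atom e, s => e.eval s ≠ 0
  | d, .not φ, s => ¬ Holds d φ s
  | d, .and φ ψ, s => Holds d φ s ∧ Holds d ψ s
  | d, .all b φ, s => ∀ i < s.var b, Holds (d + 1) φ (s.setVar (100 + d) i)

theorem holds_or {d : ℕ} {φ ψ : Fm} {s : State} :
    Holds d (.or φ ψ) s ↔ Holds d φ s ∨ Holds d ψ s := by
  simp only [Fm.or, Holds]; tauto

theorem holds_imp {d : ℕ} {φ ψ : Fm} {s : State} :
    Holds d (.imp φ ψ) s ↔ (Holds d φ s → Holds d ψ s) := by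
  simp only [Fm.imp, Holds]; tauto

theorem holds_iff {d : ℕ} {φ ψ : Fm} {s : State} :
    Holds d (.iff φ ψ) s ↔ (Holds d φ s ↔ Holds d ψ s) := by
  simp only [Fm.iff, Holds, holds_imp]; tauto

theorem holds_ex {d b : ℕ} {φ : Fm} {s : State} :
    Holds d (.ex b φ) s ↔ ∃ i < s.var b, Holds (d + 1) φ (s.setVar (100 + d) i) := by
  simp only [Fm.ex, Holds]; push Not; rfl

end Fm

/-- The variables of the expression are below `b` and different from `99`. -/
def Expr.scoped (b : ℕ) : Expr → Bool
  | .const _ => true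
  | .var x => decide (x < b) && decide (x ≠ 99)
  | .read _ i => i.scoped b
  | .bin _ e f => e.scoped b && f.scoped b

namespace Fm

/-- Compilation wraps an atom into two comparisons with 0, which adds 4 to the cost; the limit 50
keeps the result `small`. The variables that bound quantifiers are below 99 and thus untouched by
compiled code. -/
def wf : ℕ → Fm → Bool
  | d, .atom e => e.scoped (100 + d) && (e.consts && decide (e.cost ≤ 50))
  | d, .not φ => φ.wf d
  | d, .and φ ψ => φ.wf d && ψ.wf d
  | d, .all b φ => decide (b < 99) && φ.wf (d + 1)

/-- All quantifiers are bounded by `B`. -/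
def Bd (B : ℕ) (s : State) : Fm → Prop
  | .atom _ => True
  | .not φ => φ.Bd B s
  | .and φ ψ => φ.Bd B s ∧ ψ.Bd B s
  | .all b φ => s.var b ≤ B ∧ φ.Bd B s

/-- The program that puts the truth value into variable `99`. -/
def compile : ℕ → Fm → Cmd
  | _, .atom e => .assign 99 (.bin .eq (.bin .eq e (.const 0)) (.const 0))
  | d, .not φ => .seq (φ.compile d) (.assign 99 (.bin .eq (.var 99) (.const 0)))
  | d, .and φ ψ => .seq (φ.compile d) (.cond (.var 99) (ψ.compile d) .skip)
  | d, .all b φ => .seq (.assign (100 + d) (.const 0)) (.seq (.assign 99 (.const 1))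
      (.loop (.bin .mul (.var 99) (.bin .lt (.var (100 + d)) (.var b)))
        (.seq (φ.compile (d + 1)) (.assign (100 + d) (.bin .add (.var (100 + d)) (.const 1))))))

/-- A bound for the running time. -/
def time (B : ℕ) : Fm → ℕ
  | .atom _ => 55
  | .not φ => φ.time B + 4
  | .and φ ψ => φ.time B + ψ.time B + 3
  | .all _ φ => 12 + B * (φ.time B + 10)

/-- Agreement on everything that a formula at depth `d` may depend on. -/
def Agree (d : ℕ) (s s' : State) : Prop :=
  (∀ x, x < 100 + d → x ≠ 99 → s'.var x = s.var x) ∧ s'.arr = s.arr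

theorem Agree.eval {d : ℕ} {s s' : State} (h : Agree d s s') {e : Expr}
    (he : e.scoped (100 + d) = true) : e.eval s' = e.eval s := by
  induction e with
  | const c => rfl
  | var x =>
    simp only [Expr.scoped, Bool.and_eq_true, decide_eq_true_eq] at he
    exact h.1 x he.1 he.2
  | read a i ih => simp only [Expr.eval]; rw [ih he, h.2]
  | bin o a b iha ihb =>
    simp only [Expr.scoped, Bool.and_eq_true] at he
    simp only [Expr.eval]; rw [iha he.1, ihb he.2]

theorem Agree.setVar {d : ℕ} {s s' : State} (h : Agree d s s') (i : ℕ) :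
    Agree (d + 1) (s.setVar (100 + d) i) (s'.setVar (100 + d) i) := by
  refine ⟨fun x hx hx' => ?_, h.2⟩
  simp only [State.setVar_var]
  split_ifs with hh
  · rfl
  · exact h.1 x (by omega) hx'

theorem Agree.holds {φ : Fm} : ∀ {d : ℕ} {s s' : State}, Agree d s s' → φ.wf d = true →
    (φ.Holds d s' ↔ φ.Holds d s) := by
  induction φ with
  | atom e =>
    intro d s s' h hw
    simp only [wf, Bool.and_eq_true] at hw
    simp only [Holds, h.eval hw.1]
  | not φ ih => intro d s s' h hw; simp only [Holds, ih h hw]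
  | and φ ψ ih1 ih2 =>
    intro d s s' h hw
    simp only [wf, Bool.and_eq_true] at hw
    simp only [Holds, ih1 h hw.1, ih2 h hw.2]
  | all b φ ih =>
    intro d s s' h hw
    simp only [wf, Bool.and_eq_true, decide_eq_true_eq] at hw
    simp only [Holds, h.1 b (by omega) (by omega)]
    exact forall₂_congr fun i _ => ih (h.setVar i) hw.2

theorem Bd.agree {B d : ℕ} {s s' : State} (h : Agree d s s') {φ : Fm} : ∀ {d' : ℕ},
    φ.wf d' = true → φ.Bd B s → φ.Bd B s' := by
  induction φ with
  | atom e => intros; trivial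
  | not φ ih => intro d' hw hb; exact ih hw hb
  | and φ ψ ih1 ih2 =>
    intro d' hw hb
    simp only [wf, Bool.and_eq_true] at hw
    exact ⟨ih1 hw.1 hb.1, ih2 hw.2 hb.2⟩
  | all b φ ih =>
    intro d' hw hb
    simp only [wf, Bool.and_eq_true, decide_eq_true_eq] at hw
    exact ⟨by rw [h.1 b (by omega) (by omega)]; exact hb.1, ih hw.2 hb.2⟩

-- Compiled code at depth d changes only variable 99 and the variables from 100 + d on. Hence a
-- subformula leaves intact whatever the enclosing formula still has to read, and `Agree` is all
-- that has to be carried through the induction.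
open Classical in
theorem run_compile {V B : ℕ} {φ : Fm} : ∀ {d : ℕ} {s : State}, φ.wf d = true → φ.Bd B s →
    Run V (φ.time B) (φ.compile d) s (fun s' => Agree d s s' ∧
      s'.var 99 = if φ.Holds d s then 1 else 0) := by
  induction φ with
  | atom e =>
    intro d s hw _
    refine Run.bdd fun hV => ?_
    simp only [wf, Bool.and_eq_true, decide_eq_true_eq] at hw
    refine Run.assign ?_ ?_ ?_ ?_
    · simp [Expr.small, Expr.consts, Expr.cost]
      exact ⟨hw.2.1, by omega⟩
    · have := hV.two_le
      exact (BinOp.apply_eq_le _ _).trans (by omega)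
    · refine ⟨⟨fun x hx hx' => ?_, rfl⟩, ?_⟩
      · simp [State.setVar_var, hx']
      · simp only [State.setVar_var, if_true, Expr.eval, BinOp.apply, Holds]
        by_cases h : e.eval s = 0 <;> simp [h]
    · simp only [Expr.cost, time]; omega
  | not φ ih =>
    intro d s hw hB
    refine Run.seq (φ.time B) 4 ((ih hw hB).mono le_rfl ?_) le_rfl
    rintro s' hb' - ⟨hA, hv⟩
    have := hb'.two_le
    refine Run.assign rfl ?_ ?_ (by simp [Expr.cost])
    · exact (BinOp.apply_eq_le _ _).trans (by omega)
    · refine ⟨⟨fun x hx hx' => ?_, hA.2⟩, ?_⟩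
      · simp only [State.setVar_var, if_neg hx']; exact hA.1 x hx hx'
      · simp only [State.setVar_var, if_true, Expr.eval, BinOp.apply, Holds, hv]
        by_cases h : φ.Holds d s <;> simp [h]
  | and φ ψ ih1 ih2 =>
    intro d s hw hB
    simp only [wf, Bool.and_eq_true] at hw
    refine Run.seq (φ.time B) (ψ.time B + 3) ((ih1 hw.1 hB.1).mono le_rfl ?_)
      (by simp only [time]; omega)
    rintro s' hb' - ⟨hA, hv⟩
    refine Run.cond (ψ.time B + 1) rfl ?_ ?_ (by simp [Expr.cost]; omega)
    · intro h
      have h1 : φ.Holds d s := by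
        by_contra hc; simp [Expr.eval, hv, hc] at h
      refine (ih2 hw.2 (hB.2.agree hA hw.2)).mono (by omega) ?_
      rintro s'' - - ⟨hA', hv'⟩
      refine ⟨⟨fun x hx hx' => (hA'.1 x hx hx').trans (hA.1 x hx hx'), hA'.2.trans hA.2⟩, ?_⟩
      rw [hv']
      simp only [Holds, h1, true_and, hA.holds hw.2]
    · intro h
      have h1 : ¬ φ.Holds d s := by
        intro hc; simp [Expr.eval, hv, hc] at h
      refine Run.skip ⟨hA, ?_⟩ (by omega)
      simp [hv, Holds, h1]
  | all b φ ih =>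
    intro d s hw hB
    have hw0 := hw
    simp only [wf, Bool.and_eq_true, decide_eq_true_eq] at hw
    refine Run.seq 2 (10 + B * (φ.time B + 10)) ?_ (by simp only [time]; omega)
    refine Run.assign rfl (Nat.zero_le _) ?_ (by simp [Expr.cost])
    refine Run.seq 2 (8 + B * (φ.time B + 10)) ?_ (by omega)
    refine Run.bdd fun hb0 => ?_
    have h2 := hb0.two_le
    refine Run.assign rfl (by simp [Expr.eval]; omega) ?_ (by simp [Expr.cost])
    simp only [Expr.eval]
    have hlt : ∀ s' : State, (∀ x, x < 100 + d → x ≠ 99 → s'.var x = s.var x) →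
        s'.var b = s.var b := fun s' h => h b (by omega) (by omega)
    -- Variable 99 tells whether all instances tested so far hold. The guard is its product with the
    -- comparison of counter and bound, so the loop stops after the first counterexample. The
    -- potential counts the instances that are left.
    refine Run.loop (fun s' => Agree d s s' ∧ s'.var (100 + d) ≤ s.var b ∧
      s'.var 99 = if ∀ j < s'.var (100 + d), φ.Holds (d + 1) (s.setVar (100 + d) j) then 1 else 0)
      (fun s' => (s.var b - s'.var (100 + d)) * (φ.time B + 10)) rfl ?_ ?_ ?_ ?_
    · refine ⟨⟨fun x hx hx' => ?_, rfl⟩, ?_, ?_⟩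
      · simp only [State.setVar_var, if_neg hx']; rw [if_neg (by omega)]
      · simp only [State.setVar_var]; rw [if_neg (by omega)]; simp
      · simp only [State.setVar_var, if_true]; rw [if_neg (show 100 + d ≠ 99 by omega)]; simp
    · rintro s' hb' - ⟨hA, hle, hv⟩ he
      simp only [Expr.eval_bin, Expr.eval_var, BinOp.apply_lt, BinOp.apply_mul] at he
      have hlt' := hlt s' hA.1
      have hi : s'.var (100 + d) < s.var b := by
        by_contra hc; rw [hlt', if_neg hc] at he; simp at he
      have hall : ∀ j < s'.var (100 + d), φ.Holds (d + 1) (s.setVar (100 + d) j) := by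
        by_contra hc; rw [hv, if_neg hc] at he; simp at he
      have hA1 : Agree (d + 1) (s.setVar (100 + d) (s'.var (100 + d))) s' := by
        refine ⟨fun x hx hx' => ?_, hA.2⟩
        simp only [State.setVar_var]
        split_ifs with hh
        · rw [hh]
        · exact hA.1 x (by omega) hx'
      refine ⟨φ.time B + 4, ?_⟩
      refine Run.seq (φ.time B) 4 ((ih hw.2 (hB.2.agree hA hw.2)).mono le_rfl ?_) le_rfl
      rintro s'' hb'' - ⟨hA'', hv''⟩
      have hx'' : s''.var (100 + d) = s'.var (100 + d) := hA''.1 _ (by omega) (by omega)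
      refine Run.assign rfl ?_ ?_ (by simp [Expr.cost])
      · simp only [Expr.eval_bin, Expr.eval_const, Expr.eval_var, BinOp.apply_add, hx'']
        exact le_trans hi ((hlt' ▸ hb'.var_le b))
      · simp only [Expr.eval_bin, Expr.eval_const, Expr.eval_var, BinOp.apply_add, hx'']
        refine ⟨⟨⟨fun x hx hx' => ?_, hA''.2.trans hA.2⟩, ?_, ?_⟩, ?_⟩
        · simp only [State.setVar_var]
          rw [if_neg (by omega), hA''.1 x (by omega) hx', hA.1 x hx hx']
        · simp [State.setVar_var]; omega
        · simp only [State.setVar_var, if_true]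
          rw [if_neg (by omega), hv'', hA1.holds hw.2]
          congr 1
          apply propext
          constructor
          · intro h j hj
            rcases Nat.lt_succ_iff_lt_or_eq.mp hj with hj | rfl
            · exact hall j hj
            · exact h
          · intro h; exact h _ (Nat.lt_succ_self _)
        · simp only [State.setVar_var, if_true, Expr.cost]
          obtain ⟨m, hm⟩ : ∃ m, s.var b = s'.var (100 + d) + 1 + m :=
            ⟨s.var b - (s'.var (100 + d) + 1), by omega⟩
          rw [hm, show s'.var (100 + d) + 1 + m - (s'.var (100 + d) + 1) = m by omega,
            show s'.var (100 + d) + 1 + m - s'.var (100 + d) = m + 1 by omega, Nat.add_mul]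
          omega
    · rintro s' hb' - ⟨hA, hle, hv⟩ he
      refine ⟨hA, ?_⟩
      simp only [Expr.eval_bin, Expr.eval_var, BinOp.apply_lt, BinOp.apply_mul, hlt s' hA.1] at he
      rw [hv]
      congr 1
      apply propext
      simp only [Holds]
      constructor
      · intro h
        rw [hv, if_pos h] at he
        have : s'.var (100 + d) = s.var b := by
          by_contra hc
          rw [if_pos (by omega)] at he
          simp at he
        rwa [this] at h
      · intro h j hj
        exact h j (by omega)
    · simp only [State.setVar_var, Expr.cost]
      rw [if_neg (by omega), if_pos trivial]
      have : s.var b * (φ.time B + 10) ≤ B * (φ.time B + 10) := Nat.mul_le_mul_right _ hB.1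
      simp only [Nat.sub_zero]
      omega

end Fm

end RAM

namespace MEG

open SimpleGraph

/-! ### Chordal graphs -/

section Chordal

variable {V : Type*} {G : SimpleGraph V}

/-- A walk between two adjacent vertices that avoids their edge has length at least two. -/
theorem length_shortcut_lt {x a b y : V} (p₁ : G.Walk x a) (m : G.Walk a b) (p₃ : G.Walk b y)
    (hab : G.Adj a b) (hm : s(a, b) ∉ m.edges) :
    (p₁.append (.cons hab p₃)).length < (p₁.append (m.append p₃)).length := by
  cases m with
  | nil => exact absurd hab (G.loopless.irrefl _)
  | cons h q =>
    cases q with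
    | nil => simp at hm
    | cons h' r => simp

/-- In a chordal graph, an edge that lies on a cycle lies in a triangle whose third vertex is on the
cycle. -/
theorem IsChordal.exists_common_neighbor (hG : IsChordal G) {x y : V} (h : G.Adj x y) :
    ∀ p : G.Walk x y, s(x, y) ∉ p.edges → ∃ z ∈ p.support, G.Adj z x ∧ G.Adj z y := by
  classical
  -- Induction on the length: pass to a path, close it with xy to a cycle and shortcut it along a
  -- chord. The chord is not xy, which belongs to the cycle, so the shorter walk still avoids xy. At
  -- length two the middle vertex is the common neighbour.
  suffices H : ∀ k, ∀ p : G.Walk x y, p.length = k → s(x, y) ∉ p.edges →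
      ∃ z ∈ p.support, G.Adj z x ∧ G.Adj z y from fun p => H _ p rfl
  intro k
  induction k using Nat.strong_induction_on with
  | _ k ih =>
  intro p hk hp
  by_cases hpath : p.IsPath
  swap
  · have hlt : p.bypass.length < k := by
      rcases lt_or_eq_of_le p.length_bypass_le_length with hl | hl
      · omega
      · exfalso
        apply hpath
        have := p.bypass_isPath
        rwa [p.bypass_eq_self_of_length_le_length_bypass hl.ge] at this
    obtain ⟨z, hz, hz'⟩ := ih _ hlt p.bypass rfl (fun hc => hp (p.edges_bypass_subset_edges hc))
    exact ⟨z, p.support_bypass_subset_support hz, hz'⟩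
  have hcyc : (Walk.cons h.symm p).IsCycle := by
    rw [Walk.cons_isCycle_iff]
    exact ⟨hpath, by rwa [Sym2.eq_swap]⟩
  by_cases hlen : 4 ≤ (Walk.cons h.symm p).length
  · obtain ⟨a, ha, b, hb, hab, hne⟩ := hG _ _ hcyc hlen
    have hsup : ∀ c ∈ (Walk.cons h.symm p).support, c ∈ p.support := by
      intro c hc
      rw [Walk.support_cons, List.mem_cons] at hc
      rcases hc with rfl | hc
      · exact p.end_mem_support
      · exact hc
    have ha := hsup a ha
    have hb := hsup b hb
    rw [Walk.edges_cons, List.mem_cons, not_or] at hne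
    obtain ⟨hne1, hne2⟩ := hne
    -- Here a and b are the ends of the chord in the order in which the path visits them.
    have key : ∀ a b (p₁ : G.Walk x a) (m : G.Walk a b) (p₃ : G.Walk b y), G.Adj a b →
        s(a, b) ≠ s(y, x) → s(a, b) ∉ p.edges → p = p₁.append (m.append p₃) →
        ∃ z ∈ p.support, G.Adj z x ∧ G.Adj z y := by
      intro a b p₁ m p₃ hab hne1 hne2 heq
      have hm : s(a, b) ∉ m.edges := fun hc => hne2 (by rw [heq]; simp [hc])
      have hlt := length_shortcut_lt p₁ m p₃ hab hm
      rw [← heq, hk] at hlt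
      obtain ⟨z, hz, hz'⟩ := ih _ hlt (p₁.append (.cons hab p₃)) rfl (by
        rw [heq] at hp
        simp only [Walk.edges_append, Walk.edges_cons, List.mem_append, List.mem_cons,
          not_or] at hp ⊢
        exact ⟨hp.1, fun hc => hne1 (by rw [← hc, Sym2.eq_swap]), hp.2.2⟩)
      refine ⟨z, ?_, hz'⟩
      rw [heq]
      simp only [Walk.mem_support_append_iff, Walk.support_cons, List.mem_cons] at hz ⊢
      rcases hz with hz | rfl | hz
      · exact .inl hz
      · exact .inl p₁.end_mem_support
      · exact .inr (.inr hz)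
    by_cases hb' : b ∈ (p.dropUntil a ha).support
    · refine key a b (p.takeUntil a ha) ((p.dropUntil a ha).takeUntil b hb')
        ((p.dropUntil a ha).dropUntil b hb') hab hne1 hne2 ?_
      rw [Walk.take_spec, Walk.take_spec]
    · have hb'' : b ∈ (p.takeUntil a ha).support := by
        rw [← Walk.take_spec p ha, Walk.mem_support_append_iff] at hb
        exact hb.resolve_right hb'
      refine key b a ((p.takeUntil a ha).takeUntil b hb'') ((p.takeUntil a ha).dropUntil b hb'')
        (p.dropUntil a ha) hab.symm (by rwa [Sym2.eq_swap]) (by rwa [Sym2.eq_swap]) ?_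
      rw [Walk.append_assoc, Walk.take_spec, Walk.take_spec]
  · cases p with
    | nil => exact absurd h (G.loopless.irrefl _)
    | cons h1 q =>
      cases q with
      | nil => simp at hp
      | cons h2 r =>
        cases r with
        | nil => exact ⟨_, by simp, h1.symm, h2⟩
        | cons h3 r' => simp at hlen

/-- The number of neighbours of later vertices among the vertices before `b` is at most that of `b`:
the vertices are numbered by maximum cardinality search. -/
def IsMCS [Fintype V] (G : SimpleGraph V) (num : V → ℕ) : Prop := by
  classical exact ∀ b c, num b < num c →
    (Finset.univ.filter fun x => G.Adj x c ∧ num x < num b).card ≤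
      (Finset.univ.filter fun x => G.Adj x b ∧ num x < num b).card

/-- Otherwise the neighbours of b before b would form a proper subset of the neighbours of c before
b, with a missing, and c would have been preferred to b. -/
theorem IsMCS.exists_adj [Fintype V] {num : V → ℕ} (h : IsMCS G num) {a b c : V}
    (hab : num a < num b) (hbc : num b < num c) (hac : G.Adj a c) (hnab : ¬ G.Adj a b) :
    ∃ d, num d < num b ∧ G.Adj d b ∧ ¬ G.Adj d c := by
  classical
  by_contra! hcon
  have := h b c hbc
  refine absurd this (not_le.mpr (Finset.card_lt_card ⟨fun x hx => ?_, fun hsub => ?_⟩))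
  · simp only [Finset.mem_filter, Finset.mem_univ, true_and] at hx ⊢
    exact ⟨hcon x hx.2 hx.1, hx.2⟩
  · have : a ∈ Finset.univ.filter fun x => G.Adj x b ∧ num x < num b := hsub (by simp [hac, hab])
    simp only [Finset.mem_filter] at this
    exact hnab this.2.1

/-- The walk a, c, b through a later vertex c is generalised to walks with all inner vertices after
b, for the sake of a double induction on the number of b and on the length. If a and b are not
adjacent and v is the first inner vertex, the search rule yields d before b that is adjacent to b
but not to v. By induction a and d are adjacent, so the edge av closes a cycle through d and b, on
which a and v have a common neighbour z. As d is not adjacent to v, z lies on the walk from v to b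
and shortcuts the given walk. -/
theorem IsMCS.adj_of_walk [Fintype V] (hG : IsChordal G) {num : V → ℕ}
    (h : IsMCS G num) (hnum : Function.Injective num) : ∀ (k l : ℕ) (a b : V) (p : G.Walk a b),
    num b = k → p.length = l → num a < num b →
    (∀ z ∈ p.support, z ≠ a → z ≠ b → num b < num z) → G.Adj a b := by
  classical
  intro k
  induction k using Nat.strong_induction_on with
  | _ k ihk =>
  intro l
  induction l using Nat.strong_induction_on with
  | _ l ihl =>
  intro a b p hk hl hab hp
  by_cases hpath : p.IsPath
  swap
  · have hlt : p.bypass.length < l := by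
      rcases lt_or_eq_of_le p.length_bypass_le_length with hl | hl
      · omega
      · exfalso
        apply hpath
        have := p.bypass_isPath
        rwa [p.bypass_eq_self_of_length_le_length_bypass hl.ge] at this
    exact ihl _ hlt a b p.bypass hk rfl hab fun z hz => hp z (p.support_bypass_subset_support hz)
  by_contra hnab
  cases p with
  | nil => omega
  | @cons _ v _ hav q =>
    rw [Walk.cons_isPath_iff] at hpath
    have hva : v ≠ a := hav.ne'
    have hvb : v ≠ b := by rintro rfl; exact hnab hav
    have hbv : num b < num v := hp v (by simp) hva hvb
    obtain ⟨d, hdb, hadj, hnadj⟩ := h.exists_adj hab hbv hav hnab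
    have hda : d ≠ a := by rintro rfl; exact hnab hadj
    have hdv : d ≠ v := by rintro rfl; omega
    have hsup : ∀ z ∈ (Walk.cons hav q).support, z ≠ a → num b ≤ num z := by
      intro z hz hza
      by_cases hzb : z = b
      · rw [hzb]
      · exact (hp z hz hza hzb).le
    -- The inner vertices of the walk prolonged to d have numbers at least that of b, and both ends
    -- come before b. The outer induction applies to the later end, whichever it is.
    have had : G.Adj a d := by
      let w := (Walk.cons hav q).append (.cons hadj.symm .nil)
      have hw : ∀ z ∈ w.support, z ≠ a → z ≠ d → num b ≤ num z := by
        intro z hz hza hzd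
        simp only [w, Walk.mem_support_append_iff] at hz
        rcases hz with hz | hz
        · exact hsup z hz hza
        · simp only [Walk.support_cons, Walk.support_nil, List.mem_cons, List.not_mem_nil,
            or_false] at hz
          rcases hz with rfl | rfl
          · exact le_rfl
          · exact absurd rfl hzd
      rcases lt_trichotomy (num a) (num d) with hlt | heq | hlt
      · exact ihk (num d) (by omega) _ a d w rfl rfl hlt fun z hz hza hzd => by
          have := hw z hz hza hzd
          omega
      · exact absurd (hnum heq) hda.symm
      · refine (ihk (num a) (by omega) _ d a w.reverse rfl rfl hlt fun z hz hzd hza => ?_).symm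
        rw [Walk.support_reverse, List.mem_reverse] at hz
        have := hw z hz hza hzd
        omega
    let w : G.Walk a v := .cons had (.cons hadj q.reverse)
    have hw : s(a, v) ∉ w.edges := by
      simp only [w, Walk.edges_cons, Walk.edges_reverse, List.mem_cons, List.mem_reverse, not_or]
      refine ⟨?_, ?_, fun hc => hpath.2 (q.fst_mem_support_of_mem_edges hc)⟩
      · intro hc
        rw [Sym2.eq_iff] at hc
        rcases hc with ⟨-, hc⟩ | ⟨hc, -⟩
        · exact hdv hc.symm
        · exact hda hc.symm
      · intro hc
        rw [Sym2.eq_iff] at hc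
        rcases hc with ⟨hc, -⟩ | ⟨-, hc⟩
        · exact hda hc.symm
        · exact hdv hc.symm
    obtain ⟨z, hz, hza, hzv⟩ := hG.exists_common_neighbor hav w hw
    simp only [w, Walk.support_cons, Walk.support_reverse, List.mem_cons, List.mem_reverse] at hz
    have hzd : z ≠ d := by rintro rfl; exact hnadj hzv
    have hz : z ∈ q.support := by
      rcases hz with rfl | rfl | hz
      · exact absurd hza (G.loopless.irrefl _)
      · exact absurd rfl hzd
      · exact hz
    have hlen : (q.dropUntil z hz).length < q.length := by
      have h1 := congrArg Walk.length (q.take_spec hz)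
      rw [Walk.length_append] at h1
      have h2 : (q.takeUntil z hz).length ≠ 0 := fun hc => hzv.ne
          (Walk.eq_of_length_eq_zero hc).symm
      omega
    refine hnab (ihl _ ?_ a b (.cons hza.symm (q.dropUntil z hz)) hk rfl hab ?_)
    · simp only [Walk.length_cons] at hl ⊢; omega
    · intro y hy hya hyb
      simp only [Walk.support_cons, List.mem_cons] at hy
      refine hp y ?_ hya hyb
      rw [Walk.support_cons, List.mem_cons]
      exact hy.imp_right fun hy => q.support_dropUntil_subset_support hz hy

/-- In the numbering of a chordal graph by maximum cardinality search, the earlier neighbours of a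
vertex form a clique. -/
theorem IsMCS.adj [Fintype V] (hG : IsChordal G) {num : V → ℕ}
    (h : IsMCS G num) (hnum : Function.Injective num) {a b c : V} (hac : G.Adj a c)
    (hbc : G.Adj b c) (ha : num a < num c) (hb : num b < num c) (hne : a ≠ b) : G.Adj a b := by
  have key : ∀ a b, G.Adj a c → G.Adj b c → num a < num b → num b < num c → G.Adj a b := by
    intro a b hac hbc hab hb
    refine h.adj_of_walk hG hnum _ _ a b (.cons hac (.cons hbc.symm .nil)) rfl rfl hab ?_
    intro z hz hza hzb
    simp only [Walk.support_cons, Walk.support_nil, List.mem_cons, List.not_mem_nil,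
      or_false] at hz
    rcases hz with rfl | rfl | rfl
    · exact absurd rfl hza
    · exact hb
    · exact absurd rfl hzb
  rcases lt_trichotomy (num a) (num b) with hlt | heq | hlt
  · exact key a b hac hbc hlt hb
  · exact absurd (hnum heq) hne
  · exact (key b a hbc hac hlt ha).symm

end Chordal

/-! ### Monitoring in chordal graphs -/

section Monitor

variable {V : Type*} {G : SimpleGraph V}

/-- The function `δ` (a distance from some source) is smaller at `x` than at `y` and all common
neighbours of `x` and `y`. -/
def Favours (G : SimpleGraph V) (δ : V → ℕ∞) (x y : V) : Prop :=
  ∀ z, (z = y ∨ G.Adj z x ∧ G.Adj z y) → δ x < δ z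

theorem Favours.lt {δ : V → ℕ∞} {x y : V} (h : Favours G δ x y) : δ x < δ y := h y (.inl rfl)

theorem Favours.reachable {u x y : V} (h : Favours G (G.edist u) x y) : G.Reachable u x := by
  have := h.lt
  rw [← edist_ne_top_iff_reachable]
  exact (lt_of_lt_of_le this le_top).ne

theorem edist_le_of_mem_support {u v z : V} (p : G.Walk u v) (hz : z ∈ p.support) :
    G.edist u z ≤ p.length ∧ G.edist z v ≤ p.length ∧ G.edist u z + G.edist z v ≤ p.length := by
  classical
  have h := congrArg Walk.length (p.take_spec hz)
  rw [Walk.length_append] at h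
  have h1 := (p.takeUntil z hz).edist_le
  have h2 := (p.dropUntil z hz).edist_le
  have h3 : G.edist u z + G.edist z v ≤ p.length := by
    rw [← h]; push_cast; exact add_le_add h1 h2
  exact ⟨le_self_add.trans h3, le_add_self.trans h3, h3⟩

/-- Suppose that a shortest path p from u to w avoids xy. Prolonged by shortest paths from x to u
and from w to y it still avoids xy, so by chordality it contains a common neighbour z of x and y.
The vertices of the two prolongations are at most as far from u as x, or at most as far from w as y,
so z is not among them. If z were on p, then p would be longer than the walk from u to w through xy.
-/
theorem monitors_of_favours (hG : IsChordal G) {u w x y : V} (hxy : G.Adj x y)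
    (hu : Favours G (G.edist u) x y) (hw : Favours G (G.edist w) y x) :
    Monitors G u w s(x, y) := by
  classical
  have hux := hu.reachable
  have hwy := hw.reachable
  refine ⟨(hux.trans hxy.reachable).trans hwy.symm, fun p hp => ?_⟩
  by_contra hcon
  obtain ⟨q₁, hq₁⟩ := hux.exists_walk_length_eq_edist
  obtain ⟨q₂, hq₂⟩ := hwy.exists_walk_length_eq_edist
  have n₁ : y ∉ q₁.support := fun hc =>
    absurd ((edist_le_of_mem_support q₁ hc).1.trans hq₁.le) (not_le.mpr hu.lt)
  have n₂ : x ∉ q₂.support := fun hc =>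
    absurd ((edist_le_of_mem_support q₂ hc).1.trans hq₂.le) (not_le.mpr hw.lt)
  obtain ⟨z, hz, hzx, hzy⟩ := hG.exists_common_neighbor hxy (q₁.reverse.append (p.append q₂)) (by
    simp only [Walk.edges_append, Walk.edges_reverse, List.mem_append, List.mem_reverse, not_or]
    exact ⟨fun hc => n₁ (q₁.snd_mem_support_of_mem_edges hc), hcon,
      fun hc => n₂ (q₂.fst_mem_support_of_mem_edges hc)⟩)
  have hz1 := hu z (.inr ⟨hzx, hzy⟩)
  have hz2 := hw z (.inr ⟨hzy, hzx⟩)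
  simp only [Walk.mem_support_append_iff, Walk.support_reverse, List.mem_reverse] at hz
  rcases hz with hz | hz | hz
  · exact absurd ((edist_le_of_mem_support q₁ hz).1.trans hq₁.le) (not_le.mpr hz1)
  · have h1 := (edist_le_of_mem_support p hz).2.2
    have h2 : (p.length : ℕ∞) ≤ G.edist u x + 1 + G.edist w y := by
      have := dist_le ((q₁.append (.cons hxy .nil)).append q₂.reverse)
      rw [← hp] at this
      simp only [Walk.length_append, Walk.length_cons, Walk.length_nil, Walk.length_reverse] at this
      rw [← hq₁, ← hq₂]
      exact_mod_cast by omega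
    have h3 : G.edist u x + 1 ≤ G.edist u z := Order.add_one_le_of_lt hz1
    have h4 : G.edist w y + 1 ≤ G.edist z w := by
      rw [G.edist_comm (u := z)]; exact Order.add_one_le_of_lt hz2
    have h5 := (add_le_add h3 h4).trans (h1.trans h2)
    rw [← hq₁, ← hq₂] at h5
    norm_cast at h5
    omega
  · exact absurd ((edist_le_of_mem_support q₂ hz).1.trans hq₂.le) (not_le.mpr hz2)

/-- A common neighbour z that is no farther from u than x would give a shortest path that reaches y
through z and avoids xy. For z = y it would give a walk shorter than the distance. -/
theorem favours_of_walk {u v x y : V} (hxy : G.Adj x y) (p₁ : G.Walk u x) (p₂ : G.Walk y v)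
    (hl : p₁.length + 1 + p₂.length = G.dist u v)
    (hall : ∀ p : G.Walk u v, p.length = G.dist u v → s(x, y) ∈ p.edges) :
    Favours G (G.edist u) x y := by
  classical
  have h1 : G.edist u x ≤ p₁.length := p₁.edist_le
  intro z hz
  refine lt_of_le_of_lt h1 ?_
  by_contra hcon
  rw [not_lt] at hcon
  have hr : G.Reachable u z := by
    rw [← edist_ne_top_iff_reachable]
    exact (lt_of_le_of_lt hcon (ENat.natCast_lt_top _)).ne
  obtain ⟨q, hq⟩ := hr.exists_walk_length_eq_edist
  rw [← hq] at hcon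
  have hcon : q.length ≤ p₁.length := by exact_mod_cast hcon
  rcases hz with rfl | ⟨hzx, hzy⟩
  · have := dist_le (q.append p₂)
    rw [Walk.length_append] at this
    omega
  · have h2 := dist_le (q.append (.cons hzy p₂))
    have h3 := hall (q.append (.cons hzy p₂)) (by
      simp only [Walk.length_append, Walk.length_cons] at h2 ⊢; omega)
    simp only [Walk.edges_append, Walk.edges_cons, List.mem_append, List.mem_cons] at h3
    rcases h3 with h3 | h3 | h3
    · have hy := q.snd_mem_support_of_mem_edges h3
      have := dist_le ((q.takeUntil y hy).append p₂)
      rw [Walk.length_append] at this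
      have := q.length_takeUntil_le_length hy
      omega
    · rw [Sym2.eq_iff] at h3
      rcases h3 with ⟨h3, -⟩ | ⟨-, h3⟩
      · exact hzx.ne h3.symm
      · exact hzy.ne h3.symm
    · have hx := p₂.fst_mem_support_of_mem_edges h3
      have := dist_le (p₁.append (p₂.dropUntil x hx))
      rw [Walk.length_append] at this
      have h4 := p₂.length_dropUntil_le_length hx
      omega

/-- Which of u and v favours x is decided by the direction in which a shortest path traverses xy.
Reversing all paths gives the statement for the other end. -/
theorem favours_of_monitors {u v x y : V} (h : Monitors G u v s(x, y)) :
    (Favours G (G.edist u) x y ∧ Favours G (G.edist v) y x) ∨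
      (Favours G (G.edist v) x y ∧ Favours G (G.edist u) y x) := by
  classical
  obtain ⟨hr, hall⟩ := h
  obtain ⟨p, hp⟩ := hr.exists_walk_length_eq_dist
  have key : ∀ x y, G.Adj x y → (∀ p : G.Walk u v, p.length = G.dist u v → s(x, y) ∈ p.edges) →
      (∃ (p₁ : G.Walk u x) (p₂ : G.Walk y v), p₁.length + 1 + p₂.length = G.dist u v) →
      Favours G (G.edist u) x y ∧ Favours G (G.edist v) y x := by
    rintro x y hxy hall ⟨p₁, p₂, hl⟩
    refine ⟨favours_of_walk hxy p₁ p₂ hl hall,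
      favours_of_walk hxy.symm p₂.reverse p₁.reverse ?_ ?_⟩
    · rw [G.dist_comm, ← hl]; simp only [Walk.length_reverse]; omega
    · intro q hq
      have := hall q.reverse (by rw [Walk.length_reverse, hq, G.dist_comm])
      rwa [Walk.edges_reverse, List.mem_reverse, Sym2.eq_swap] at this
  have hmem := hall p hp
  have hxy : G.Adj x y := p.adj_of_mem_edges hmem
  have hd : ∃ d ∈ p.darts, d.edge = s(x, y) := by
    simpa [Walk.edges] using hmem
  obtain ⟨d, hd, hde⟩ := hd
  have split : ∀ {a b : V} (q : G.Walk a b), d ∈ q.darts →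
      ∃ (p₁ : G.Walk a d.fst) (p₂ : G.Walk d.snd b), p₁.length + 1 + p₂.length = q.length := by
    intro a b q
    induction q with
    | nil => simp
    | @cons a c b h r ih =>
      intro hm
      rw [Walk.darts_cons, List.mem_cons] at hm
      rcases hm with rfl | hm
      · exact ⟨.nil, r, by simp; omega⟩
      · obtain ⟨p₁, p₂, hl⟩ := ih hm
        exact ⟨.cons h p₁, p₂, by simp; omega⟩
  obtain ⟨p₁, p₂, hl⟩ := split p hd
  rw [hp] at hl
  have hde' : s(d.fst, d.snd) = s(x, y) := hde
  rw [Sym2.eq_iff] at hde'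
  rcases hde' with ⟨h1, h2⟩ | ⟨h1, h2⟩
  · left
    exact key x y hxy hall ⟨p₁.copy rfl h1, p₂.copy h2 rfl, by simpa using hl⟩
  · right
    exact (key y x hxy.symm (by rwa [Sym2.eq_swap]) ⟨p₁.copy rfl h1, p₂.copy h2 rfl,
      by simpa using hl⟩).symm

/-- In a chordal graph the two ends of a monitoring pair can be chosen independently. -/
theorem isMEGSet_iff (hG : IsChordal G) (M : Finset V) :
    IsMEGSet G M ↔ ∀ x y, G.Adj x y → ∃ u ∈ M, Favours G (G.edist u) x y := by
  constructor
  · intro h x y hxy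
    obtain ⟨u, hu, v, hv, hm⟩ := h s(x, y) hxy
    rcases favours_of_monitors hm with hf | hf
    · exact ⟨u, hu, hf.1⟩
    · exact ⟨v, hv, hf.1⟩
  · intro h e he
    induction e with
    | _ x y =>
      obtain ⟨u, hu, hfu⟩ := h x y he
      obtain ⟨w, hw, hfw⟩ := h y x he.symm
      exact ⟨u, hu, w, hw, monitors_of_favours hG he hfu hfw⟩

end Monitor

end MEG

namespace MEG

open SimpleGraph

/-! ### Cliques and treewidth -/

section Treewidth

theorem exists_isPath_of_induce_connected {ι : Type*} {T : SimpleGraph ι} {S : Set ι}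
    (hS : (T.induce S).Connected) {a b : ι} (ha : a ∈ S) (hb : b ∈ S) :
    ∃ p : T.Walk a b, p.IsPath ∧ ∀ z ∈ p.support, z ∈ S := by
  obtain ⟨p, hp⟩ := hS.exists_path_of_dist ⟨a, ha⟩ ⟨b, hb⟩
  let f : T.induce S →g T := (Embedding.induce S).toHom
  refine ⟨p.map f, hp.1.map (f := f) Subtype.val_injective, fun z hz => ?_⟩
  have hz : z ∈ p.support.map f := by
    have := Walk.support_map (f := f) (p := p)
    rwa [← this]
  rw [List.mem_map] at hz
  obtain ⟨w, -, rfl⟩ := hz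
  exact w.2

/-- The node of a subtree that is nearest to `t` lies in every subtree that contains `t` and meets
the given one. -/
theorem exists_gate {ι : Type*} {T : SimpleGraph ι} (hT : T.IsTree) {S : Set ι}
    (hS : (T.induce S).Connected) (t : ι) :
    ∃ g ∈ S, ∀ C : Set ι, (T.induce C).Connected → t ∈ C → (∃ s ∈ S, s ∈ C) → g ∈ C := by
  classical
  obtain ⟨g, hg, hmin⟩ : ∃ g ∈ S, ∀ s ∈ S, T.dist t g ≤ T.dist t s := by
    obtain ⟨⟨s, hs⟩⟩ := hS.nonempty
    obtain ⟨g, hg, hmin⟩ := WellFounded.has_min (InvImage.wf (fun x => T.dist t x) Nat.lt_wfRel.wf)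
      S ⟨s, hs⟩
    exact ⟨g, hg, fun s hs => not_lt.mp (hmin s hs)⟩
  refine ⟨g, hg, fun C hC htC ⟨s, hsS, hsC⟩ => ?_⟩
  obtain ⟨p₀, hp₀, hlen⟩ := hT.connected.exists_path_of_dist t g
  obtain ⟨p₁, hp₁, hp₁S⟩ := exists_isPath_of_induce_connected hS hg hsS
  obtain ⟨p₂, hp₂, hp₂C⟩ := exists_isPath_of_induce_connected hC htC hsC
  have hmeet : ∀ z ∈ p₀.support, z ∈ S → z = g := by
    intro z hz hzS
    have h1 := congrArg Walk.length (p₀.take_spec hz)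
    rw [Walk.length_append] at h1
    have h2 := dist_le (p₀.takeUntil z hz)
    have h3 := hmin z hzS
    exact Walk.eq_of_length_eq_zero (p := p₀.dropUntil z hz) (by omega)
  -- The shortest path from t to g meets S only in g, so it continues inside S to a path from t to
  -- s. This is the only such path in the tree, and hence it is the one that runs inside C.
  have happ : (p₀.append p₁).IsPath := by
    rw [Walk.isPath_def, Walk.support_append]
    refine List.Nodup.append hp₀.support_nodup (hp₁.support_nodup.sublist (List.tail_sublist _)) ?_
    intro z hz hz'
    have hzg := hmeet z hz (hp₁S z (List.mem_of_mem_tail hz'))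
    subst hzg
    have := hp₁.support_nodup
    rw [← Walk.cons_tail_support, List.nodup_cons] at this
    exact this.1 hz'
  have heq := congrArg Subtype.val
      ((hT.isAcyclic.subsingleton_path t s).elim ⟨p₀.append p₁, happ⟩ ⟨p₂, hp₂⟩)
  simp only at heq
  refine hp₂C g ?_
  rw [← heq, Walk.mem_support_append_iff]
  exact .inl p₀.end_mem_support

theorem exists_treeDecomposition {V : Type*} [Fintype V] (G : SimpleGraph V) :
    ∃ (m : ℕ) (T : SimpleGraph (Fin m)) (X : Fin m → Finset V),
      IsTreeDecomposition G T X ∧ ∀ t, (X t).card ≤ treewidth G + 1 := by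
  refine Nat.sInf_mem (s := {w : ℕ | ∃ (m : ℕ) (T : SimpleGraph (Fin m)) (X : Fin m → Finset V),
    IsTreeDecomposition G T X ∧ ∀ t, (X t).card ≤ w + 1})
    ⟨Fintype.card V, 1, ⊥, fun _ => Finset.univ, ⟨.of_subsingleton, fun v => ?_, fun u v _ =>
      ⟨0, Finset.mem_univ _, Finset.mem_univ _⟩⟩, fun t => by simp⟩
  have : Nonempty ({t : Fin 1 | v ∈ (Finset.univ : Finset V)} : Set (Fin 1)) := ⟨0, by simp⟩
  exact (IsTree.of_subsingleton).connected

/-- A clique is contained in some bag, so it has at most `treewidth + 1` vertices. -/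
theorem card_le_treewidth_add_one {V : Type*} [Fintype V] {G : SimpleGraph V} {Q : Finset V}
    (hQ : ∀ a ∈ Q, ∀ b ∈ Q, a ≠ b → G.Adj a b) : Q.card ≤ treewidth G + 1 := by
  classical
  obtain ⟨m, T, X, hX, hcard⟩ := exists_treeDecomposition G
  have := hX.isTree.connected.nonempty
  -- A bag that contains as many vertices of Q as possible contains all of Q. If it missed w, the
  -- gate of the subtree of w as seen from this bag would keep all the vertices of Q and gain w.
  obtain ⟨t, ht⟩ := Finite.exists_max fun t : Fin m => (X t ∩ Q).card
  suffices h : Q ⊆ X t from (Finset.card_le_card h).trans (hcard t)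
  intro w hw
  by_contra hwt
  obtain ⟨g, hg, hgate⟩ := exists_gate hX.isTree (hX.connected w) t
  refine absurd (ht g) (not_le.mpr (Finset.card_lt_card ⟨fun v hv => ?_, fun hsub => ?_⟩))
  · rw [Finset.mem_inter] at hv ⊢
    refine ⟨hgate _ (hX.connected v) hv.1 ?_, hv.2⟩
    have hne : w ≠ v := by rintro rfl; exact hwt hv.1
    exact hX.adj w v (hQ w hw v hv.2 hne)
  · exact hwt (Finset.mem_inter.mp (hsub (Finset.mem_inter.mpr ⟨hg, hw⟩))).1

end Treewidth

end MEG

namespace MEG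

open SimpleGraph

/-! ### Distances through separators -/

section Distance

variable {V : Type*} {G : SimpleGraph V}

/-- The vertices of `B` at which `δ` is finite and smallest. -/
def near (δ : V → ℕ∞) (B : Set V) : Set V := {x | x ∈ B ∧ δ x ≠ ⊤ ∧ ∀ z ∈ B, δ x ≤ δ z}

/-- Distance from the set `P`. -/
noncomputable def srcDist (G : SimpleGraph V) (P : Set V) (z : V) : ℕ∞ := ⨅ b ∈ P, G.edist b z

/-- Together with `Passes` this is all that is needed of a distance beyond a clique, so that
distances from a vertex and from a set can be treated alike. -/
def IsLip (G : SimpleGraph V) (δ : V → ℕ∞) : Prop := ∀ a b, δ b ≤ δ a + G.edist a b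

/-- The value of `δ` at `z` comes from a vertex of `K`. -/
def Passes (G : SimpleGraph V) (δ : V → ℕ∞) (K : Set V) (z : V) : Prop :=
  δ z = ⊤ ∨ ∃ k ∈ K, δ k + G.edist k z ≤ δ z

def IsCliqueSet (G : SimpleGraph V) (B : Set V) : Prop := ∀ a ∈ B, ∀ b ∈ B, a ≠ b → G.Adj a b

theorem isLip_edist (u : V) : IsLip G (G.edist u) := fun _ _ => G.edist_triangle

theorem exists_srcDist_eq {P : Set V} (hP : P.Nonempty) (z : V) :
    ∃ b ∈ P, srcDist G P z = G.edist b z := by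
  obtain ⟨b₀, hb₀⟩ := hP
  obtain ⟨b, hb, hmin⟩ := WellFounded.has_min (InvImage.wf (fun b => G.edist b z) wellFounded_lt)
    P ⟨b₀, hb₀⟩
  refine ⟨b, hb, le_antisymm (iInf₂_le b hb) (le_iInf₂ fun b' hb' => ?_)⟩
  exact not_lt.mp (hmin b' hb')

theorem srcDist_le {P : Set V} {b : V} (hb : b ∈ P) (z : V) : srcDist G P z ≤ G.edist b z :=
  iInf₂_le b hb

theorem srcDist_empty (z : V) : srcDist G ∅ z = ⊤ := by simp [srcDist]

theorem isLip_srcDist (P : Set V) : IsLip G (srcDist G P) := by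
  intro a b
  rcases P.eq_empty_or_nonempty with rfl | hP
  · simp [srcDist_empty]
  · obtain ⟨c, hc, h⟩ := exists_srcDist_eq (G := G) hP a
    rw [h]
    exact (srcDist_le hc b).trans G.edist_triangle

theorem exists_boundary {H K : Set V} (hHK : ∀ a ∈ H, ∀ b ∉ H, G.Adj a b → b ∈ K) {u z : V}
    (p : G.Walk u z) (hu : u ∈ H) (hz : z ∉ H) : ∃ k ∈ K, k ∈ p.support := by
  induction p with
  | nil => exact absurd hu hz
  | @cons u v z h q ih =>
    by_cases hv : v ∈ H
    · obtain ⟨k, hk, hk'⟩ := ih hv hz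
      exact ⟨k, hk, by simp [hk']⟩
    · exact ⟨v, hHK u hu v hv h, by simp⟩

theorem passes_edist_of_mem {H K : Set V} (hHK : ∀ a ∈ H, ∀ b ∉ H, G.Adj a b → b ∈ K) {u z : V}
    (hu : u ∈ H) (hz : z ∉ H) : Passes G (G.edist u) K z := by
  by_cases h : G.edist u z = ⊤
  · exact .inl h
  · obtain ⟨p, hp⟩ := (edist_ne_top_iff_reachable.mp h).exists_walk_length_eq_edist
    obtain ⟨k, hk, hkp⟩ := exists_boundary hHK p hu hz
    exact .inr ⟨k, hk, (edist_le_of_mem_support p hkp).2.2.trans hp.le⟩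

theorem passes_edist_of_notMem {H K : Set V} (hHK : ∀ a ∈ H, ∀ b ∉ H, G.Adj a b → b ∈ K)
    {u z : V} (hu : u ∉ H) (hz : z ∈ H) : Passes G (G.edist u) K z := by
  rcases passes_edist_of_mem hHK hz hu with h | ⟨k, hk, h⟩
  · exact .inl (by rw [G.edist_comm]; exact h)
  · refine .inr ⟨k, hk, ?_⟩
    rw [G.edist_comm (u := u) (v := k), G.edist_comm (u := k) (v := z),
      G.edist_comm (u := u) (v := z), add_comm]
    exact h

theorem passes_srcDist {H K P : Set V} (hHK : ∀ a ∈ H, ∀ b ∉ H, G.Adj a b → b ∈ K)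
    {z : V} (hP : ∀ u ∈ P, u ∉ H) (hz : z ∈ H) : Passes G (srcDist G P) K z := by
  rcases P.eq_empty_or_nonempty with rfl | hne
  · exact .inl (srcDist_empty z)
  · obtain ⟨b, hb, h⟩ := exists_srcDist_eq (G := G) hne z
    rcases passes_edist_of_notMem hHK (hP b hb) hz with h' | ⟨k, hk, h'⟩
    · exact .inl (h.trans h')
    · refine .inr ⟨k, hk, ?_⟩
      rw [h]
      exact (add_le_add_left (srcDist_le hb k) _).trans h'

theorem Passes.self {δ : V → ℕ∞} {K : Set V} {z : V} (hz : z ∈ K) : Passes G δ K z :=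
  .inr ⟨z, hz, by simp⟩

theorem one_le_edist {a b : V} (h : a ≠ b) : 1 ≤ G.edist a b :=
  Order.one_le_iff_pos.mpr (pos_iff_ne_zero.mpr fun hc => h (edist_eq_zero_iff.mp hc))

theorem lt_of_add_edist_le {δ : V → ℕ∞} {k z : V} (hkz : k ≠ z) (hz : δ z ≠ ⊤)
    (h : δ k + G.edist k z ≤ δ z) : δ k < δ z := by
  have h1 : δ k + 1 ≤ δ z := (add_le_add_right (one_le_edist hkz) _).trans h
  exact (ENat.add_one_le_iff (fun hc => hz (by rw [hc] at h1; simpa using h1))).mp h1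

theorem Passes.exists_lt {δ : V → ℕ∞} {K : Set V} {z : V} (h : Passes G δ K z) (hz : z ∉ K)
    (hfin : δ z ≠ ⊤) : ∃ k ∈ K, δ k < δ z := by
  rcases h with h | ⟨k, hk, h⟩
  · exact absurd h hfin
  · exact ⟨k, hk, lt_of_add_edist_le (by rintro rfl; exact hz hk) hfin h⟩

theorem near_nonempty {δ : V → ℕ∞} {B : Set V} {x : V} (hx : x ∈ B) (h : δ x ≠ ⊤) :
    (near δ B).Nonempty := by
  obtain ⟨b, hb, hmin⟩ := WellFounded.has_min (InvImage.wf δ wellFounded_lt) B ⟨x, hx⟩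
  have hle : ∀ z ∈ B, δ b ≤ δ z := fun z hz => not_lt.mp (hmin z hz)
  exact ⟨b, hb, fun hc => h (top_le_iff.mp (hc ▸ hle x hx)), hle⟩

theorem lt_of_notMem_near {δ : V → ℕ∞} {B : Set V} {x z : V} (hx : x ∈ near δ B) (hz : z ∈ B)
    (hz' : z ∉ near δ B) : δ x < δ z := by
  refine lt_of_le_of_ne (hx.2.2 z hz) fun heq => hz' ⟨hz, heq ▸ hx.2.1, fun y hy => ?_⟩
  rw [← heq]; exact hx.2.2 y hy

/-- Vertices reached only through `K` are not nearest. -/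
theorem near_eq_of_passes {δ : V → ℕ∞} {K B : Set V} (hKB : K ⊆ B)
    (h : ∀ z ∈ B, z ∉ K → Passes G δ K z) : near δ B = near δ K := by
  ext x
  constructor
  · rintro ⟨hxB, hfin, hmin⟩
    have hxK : x ∈ K := by
      by_contra hc
      obtain ⟨k, hk, hlt⟩ := (h x hxB hc).exists_lt hc hfin
      exact absurd (hmin k (hKB hk)) (not_le.mpr hlt)
    exact ⟨hxK, hfin, fun z hz => hmin z (hKB hz)⟩
  · rintro ⟨hxK, hfin, hmin⟩
    refine ⟨hKB hxK, hfin, fun z hz => ?_⟩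
    by_cases hzK : z ∈ K
    · exact hmin z hzK
    · by_cases hzt : δ z = ⊤
      · rw [hzt]; exact le_top
      · obtain ⟨k, hk, hlt⟩ := (h z hz hzK).exists_lt hzK hzt
        exact (hmin k hk).trans hlt.le

theorem edist_le_one {B : Set V} (hB : IsCliqueSet G B) {a b : V} (ha : a ∈ B) (hb : b ∈ B) :
    G.edist a b ≤ 1 := by
  by_cases h : a = b
  · subst h; simp
  · rw [edist_eq_one_iff_adj.mpr (hB a ha b hb h)]

/-- On the clique B the function takes only its minimum and possibly the minimum plus one. So if K
contains nearest vertices of B, these are the nearest ones of K, and otherwise the function is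
constant on K. -/
theorem mem_near_subset {δ : V → ℕ∞} (hδ : IsLip G δ) {K B : Set V} (hB : IsCliqueSet G B)
    (hKB : K ⊆ B) (hne : (near δ B).Nonempty) (x : V) :
    x ∈ near δ K ↔ x ∈ K ∧ (x ∈ near δ B ∨ ∀ y ∈ K, y ∉ near δ B) := by
  obtain ⟨m, hm⟩ := hne
  have hle : ∀ z ∈ B, δ z ≤ δ m + 1 := fun z hz =>
    (hδ m z).trans (add_le_add_right (edist_le_one hB hm.1 hz) _)
  have hfin : ∀ z ∈ B, δ z ≠ ⊤ := fun z hz hc => by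
    have := hle z hz
    rw [hc, top_le_iff] at this
    exact hm.2.1 (by simpa using this)
  constructor
  · rintro ⟨hxK, -, hmin⟩
    refine ⟨hxK, ?_⟩
    by_contra! hcon
    obtain ⟨hx, y, hy, hy'⟩ := hcon
    exact absurd (hmin y hy) (not_le.mpr (lt_of_notMem_near hy' (hKB hxK) hx))
  · rintro ⟨hxK, hx | hx⟩
    · exact ⟨hxK, hx.2.1, fun z hz => hx.2.2 z (hKB hz)⟩
    · refine ⟨hxK, hfin x (hKB hxK), fun z hz => (hle x (hKB hxK)).trans ?_⟩
      exact Order.add_one_le_of_lt (lt_of_notMem_near hm (hKB hz) (hx z hz))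

/-- Beyond a clique `B`, only the nearest vertices of `B` matter. -/
theorem favours_srcDist_near {δ : V → ℕ∞} (hδ : IsLip G δ) {B : Set V} (hB : IsCliqueSet G B)
    {x y : V} (hx : Passes G δ B x)
    (hz : ∀ z, (z = y ∨ G.Adj z x ∧ G.Adj z y) → Passes G δ B z) :
    Favours G (srcDist G (near δ B)) x y ↔ Favours G δ x y := by
  rcases (near δ B).eq_empty_or_nonempty with he | hne
  · constructor
    · intro h
      have := h.lt
      rw [he, srcDist_empty] at this
      exact absurd le_top (not_le.mpr this)
    · intro h
      exfalso
      rcases hx with hx | ⟨k, hk, hx⟩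
      · exact absurd le_top (not_le.mpr (hx ▸ h.lt))
      · by_cases hkt : δ k = ⊤
        · rw [hkt, top_add, top_le_iff] at hx
          exact absurd le_top (not_le.mpr (hx ▸ h.lt))
        · exact (near_nonempty hk hkt).ne_empty he
  · obtain ⟨m, hm⟩ := hne
    have hval : ∀ b ∈ near δ B, δ b = δ m := fun b hb =>
      le_antisymm (hb.2.2 m hm.1) (hm.2.2 b hb.1)
    -- Beyond B, δ is a constant plus the distance from the nearest vertices. A path through another
    -- vertex of B starts one higher, and this pays for the step from that vertex to a nearest one.
    have key : ∀ z, Passes G δ B z → δ z = δ m + srcDist G (near δ B) z := by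
      intro z hz
      refine le_antisymm ?_ ?_
      · obtain ⟨b, hb, h⟩ := exists_srcDist_eq (G := G) ⟨m, hm⟩ z
        rw [h, ← hval b hb]
        exact hδ b z
      · rcases hz with hz | ⟨k, hk, hz⟩
        · rw [hz]; exact le_top
        · by_cases hk' : k ∈ near δ B
          · rw [← hval k hk']
            exact (add_le_add_right (srcDist_le hk' z) _).trans hz
          · have h1 : δ m + 1 ≤ δ k := Order.add_one_le_of_lt (lt_of_notMem_near hm hk hk')
            have h2 : srcDist G (near δ B) z ≤ 1 + G.edist k z :=
              (srcDist_le hm z).trans (G.edist_triangle.trans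
                (add_le_add_left (edist_le_one hB hm.1 hk) _))
            calc δ m + srcDist G (near δ B) z ≤ δ m + (1 + G.edist k z) := add_le_add_right h2 _
              _ = δ m + 1 + G.edist k z := (add_assoc _ _ _).symm
              _ ≤ δ k + G.edist k z := add_le_add_left h1 _
              _ ≤ δ z := hz
    refine forall₂_congr fun z hzz => ?_
    rw [key x hx, key z (hz z hzz), ENat.add_lt_add_iff_left hm.2.1]

theorem near_srcDist_self {B P : Set V} (hPB : P ⊆ B) (hP : P.Nonempty) :
    near (srcDist G P) B = P := by
  have h0 : ∀ b ∈ P, srcDist G P b = 0 := fun b hb => by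
    have := srcDist_le (G := G) hb b
    rw [edist_self] at this
    exact le_antisymm this zero_le
  ext x
  constructor
  · rintro ⟨hxB, -, hmin⟩
    obtain ⟨b, hb, h⟩ := exists_srcDist_eq (G := G) hP x
    have h2 := hmin b (hPB hb)
    rw [h0 b hb, h, nonpos_iff_eq_zero, edist_eq_zero_iff] at h2
    exact h2 ▸ hb
  · intro hx
    refine ⟨hPB hx, by rw [h0 x hx]; simp, fun z _ => by rw [h0 x hx]; exact zero_le⟩

/-- If `δ` favours `x` over `y` then `x` is the only nearest vertex in every clique with both. -/
theorem Favours.near_eq {δ : V → ℕ∞} {x y : V} (h : Favours G δ x y) {B : Set V}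
    (hB : IsCliqueSet G B) (hx : x ∈ B) (hy : y ∈ B) : near δ B = {x} := by
  have hlt : ∀ z ∈ B, z ≠ x → δ x < δ z := by
    intro z hz hzx
    by_cases hzy : z = y
    · exact h z (.inl hzy)
    · exact h z (.inr ⟨hB z hz x hx hzx, hB z hz y hy hzy⟩)
  ext z
  constructor
  · rintro ⟨hzB, -, hmin⟩
    by_contra hzx
    exact absurd (hmin x hx) (not_le.mpr (hlt z hzB hzx))
  · rintro rfl
    refine ⟨hx, (lt_of_lt_of_le h.lt le_top).ne, fun w hw => ?_⟩
    by_cases hwz : w = z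
    · rw [hwz]
    · exact (hlt w hw hwz).le

end Distance

end MEG

namespace MEG

open SimpleGraph

/-! ### Elimination orderings and clusters -/

section Elimination

variable {V : Type*} {G : SimpleGraph V}

/-- The neighbours of `v` before `v`. -/
def earlier (G : SimpleGraph V) (num : V → ℕ) (v : V) : Set V := {w | G.Adj w v ∧ num w < num v}

/-- `v` and its earlier neighbours. -/
def bag (G : SimpleGraph V) (num : V → ℕ) (v : V) : Set V := insert v (earlier G num v)

/-- `num` numbers the vertices such that earlier neighbours form cliques; `par v` is the last
earlier neighbour of `v`; `col` is a proper colouring with fewer than `om` colours. -/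
structure Elim (G : SimpleGraph V) (num : V → ℕ) (par : V → V) (col : V → ℕ) (om : ℕ) :
    Prop where
  inj : Function.Injective num
  clique : ∀ v, IsCliqueSet G (earlier G num v)
  par_mem : ∀ v, (earlier G num v).Nonempty → par v ∈ earlier G num v
  le_par : ∀ v, ∀ w ∈ earlier G num v, num w ≤ num (par v)
  proper : ∀ u v, G.Adj u v → col u ≠ col v
  lt : ∀ v, col v < om

variable {num : V → ℕ} {par : V → V} {col : V → ℕ} {om : ℕ}

theorem earlier_subset_bag (v : V) : earlier G num v ⊆ bag G num v := Set.subset_insert _ _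

theorem mem_bag (v : V) : v ∈ bag G num v := Set.mem_insert _ _

theorem notMem_earlier (v : V) : v ∉ earlier G num v := fun h => lt_irrefl _ h.2

namespace Elim

theorem bag_clique (h : Elim G num par col om) (v : V) : IsCliqueSet G (bag G num v) := by
  rintro a (rfl | ha) b (rfl | hb) hab
  · exact absurd rfl hab
  · exact hb.1.symm
  · exact ha.1
  · exact h.clique v a ha b hb hab

/-- The earlier neighbours of v are pairwise adjacent and `par v` is the last of them. This is what
makes the bags fit together along `par`. -/
theorem earlier_subset_bag_par (h : Elim G num par col om) (v : V) :
    earlier G num v ⊆ bag G num (par v) := by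
  intro w hw
  have hp := h.par_mem v ⟨w, hw⟩
  by_cases hwp : w = par v
  · rw [hwp]; exact mem_bag _
  · refine Set.mem_insert_of_mem _ ⟨h.clique v w hw _ hp hwp, ?_⟩
    exact lt_of_le_of_ne (h.le_par v w hw) fun hc => hwp (h.inj hc)

/-- Colours serve as names of the vertices of a clique, which turns subsets of a bag into sets of
small numbers. -/
theorem col_inj (h : Elim G num par col om) {B : Set V} (hB : IsCliqueSet G B) {a b : V}
    (ha : a ∈ B) (hb : b ∈ B) (hab : col a = col b) : a = b := by
  by_contra hne
  exact h.proper a b (hB a ha b hb hne) hab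

end Elim

/-- The state of the clustering when the vertices numbered `j` and above have been merged into the
clusters of their parents. -/
structure Clusters (G : SimpleGraph V) (num : V → ℕ) (j : ℕ) (rep : V → V) : Prop where
  eq_self : ∀ u, num u < j → rep u = u
  edge : ∀ u w, G.Adj u w → num u < num w →
    rep w = rep u ∨ (rep u = u ∧ u ∈ earlier G num (rep w))
  lt_or : ∀ u, num (rep u) < j ∨ earlier G num (rep u) = ∅
  reach : ∀ u, G.Reachable u (rep u)

theorem clusters_id {j : ℕ} (hj : ∀ u, num u < j) : Clusters G num j id where
  eq_self _ _ := rfl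
  edge _ _ huw hlt := .inr ⟨rfl, huw, hlt⟩
  lt_or u := .inl (hj u)
  reach _ := .rfl

open Classical in
/-- Merging the cluster of `c` into that of `p`. -/
noncomputable def mergeRep (rep : V → V) (c p : V) (u : V) : V := if rep u = c then p else rep u

theorem mergeRep_eq_iff {rep : V → V} {c p u x : V} (hxc : x ≠ c) :
    mergeRep rep c p u = x ↔ rep u = x ∨ (rep u = c ∧ p = x) := by
  unfold mergeRep
  split_ifs with h
  · rw [h]; simp [hxc.symm]
  · simp [h]

namespace Clusters

variable {rep : V → V} {c : V}

theorem notMem_earlier_rep (hr : Clusters G num (num c + 1) rep) (w : V) :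
    c ∉ earlier G num (rep w) := by
  intro hc
  rcases hr.lt_or w with h | h
  · have := hc.2; omega
  · rw [h] at hc; exact hc

theorem rep_self (hr : Clusters G num (num c + 1) rep) : rep c = c := hr.eq_self c (by omega)

/-- The neighbours of the cluster of `c` are earlier neighbours of `c`. -/
theorem boundary (hr : Clusters G num (num c + 1) rep) (hinj : Function.Injective num) :
    ∀ a ∈ {u | rep u = c}, ∀ b ∉ {u | rep u = c}, G.Adj a b → b ∈ earlier G num c := by
  intro a ha b hb hab
  simp only [Set.mem_ofPred_eq] at ha hb
  rcases lt_trichotomy (num a) (num b) with hlt | heq | hlt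
  · rcases hr.edge a b hab hlt with h | ⟨h, h'⟩
    · exact absurd (h.trans ha) hb
    · rw [← h, ha] at h'
      exact absurd h' (hr.notMem_earlier_rep b)
  · exact absurd (hinj heq) hab.ne
  · rcases hr.edge b a hab.symm hlt with h | ⟨-, h'⟩
    · exact absurd (h.symm.trans ha) hb
    · rwa [ha] at h'

/-- The neighbours of the rest of the cluster of `p` are in the bag of `p`. -/
theorem boundary_rest {j : ℕ} (hr : Clusters G num j rep) (hinj : Function.Injective num) (p : V) :
    ∀ a ∈ {u | rep u = p ∧ u ≠ p}, ∀ b ∉ {u | rep u = p ∧ u ≠ p}, G.Adj a b →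
      b ∈ bag G num p := by
  rintro a ⟨ha, hap⟩ b hb hab
  simp only [Set.mem_ofPred_eq, not_and, not_not] at hb
  by_cases hbp : b = p
  · rw [hbp]; exact mem_bag _
  have hrb : rep b ≠ p := fun hc => hbp (hb hc)
  rcases lt_trichotomy (num a) (num b) with hlt | heq | hlt
  · rcases hr.edge a b hab hlt with h | ⟨h, -⟩
    · exact absurd (h.trans ha) hrb
    · exact absurd (h.symm.trans ha) hap
  · exact absurd (hinj heq) hab.ne
  · rcases hr.edge b a hab.symm hlt with h | ⟨-, h'⟩
    · exact absurd (h.symm.trans ha) hrb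
    · rw [ha] at h'; exact earlier_subset_bag _ h'

/-- An edge between clusters whose later end is in the cluster of c has its earlier end among the
earlier neighbours of c, hence in the bag of the parent. That end is either the parent, now in the
same cluster, or an earlier neighbour of the parent. -/
theorem merge (hr : Clusters G num (num c + 1) rep) (he : Elim G num par col om)
    (hc : (earlier G num c).Nonempty) : Clusters G num (num c) (mergeRep rep c (par c)) := by
  have hpar := he.par_mem c hc
  refine ⟨fun u hu => ?_, fun u w huw hlt => ?_, fun u => ?_, fun u => ?_⟩
  · have h := hr.eq_self u (by omega)
    have hne : u ≠ c := by rintro rfl; omega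
    rw [mergeRep, if_neg (by rw [h]; exact hne), h]
  · rcases hr.edge u w huw hlt with h | ⟨h, h'⟩
    · left; unfold mergeRep; rw [h]
    · have huc : u ≠ c := by rintro rfl; exact hr.notMem_earlier_rep w h'
      have hu : mergeRep rep c (par c) u = u := by
        rw [mergeRep, if_neg (by rw [h]; exact huc), h]
      rw [hu]
      by_cases hw : rep w = c
      · rw [mergeRep, if_pos hw]
        rw [hw] at h'
        rcases he.earlier_subset_bag_par c h' with h1 | h1
        · exact .inl h1.symm
        · exact .inr ⟨rfl, h1⟩
      · rw [mergeRep, if_neg hw]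
        exact .inr ⟨rfl, h'⟩
  · unfold mergeRep
    split_ifs with h
    · exact .inl hpar.2
    · rcases hr.lt_or u with h1 | h1
      · refine .inl (lt_of_le_of_ne (by omega) fun hcc => h (he.inj hcc))
      · exact .inr h1
  · unfold mergeRep
    split_ifs with h
    · exact (h ▸ hr.reach u).trans hpar.1.symm.reachable
    · exact hr.reach u

theorem finish (hr : Clusters G num (num c + 1) rep) (hinj : Function.Injective num)
    (hc : earlier G num c = ∅) : Clusters G num (num c) rep := by
  refine ⟨fun u hu => hr.eq_self u (by omega), hr.edge, fun u => ?_, hr.reach⟩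
  rcases hr.lt_or u with h | h
  · by_cases hu : rep u = c
    · exact .inr (hu ▸ hc)
    · exact .inl (lt_of_le_of_ne (by omega) fun hcc => hu (hinj hcc))
  · exact .inr h

end Clusters

end Elimination

/-! ### Partial solutions -/

section Partial

variable {V : Type*} {G : SimpleGraph V} {num : V → ℕ} {par : V → V} {col : V → ℕ} {om : ℕ}

/-- The vertices of the bag of `p` with colours in `t`. -/
def cls (G : SimpleGraph V) (num col : V → ℕ) (p : V) (t : ℕ) : Set V :=
  {x | x ∈ bag G num p ∧ t.testBit (col x) = true}

/-- `t` is the set of colours of the vertices of the bag of `p` nearest to `u`. -/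
def HasType (G : SimpleGraph V) (num col : V → ℕ) (om : ℕ) (p u : V) (t : ℕ) : Prop :=
  ∀ i < om, t.testBit i = true ↔ ∃ x ∈ near (G.edist u) (bag G num p), col x = i

/-- The pair of colours `i`, `j` in the bag of `p` is favoured by a vertex of `M`. -/
def Hits (G : SimpleGraph V) (num col : V → ℕ) (p : V) (M : Finset V) (i j : ℕ) : Prop :=
  ∃ x ∈ bag G num p, ∃ y ∈ bag G num p, col x = i ∧ col y = j ∧ x ≠ y ∧
    ∃ u ∈ M, Favours G (G.edist u) x y

/-- There is a set of at most `m` vertices in the cluster of `p` that provides the types `I` and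
favours the pairs `S` in the bag of `p`, such that all pairs reaching into the rest of the cluster
are favoured by it or by an outside vertex with a type in `O`. -/
def Spec (G : SimpleGraph V) (num col : V → ℕ) (om : ℕ) (rep : V → V) (p : V) (I O : ℕ → Prop)
    (S : ℕ → ℕ → Prop) (m : ℕ) : Prop :=
  ∃ M : Finset V, M.card ≤ m ∧ (∀ u ∈ M, rep u = p) ∧
    (∀ t < 2 ^ om, I t → ∃ u ∈ M, HasType G num col om p u t) ∧
    (∀ i < om, ∀ j < om, S i j → Hits G num col p M i j) ∧
    ∀ x y, G.Adj x y → (rep x = p ∧ x ≠ p ∨ rep y = p ∧ y ≠ p) →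
      (∃ u ∈ M, Favours G (G.edist u) x y) ∨
        ∃ t < 2 ^ om, O t ∧ Favours G (srcDist G (cls G num col p t)) x y

theorem Spec.congr {rep rep' : V → V} {p : V} {I O I' O' : ℕ → Prop} {S S' : ℕ → ℕ → Prop} {m : ℕ}
    (hr : ∀ u, rep' u = p ↔ rep u = p)
    (hI : ∀ t < 2 ^ om, I' t ↔ I t) (hO : ∀ t < 2 ^ om, O' t ↔ O t)
    (hS : ∀ i < om, ∀ j < om, S' i j ↔ S i j)
    (h : Spec G num col om rep p I O S m) : Spec G num col om rep' p I' O' S' m := by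
  obtain ⟨M, h1, h2, h3, h4, h5⟩ := h
  refine ⟨M, h1, fun u hu => (hr u).2 (h2 u hu), fun t ht hIt => h3 t ht ((hI t ht).1 hIt),
    fun i hi j hj hs => h4 i hi j hj ((hS i hi j hj).1 hs), fun x y hxy hor => ?_⟩
  rw [hr, hr] at hor
  refine (h5 x y hxy hor).imp_right ?_
  rintro ⟨t, ht, hOt, hf⟩
  exact ⟨t, ht, (hO t ht).2 hOt, hf⟩

/-- `t` is the restriction to `K` of the type `t'`. -/
def Restr (om : ℕ) (K : ℕ → Prop) (t' t : ℕ) : Prop :=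
  ∀ i < om, t.testBit i = true ↔
    K i ∧ (t'.testBit i = true ∨ ∀ j < om, ¬ (t'.testBit j = true ∧ K j))

/-- The states `1` (of a vertex with colours `Bp` in its bag) and `2` (of a child with colour `cc`
and earlier neighbours of colours `K`) combine into the state without number. -/
structure Joins (om : ℕ) (K Bp : ℕ → Prop) (cc : ℕ) (I O : ℕ → Prop) (S : ℕ → ℕ → Prop)
    (I₁ O₁ : ℕ → Prop) (S₁ : ℕ → ℕ → Prop) (I₂ O₂ : ℕ → Prop) (S₂ : ℕ → ℕ → Prop) : Prop where
  inner : ∀ t < 2 ^ om, I t → I₁ t ∨ ∃ t' < 2 ^ om, I₂ t' ∧ Restr om K t' t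
  outer₁ : ∀ t < 2 ^ om, O₁ t → O t ∨ ∃ t' < 2 ^ om, I₂ t' ∧ Restr om K t' t
  outer₂ : ∀ t < 2 ^ om, O₂ t → ∃ t' < 2 ^ om, (O t' ∨ I₁ t') ∧
    (∃ i < om, t'.testBit i = true ∧ Bp i) ∧ Restr om K t' t
  hits : ∀ i < om, ∀ j < om, S i j → S₁ i j ∨ (K i ∧ K j ∧ S₂ i j) ∨
    (K i ∧ Bp j ∧ ¬ K j ∧ ∃ t' < 2 ^ om, I₂ t' ∧ Restr om K t' (2 ^ i))
  own : ∀ i < om, K i → (S₂ i cc ∨ O₂ (2 ^ i)) ∧ S₂ cc i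

theorem exists_testBit (n : ℕ) (P : ℕ → Prop) :
    ∃ t < 2 ^ n, ∀ i < n, t.testBit i = true ↔ P i := by
  classical
  induction n with
  | zero => exact ⟨0, by simp, by simp⟩
  | succ n ih =>
    obtain ⟨t, ht, h⟩ := ih
    by_cases hP : P n
    · refine ⟨2 ^ n + t, by rw [pow_succ]; omega, fun i hi => ?_⟩
      rcases Nat.lt_succ_iff_lt_or_eq.mp hi with hi | rfl
      · rw [Nat.testBit_two_pow_add_gt hi, h i hi]
      · rw [Nat.testBit_two_pow_add_eq, Nat.testBit_lt_two_pow ht]; simp [hP]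
    · refine ⟨t, by rw [pow_succ]; omega, fun i hi => ?_⟩
      rcases Nat.lt_succ_iff_lt_or_eq.mp hi with hi | rfl
      · exact h i hi
      · rw [Nat.testBit_lt_two_pow ht]; simp [hP]

namespace Elim

theorem near_eq_cls (he : Elim G num par col om) {δ : V → ℕ∞} {p : V} {t : ℕ}
    (h : ∀ i < om, t.testBit i = true ↔ ∃ x ∈ near δ (bag G num p), col x = i) :
    near δ (bag G num p) = cls G num col p t := by
  ext x
  constructor
  · intro hx
    exact ⟨hx.1, (h _ (he.lt x)).2 ⟨x, hx, rfl⟩⟩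
  · rintro ⟨hx, hb⟩
    obtain ⟨y, hy, hyx⟩ := (h _ (he.lt x)).1 hb
    exact he.col_inj (he.bag_clique p) hy.1 hx hyx ▸ hy

/-- Colours of the nearest vertices after restriction. -/
theorem restr_iff (he : Elim G num par col om) {δ : V → ℕ∞} (hδ : IsLip G δ) {p : V}
    {K : Set V} (hK : K ⊆ bag G num p)
    {t' : ℕ} (hne : (near δ (bag G num p)).Nonempty)
    (h : near δ (bag G num p) = cls G num col p t') (t : ℕ) :
    Restr om (fun i => ∃ w ∈ K, col w = i) t' t ↔
      ∀ i < om, t.testBit i = true ↔ ∃ x ∈ near δ K, col x = i := by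
  have hB := he.bag_clique p
  have hmem : ∀ w ∈ K, (w ∈ near δ (bag G num p) ↔ t'.testBit (col w) = true) := fun w hw => by
    rw [h]; simp [cls, hK hw]
  refine forall₂_congr fun i hi => ?_
  have : (∃ x ∈ near δ K, col x = i) ↔ ((∃ w ∈ K, col w = i) ∧
      (t'.testBit i = true ∨ ∀ j < om, ¬ (t'.testBit j = true ∧ ∃ w ∈ K, col w = j))) := by
    constructor
    · rintro ⟨x, hx, rfl⟩
      rw [mem_near_subset hδ hB hK hne] at hx
      refine ⟨⟨x, hx.1, rfl⟩, hx.2.imp (hmem x hx.1).1 fun hx2 => ?_⟩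
      rintro j - ⟨hj, w, hw, rfl⟩
      exact hx2 w hw ((hmem w hw).2 hj)
    · rintro ⟨⟨x, hx, rfl⟩, hor⟩
      refine ⟨x, (mem_near_subset hδ hB hK hne x).2 ⟨hx, hor.imp (hmem x hx).2 fun h2 => ?_⟩, rfl⟩
      intro y hy hyn
      exact h2 (col y) (he.lt y) ⟨(hmem y hy).1 hyn, y, hy, rfl⟩
  rw [this]

end Elim

end Partial

end MEG

namespace MEG

open SimpleGraph

/-! ### Merging partial solutions -/

section Merge

variable {V : Type*} {G : SimpleGraph V} {num : V → ℕ} {par : V → V} {col : V → ℕ} {om : ℕ}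
  {rep : V → V} {c p : V}

/-- The colours occurring in `B`. -/
def cols (col : V → ℕ) (B : Set V) (i : ℕ) : Prop := ∃ w ∈ B, col w = i

/-- If one end of the pair is in the cluster of p but is not p, then the other end and all common
neighbours are in that part of the cluster or in the bag of p. The bag therefore screens the whole
comparison. -/
theorem favours_rest {j : ℕ} (he : Elim G num par col om) (hr : Clusters G num j rep)
    {δ : V → ℕ∞} (hδ : IsLip G δ)
    (hpass : ∀ z, rep z = p → z ≠ p → Passes G δ (bag G num p) z)
    {x y : V} (hxy : G.Adj x y) (hor : rep x = p ∧ x ≠ p ∨ rep y = p ∧ y ≠ p) :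
    Favours G (srcDist G (near δ (bag G num p))) x y ↔ Favours G δ x y := by
  have hall : ∀ z, (z = x ∨ z = y ∨ G.Adj z x ∧ G.Adj z y) → Passes G δ (bag G num p) z := by
    intro z hz
    by_cases hzH : rep z = p ∧ z ≠ p
    · exact hpass z hzH.1 hzH.2
    refine Passes.self ?_
    have hb := hr.boundary_rest he.inj p
    rcases hor with hx | hy
    · have hzx : z ≠ x := by rintro rfl; exact hzH hx
      refine hb x hx z hzH ?_
      rcases hz with rfl | rfl | hz
      · exact absurd rfl hzx
      · exact hxy
      · exact hz.1.symm
    · have hzy : z ≠ y := by rintro rfl; exact hzH hy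
      refine hb y hy z hzH ?_
      rcases hz with rfl | rfl | hz
      · exact hxy.symm
      · exact absurd rfl hzy
      · exact hz.2.symm
  exact favours_srcDist_near hδ (he.bag_clique p) (hall x (.inl rfl)) fun z hz => hall z (.inr hz)

theorem passes_rest_of_edist {j : ℕ} (he : Elim G num par col om) (hr : Clusters G num j rep)
    {u : V} (hu : ¬ (rep u = p ∧ u ≠ p)) (z : V) (hz : rep z = p) (hzp : z ≠ p) :
    Passes G (G.edist u) (bag G num p) z :=
  passes_edist_of_notMem (hr.boundary_rest he.inj p) hu ⟨hz, hzp⟩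

/-- A distance whose source is outside of the cluster of `c`. -/
structure Outside (G : SimpleGraph V) (num : V → ℕ) (rep : V → V) (c : V) (δ : V → ℕ∞) :
    Prop where
  lip : IsLip G δ
  passes : ∀ z, rep z = c → Passes G δ (earlier G num c) z

theorem outside_edist (he : Elim G num par col om) (hr : Clusters G num (num c + 1) rep) {u : V}
    (hu : rep u ≠ c) : Outside G num rep c (G.edist u) :=
  ⟨isLip_edist u, fun _ hz => passes_edist_of_notMem (H := {u | rep u = c})
    (hr.boundary he.inj) hu hz⟩

theorem rep_ne_of_mem_bag_par (he : Elim G num par col om) (hr : Clusters G num (num c + 1) rep)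
    (hc : (earlier G num c).Nonempty) {w : V} (hw : w ∈ bag G num (par c)) : rep w ≠ c := by
  have hpar := he.par_mem c hc
  have hlt : num w < num c := by
    rcases hw with rfl | hw
    · exact hpar.2
    · exact hw.2.trans hpar.2
  rw [hr.eq_self w (by omega)]
  rintro rfl
  omega

theorem outside_srcDist (he : Elim G num par col om) (hr : Clusters G num (num c + 1) rep)
    (hc : (earlier G num c).Nonempty) (t : ℕ) :
    Outside G num rep c (srcDist G (cls G num col (par c) t)) :=
  ⟨isLip_srcDist _, fun _ hz => passes_srcDist (H := {u | rep u = c}) (hr.boundary he.inj)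
    (fun _ hu => rep_ne_of_mem_bag_par he hr hc hu.1) hz⟩

namespace Outside

variable {δ : V → ℕ∞}

theorem near_bag (ho : Outside G num rep c δ) (hcc : rep c = c) :
    near δ (bag G num c) = near δ (earlier G num c) := by
  refine near_eq_of_passes (G := G) (earlier_subset_bag c) fun z hz hz' => ?_
  rcases hz with rfl | hz
  · exact ho.passes z hcc
  · exact absurd hz hz'

theorem passes_rest (ho : Outside G num rep c δ) (z : V) (hz : rep z = c) (_ : z ≠ c) :
    Passes G δ (bag G num c) z :=
  (ho.passes z hz).imp_right fun ⟨k, hk, h⟩ => ⟨k, earlier_subset_bag c hk, h⟩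

theorem restr_iff (ho : Outside G num rep c δ) (he : Elim G num par col om) (hcc : rep c = c)
    {t' : ℕ} (hne : (near δ (bag G num (par c))).Nonempty)
    (h : near δ (bag G num (par c)) = cls G num col (par c) t') (t : ℕ) :
    Restr om (cols col (earlier G num c)) t' t ↔
      ∀ i < om, t.testBit i = true ↔ ∃ x ∈ near δ (bag G num c), col x = i := by
  rw [ho.near_bag hcc]
  exact he.restr_iff ho.lip (he.earlier_subset_bag_par c) hne h t

/-- Which pairs `x`, `c` are favoured from outside of the cluster of `c`. -/
theorem favours_own (ho : Outside G num rep c δ) (he : Elim G num par col om)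
    (hr : Clusters G num (num c + 1) rep) {x : V}
    (hn : near δ (bag G num c) = {x}) : Favours G δ x c := by
  have hnx : near δ (earlier G num c) = {x} := by rw [← ho.near_bag hr.rep_self, hn]
  have hx : x ∈ near δ (earlier G num c) := by rw [hnx]; rfl
  intro z hz
  by_cases hzt : δ z = ⊤
  · rw [hzt]; exact lt_top_iff_ne_top.mpr hx.2.1
  by_cases hzc : rep z = c
  · obtain ⟨k, hk, hlt⟩ := (ho.passes z hzc).exists_lt (fun hzk => by
      have h1 := hr.eq_self z (by have := hzk.2; omega)
      rw [h1] at hzc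
      exact notMem_earlier c (hzc ▸ hzk)) hzt
    exact (hx.2.2 k hk).trans_lt hlt
  · rcases hz with rfl | ⟨hzx, hzc'⟩
    · exact absurd hr.rep_self hzc
    · have hzE := hr.boundary he.inj c hr.rep_self z hzc hzc'.symm
      refine lt_of_notMem_near hx hzE ?_
      rw [hnx]
      exact hzx.ne

/-- From outside, c is reached through an earlier neighbour, which is strictly closer. This is why
the field `own` of `Joins` has an alternative with an outside type for pairs pointing to an earlier
neighbour but none for pairs pointing to c. -/
theorem not_favours_own (ho : Outside G num rep c δ) (he : Elim G num par col om)
    (hcc : rep c = c) {y : V} (hy : y ∈ earlier G num c) : ¬ Favours G δ c y := by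
  intro hf
  obtain ⟨k, hk, hlt⟩ := (ho.passes c hcc).exists_lt (notMem_earlier c)
    (lt_of_lt_of_le hf.lt le_top).ne
  have hck : δ c < δ k := by
    by_cases hky : k = y
    · exact hf k (.inl hky)
    · exact hf k (.inr ⟨hk.1, he.clique c k hk y hy hky⟩)
  exact absurd hlt hck.asymm

end Outside

theorem near_edist_nonempty (hr : Clusters G num (num c + 1) rep) {u : V} :
    (near (G.edist u) (bag G num (rep u))).Nonempty :=
  near_nonempty (mem_bag _) (edist_ne_top_iff_reachable.mpr (hr.reach u))

theorem passes_of_rep_eq (he : Elim G num par col om) (hr : Clusters G num (num c + 1) rep)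
    {u z : V} (hu : rep u = c) (hz : rep z ≠ c) : Passes G (G.edist u) (earlier G num c) z :=
  passes_edist_of_mem (H := {u | rep u = c}) (hr.boundary he.inj) hu hz

theorem near_bag_par (he : Elim G num par col om) (hr : Clusters G num (num c + 1) rep)
    (hc : (earlier G num c).Nonempty) {u : V} (hu : rep u = c) :
    near (G.edist u) (bag G num (par c)) = near (G.edist u) (earlier G num c) :=
  near_eq_of_passes (he.earlier_subset_bag_par c) fun _ hz _ =>
    passes_of_rep_eq he hr hu (rep_ne_of_mem_bag_par he hr hc hz)

/-- From inside the cluster of c, the bag of the parent is entered through the earlier neighbours of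
c. So the type there is obtained by restricting the type in the bag of c to these neighbours. -/
theorem hasType_par_iff (he : Elim G num par col om) (hr : Clusters G num (num c + 1) rep)
    (hc : (earlier G num c).Nonempty) {u : V} (hu : rep u = c) {t' : ℕ}
    (ht' : HasType G num col om c u t') (t : ℕ) :
    Restr om (cols col (earlier G num c)) t' t ↔ HasType G num col om (par c) u t := by
  unfold HasType
  rw [near_bag_par he hr hc hu]
  refine he.restr_iff (isLip_edist u) (earlier_subset_bag c) ?_ (he.near_eq_cls ht') t
  have := near_edist_nonempty (u := u) hr
  rwa [hu] at this

theorem exists_hasType (p u : V) : ∃ t < 2 ^ om, HasType G num col om p u t :=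
  exists_testBit om _

/-- A vertex in the cluster of `c` whose only nearest vertex of the bag of the parent is `x` favours
`x` over the vertices of that bag that are not adjacent to `c`. -/
theorem favours_par (he : Elim G num par col om) (hr : Clusters G num (num c + 1) rep)
    (hc : (earlier G num c).Nonempty) {u x y : V} (hu : rep u = c)
    (hn : near (G.edist u) (bag G num (par c)) = {x})
    (hy : y ∈ bag G num (par c)) (hyc : y ∉ earlier G num c) : Favours G (G.edist u) x y := by
  have hx : x ∈ near (G.edist u) (bag G num (par c)) := by rw [hn]; rfl
  have hxc : x ∈ near (G.edist u) (earlier G num c) := by rwa [← near_bag_par he hr hc hu]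
  have hrepy := rep_ne_of_mem_bag_par he hr hc hy
  intro z hz
  have hrep : rep z ≠ c := by
    rcases hz with rfl | hz
    · exact hrepy
    · intro hzc
      exact hyc (hr.boundary he.inj z hzc y hrepy hz.2)
  by_cases hzt : G.edist u z = ⊤
  · rw [hzt]; exact lt_top_iff_ne_top.mpr hx.2.1
  by_cases hzE : z ∈ earlier G num c
  · refine lt_of_notMem_near hx (he.earlier_subset_bag_par c hzE) ?_
    rw [hn]
    rcases hz with rfl | hz
    · exact absurd hzE hyc
    · exact hz.1.ne
  · obtain ⟨k, hk, hlt⟩ := (passes_of_rep_eq he hr hu hrep).exists_lt hzE hzt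
    exact (hxc.2.2 k hk).trans_lt hlt

theorem cls_two_pow (he : Elim G num par col om) {p x : V} (hx : x ∈ bag G num p) :
    cls G num col p (2 ^ col x) = {x} := by
  ext y
  simp only [cls, Nat.testBit_two_pow, decide_eq_true_eq, Set.mem_ofPred_eq, Set.mem_singleton_iff]
  constructor
  · rintro ⟨hy, h⟩
    exact he.col_inj (he.bag_clique p) hy hx h.symm
  · rintro rfl; exact ⟨hx, rfl⟩

theorem testBit_two_pow_iff {x : V} {i : ℕ} {N : Set V} (hN : N = {x}) :
    (2 ^ col x).testBit i = true ↔ ∃ y ∈ N, col y = i := by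
  simp [hN, Nat.testBit_two_pow]

theorem hits_inj (he : Elim G num par col om) {q : V} {M : Finset V} {x y : V}
    (hx : x ∈ bag G num q) (hy : y ∈ bag G num q) (h : Hits G num col q M (col x) (col y)) :
    ∃ u ∈ M, Favours G (G.edist u) x y := by
  obtain ⟨x', hx', y', hy', hxx, hyy, -, h⟩ := h
  rwa [he.col_inj (he.bag_clique q) hx' hx hxx, he.col_inj (he.bag_clique q) hy' hy hyy] at h

/-- The union of the two partial solutions works. A type expected by one side is either provided by
the other side or passed on to the outside. The pairs formed by c and its earlier neighbours that
neither side has covered are the subject of the field `own`. -/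
theorem spec_of_joins (he : Elim G num par col om) (hr : Clusters G num (num c + 1) rep)
    (hc : (earlier G num c).Nonempty) {I O I₁ O₁ I₂ O₂ : ℕ → Prop} {S S₁ S₂ : ℕ → ℕ → Prop}
    {m₁ m₂ : ℕ} (hj : Joins om (cols col (earlier G num c)) (cols col (bag G num (par c))) (col c)
      I O S I₁ O₁ S₁ I₂ O₂ S₂)
    (h₁ : Spec G num col om rep (par c) I₁ O₁ S₁ m₁) (h₂ : Spec G num col om rep c I₂ O₂ S₂ m₂) :
    Spec G num col om (mergeRep rep c (par c)) (par c) I O S (m₁ + m₂) := by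
  classical
  obtain ⟨M₁, hM₁, hrep₁, hI₁, hS₁, hV₁⟩ := h₁
  obtain ⟨M₂, hM₂, hrep₂, hI₂, hS₂, hV₂⟩ := h₂
  have hpc : par c ≠ c := (he.par_mem c hc).1.ne
  have hpp : rep (par c) = par c := hr.eq_self _ (by have := (he.par_mem c hc).2; omega)
  have up : ∀ t < 2 ^ om, (∃ t' < 2 ^ om, I₂ t' ∧ Restr om (cols col (earlier G num c)) t' t) →
      ∃ u ∈ M₂, HasType G num col om (par c) u t := by
    rintro t - ⟨t', ht', hI, hR⟩
    obtain ⟨u, hu, htype⟩ := hI₂ t' ht' hI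
    exact ⟨u, hu, (hasType_par_iff he hr hc (hrep₂ u hu) htype t).1 hR⟩
  -- A type expected in the cluster of c is realised by a source outside of it, either a vertex of
  -- M₁ or the set of bag vertices described by a type in O. The type at the parent has to occur in
  -- the bag: the restriction of an empty one would be all of K although it favours nothing.
  have down : ∀ t < 2 ^ om, O₂ t → ∃ δ, Outside G num rep c δ ∧
      near δ (bag G num c) = cls G num col c t ∧ (∀ x y, Favours G δ x y →
        (∃ u ∈ M₁ ∪ M₂, Favours G (G.edist u) x y) ∨
        ∃ t < 2 ^ om, O t ∧ Favours G (srcDist G (cls G num col (par c) t)) x y) := by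
    intro t ht hO
    obtain ⟨t', ht', hor, ⟨i, hi, hbit, b, hb, hbi⟩, hR⟩ := hj.outer₂ t ht hO
    have hb' : b ∈ cls G num col (par c) t' := ⟨hb, by rw [hbi]; exact hbit⟩
    rcases hor with hO' | hI'
    · have ho := outside_srcDist he hr hc t'
      have hnear : near (srcDist G (cls G num col (par c) t')) (bag G num (par c)) =
        cls G num col (par c) t' := near_srcDist_self (fun _ h => h.1) ⟨b, hb'⟩
      refine ⟨_, ho, he.near_eq_cls ((ho.restr_iff he hr.rep_self ?_ hnear t).1 hR), ?_⟩
      · rw [hnear]; exact ⟨b, hb'⟩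
      · exact fun x y hf => .inr ⟨t', ht', hO', hf⟩
    · obtain ⟨u, hu, htype⟩ := hI₁ t' ht' hI'
      have ho := outside_edist he hr (u := u) (by rw [hrep₁ u hu]; exact hpc)
      have hnear := he.near_eq_cls htype
      refine ⟨_, ho, he.near_eq_cls ((ho.restr_iff he hr.rep_self ?_ hnear t).1 hR), ?_⟩
      · rw [hnear]; exact ⟨b, hb'⟩
      · exact fun x y hf => .inl ⟨u, Finset.mem_union_left _ hu, hf⟩
  refine ⟨M₁ ∪ M₂, (Finset.card_union_le _ _).trans (by omega), ?_, ?_, ?_, ?_⟩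
  · intro u hu
    rw [mergeRep_eq_iff hpc]
    rcases Finset.mem_union.mp hu with hu | hu
    · exact .inl (hrep₁ u hu)
    · exact .inr ⟨hrep₂ u hu, rfl⟩
  · intro t ht hIt
    rcases hj.inner t ht hIt with h | h
    · obtain ⟨u, hu, h⟩ := hI₁ t ht h
      exact ⟨u, Finset.mem_union_left _ hu, h⟩
    · obtain ⟨u, hu, h⟩ := up t ht h
      exact ⟨u, Finset.mem_union_right _ hu, h⟩
  · intro i hi j hj' hS
    rcases hj.hits i hi j hj' hS with h | ⟨⟨w, hw, rfl⟩, ⟨w', hw', rfl⟩, h⟩ |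
      ⟨⟨x, hx, rfl⟩, ⟨y, hy, rfl⟩, hnK, h⟩
    · obtain ⟨x, hx, y, hy, hxi, hyj, hne, u, hu, hf⟩ := hS₁ i hi j hj' h
      exact ⟨x, hx, y, hy, hxi, hyj, hne, u, Finset.mem_union_left _ hu, hf⟩
    · obtain ⟨u, hu, hf⟩ := hits_inj he (earlier_subset_bag c hw) (earlier_subset_bag c hw')
        (hS₂ _ hi _ hj' h)
      exact ⟨w, he.earlier_subset_bag_par c hw, w', he.earlier_subset_bag_par c hw', rfl, rfl,
        fun hc => absurd hf.lt (by rw [hc]; exact lt_irrefl _),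
        u, Finset.mem_union_right _ hu, hf⟩
    · obtain ⟨u, hu, htype⟩ := up _ (Nat.pow_lt_pow_right (by omega) (he.lt x)) h
      have hxp := he.earlier_subset_bag_par c hx
      have hn := (he.near_eq_cls htype).trans (cls_two_pow he hxp)
      have hyE : y ∉ earlier G num c := fun hyE => hnK ⟨y, hyE, rfl⟩
      have hf := favours_par he hr hc (hrep₂ u hu) hn hy hyE
      exact ⟨x, hxp, y, hy, rfl, rfl, fun hc => absurd hf.lt (by rw [hc]; exact lt_irrefl _),
        u, Finset.mem_union_right _ hu, hf⟩
  · intro x y hxy hor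
    have hor' : (rep x = par c ∧ x ≠ par c ∨ rep y = par c ∧ y ≠ par c) ∨
        (rep x = c ∨ rep y = c) := by
      rw [mergeRep_eq_iff hpc, mergeRep_eq_iff hpc] at hor
      tauto
    rcases hor' with hor' | hor'
    · rcases hV₁ x y hxy hor' with ⟨u, hu, hf⟩ | ⟨t, ht, hO, hf⟩
      · exact .inl ⟨u, Finset.mem_union_left _ hu, hf⟩
      · rcases hj.outer₁ t ht hO with h | h
        · exact .inr ⟨t, ht, h, hf⟩
        · obtain ⟨u, hu, htype⟩ := up t ht h
          refine .inl ⟨u, Finset.mem_union_right _ hu, ?_⟩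
          rw [← he.near_eq_cls htype] at hf
          exact (favours_rest he hr (isLip_edist u) (passes_rest_of_edist he hr fun hcc =>
            hpc (hcc.1.symm.trans (hrep₂ u hu))) hxy hor').1 hf
    · by_cases hown : rep x = c ∧ x ≠ c ∨ rep y = c ∧ y ≠ c
      · rcases hV₂ x y hxy hown with ⟨u, hu, hf⟩ | ⟨t, ht, hO, hf⟩
        · exact .inl ⟨u, Finset.mem_union_right _ hu, hf⟩
        · obtain ⟨δ, ho, hnear, hfav⟩ := down t ht hO
          refine hfav x y ?_
          rw [← hnear] at hf
          exact (favours_rest he hr ho.lip ho.passes_rest hxy hown).1 hf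
      -- The pair meets the cluster of c in c only, so its other end is an earlier neighbour of c.
      · push Not at hown
        have hcase : (x = c ∧ y ∈ earlier G num c) ∨ (y = c ∧ x ∈ earlier G num c) := by
          rcases hor' with h | h
          · have hx := hown.1 h
            refine .inl ⟨hx, hr.boundary he.inj x h y (fun hyc => ?_) hxy⟩
            exact hxy.ne (hx.trans (hown.2 hyc).symm)
          · have hy := hown.2 h
            refine .inr ⟨hy, hr.boundary he.inj y h x (fun hxc => ?_) hxy.symm⟩
            exact hxy.ne ((hown.1 hxc).trans hy.symm)
        rcases hcase with ⟨rfl, hy⟩ | ⟨rfl, hx⟩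
        · have h := (hj.own (col y) (he.lt y) ⟨y, hy, rfl⟩).2
          obtain ⟨u, hu, hf⟩ := hits_inj he (mem_bag x) (earlier_subset_bag x hy)
            (hS₂ _ (he.lt x) _ (he.lt y) h)
          exact .inl ⟨u, Finset.mem_union_right _ hu, hf⟩
        · rcases (hj.own (col x) (he.lt x) ⟨x, hx, rfl⟩).1 with h | h
          · obtain ⟨u, hu, hf⟩ := hits_inj he (earlier_subset_bag y hx) (mem_bag y)
              (hS₂ _ (he.lt x) _ (he.lt y) h)
            exact .inl ⟨u, Finset.mem_union_right _ hu, hf⟩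
          · obtain ⟨δ, ho, hnear, hfav⟩ := down _ (Nat.pow_lt_pow_right (by omega) (he.lt x)) h
            rw [cls_two_pow he (earlier_subset_bag y hx)] at hnear
            exact hfav x y (ho.favours_own he hr hnear)

/-- The solution is split by clusters. The states record everything that the two parts provide and
favour, and the expected types are taken as large as `Joins` permits, so the fields `outer₁` and
`outer₂` hold by definition. It remains to see that whatever favoured a pair before is still
available. -/
theorem exists_joins (he : Elim G num par col om) (hr : Clusters G num (num c + 1) rep)
    (hc : (earlier G num c).Nonempty) {I O : ℕ → Prop} {S : ℕ → ℕ → Prop} {m : ℕ}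
    (h : Spec G num col om (mergeRep rep c (par c)) (par c) I O S m) :
    ∃ (I₁ O₁ I₂ O₂ : ℕ → Prop) (S₁ S₂ : ℕ → ℕ → Prop) (m₁ m₂ : ℕ),
      Joins om (cols col (earlier G num c)) (cols col (bag G num (par c))) (col c)
        I O S I₁ O₁ S₁ I₂ O₂ S₂ ∧ m₁ + m₂ ≤ m ∧
      Spec G num col om rep (par c) I₁ O₁ S₁ m₁ ∧ Spec G num col om rep c I₂ O₂ S₂ m₂ := by
  classical
  obtain ⟨M, hM, hrep, hI, hS, hV⟩ := h
  have hpc : par c ≠ c := (he.par_mem c hc).1.ne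
  have hpp : rep (par c) = par c := hr.eq_self _ (by have := (he.par_mem c hc).2; omega)
  set M₁ := M.filter fun u => rep u = par c with hM₁
  set M₂ := M.filter fun u => rep u = c with hM₂
  have hsplit : ∀ u ∈ M, u ∈ M₁ ∨ u ∈ M₂ := by
    intro u hu
    have := hrep u hu
    rw [mergeRep_eq_iff hpc] at this
    rcases this with h | h
    · exact .inl (Finset.mem_filter.mpr ⟨hu, h⟩)
    · exact .inr (Finset.mem_filter.mpr ⟨hu, h.1⟩)
  have hrep₁ : ∀ u ∈ M₁, rep u = par c := fun u hu => (Finset.mem_filter.mp hu).2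
  have hrep₂ : ∀ u ∈ M₂, rep u = c := fun u hu => (Finset.mem_filter.mp hu).2
  have hcard : M₁.card + M₂.card ≤ m := by
    rw [← Finset.card_union_of_disjoint]
    · refine (Finset.card_le_card fun u hu => ?_).trans hM
      rcases Finset.mem_union.mp hu with hu | hu
      · exact (Finset.mem_filter.mp hu).1
      · exact (Finset.mem_filter.mp hu).1
    · rw [Finset.disjoint_left]
      intro u hu hu'
      exact hpc ((hrep₁ u hu).symm.trans (hrep₂ u hu'))
  let K := cols col (earlier G num c)
  let Bp := cols col (bag G num (par c))
  let I₁ : ℕ → Prop := fun t => ∃ u ∈ M₁, HasType G num col om (par c) u t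
  let I₂ : ℕ → Prop := fun t => ∃ u ∈ M₂, HasType G num col om c u t
  let O₁ : ℕ → Prop := fun t => O t ∨ ∃ t' < 2 ^ om, I₂ t' ∧ Restr om K t' t
  let O₂ : ℕ → Prop := fun t => ∃ t' < 2 ^ om, (O t' ∨ I₁ t') ∧
    (∃ i < om, t'.testBit i = true ∧ Bp i) ∧ Restr om K t' t
  have up : ∀ u ∈ M₂, ∀ t, HasType G num col om (par c) u t →
      ∃ t' < 2 ^ om, I₂ t' ∧ Restr om K t' t := by
    intro u hu t ht
    obtain ⟨t', ht', htype⟩ := exists_hasType (G := G) (num := num) (col := col) (om := om) c u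
    exact ⟨t', ht', ⟨u, hu, htype⟩, (hasType_par_iff he hr hc (hrep₂ u hu) htype t).2 ht⟩
  have down : ∀ δ, Outside G num rep c δ → ∀ t', t' < 2 ^ om → (O t' ∨ I₁ t') →
      (near δ (bag G num (par c))).Nonempty →
      near δ (bag G num (par c)) = cls G num col (par c) t' →
      ∀ t, (∀ i < om, t.testBit i = true ↔ ∃ x ∈ near δ (bag G num c), col x = i) → O₂ t := by
    intro δ ho t' ht' hor hne hnear t ht
    refine ⟨t', ht', hor, ?_, (ho.restr_iff he hr.rep_self hne hnear t).2 ht⟩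
    obtain ⟨b, hb⟩ := hne
    exact ⟨col b, he.lt b, (hnear ▸ hb : b ∈ cls G num col (par c) t').2, b, hb.1, rfl⟩
  have src : ∀ x y, G.Adj x y → (mergeRep rep c (par c) x = par c ∧ x ≠ par c ∨
      mergeRep rep c (par c) y = par c ∧ y ≠ par c) →
      (∃ u ∈ M₂, Favours G (G.edist u) x y) ∨ (∃ u ∈ M₁, Favours G (G.edist u) x y) ∨
      ∃ t < 2 ^ om, O t ∧ Favours G (srcDist G (cls G num col (par c) t)) x y := by
    intro x y hxy hor
    rcases hV x y hxy hor with ⟨u, hu, hf⟩ | h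
    · rcases hsplit u hu with hu | hu
      · exact .inr (.inl ⟨u, hu, hf⟩)
      · exact .inl ⟨u, hu, hf⟩
    · exact .inr (.inr h)
  -- The two kinds of sources outside the cluster of c, vertices of M₁ and types in O, are brought
  -- into a common form: a function δ whose type in the bag of c is among the expected ones.
  have src' : ∀ x y, G.Adj x y → (mergeRep rep c (par c) x = par c ∧ x ≠ par c ∨
      mergeRep rep c (par c) y = par c ∧ y ≠ par c) →
      (∃ u ∈ M₂, Favours G (G.edist u) x y) ∨ ∃ δ, Outside G num rep c δ ∧ Favours G δ x y ∧
        ∀ t, (∀ i < om, t.testBit i = true ↔ ∃ x ∈ near δ (bag G num c), col x = i) → O₂ t := by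
    intro x y hxy hor
    rcases src x y hxy hor with h | ⟨u, hu, hf⟩ | ⟨t', ht', hO, hf⟩
    · exact .inl h
    · obtain ⟨t', ht', htype⟩ :=
        exists_hasType (G := G) (num := num) (col := col) (om := om) (par c) u
      have ho := outside_edist he hr (u := u) (by rw [hrep₁ u hu]; exact hpc)
      refine .inr ⟨_, ho, hf, down _ ho t' ht' (.inr ⟨u, hu, htype⟩) ?_ (he.near_eq_cls htype)⟩
      have := near_edist_nonempty (u := u) hr
      rwa [hrep₁ u hu] at this
    · have ho := outside_srcDist he hr hc t'
      -- A type that does not occur in the bag has distance ⊤ everywhere and favours no pair.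
      have hne : (cls G num col (par c) t').Nonempty := by
        rw [Set.nonempty_iff_ne_empty]
        intro hemp
        rw [hemp] at hf
        have := hf.lt
        rw [srcDist_empty] at this
        exact absurd le_top (not_le.mpr this)
      have hnear : near (srcDist G (cls G num col (par c) t')) (bag G num (par c)) =
        cls G num col (par c) t' := near_srcDist_self (fun _ h => h.1) hne
      exact .inr ⟨_, ho, hf, down _ ho t' ht' (.inl hO) (by rw [hnear]; exact hne) hnear⟩
  have hcm : mergeRep rep c (par c) c = par c ∧ c ≠ par c :=
    ⟨(mergeRep_eq_iff hpc).2 (.inr ⟨hr.rep_self, rfl⟩), hpc.symm⟩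
  refine ⟨I₁, O₁, I₂, O₂, Hits G num col (par c) M₁, Hits G num col c M₂, M₁.card, M₂.card,
    ⟨?_, fun _ _ h => h, fun _ _ h => h, ?_, ?_⟩, hcard, ?_, ?_⟩
  · intro t ht hIt
    obtain ⟨u, hu, htype⟩ := hI t ht hIt
    rcases hsplit u hu with hu | hu
    · exact .inl ⟨u, hu, htype⟩
    · exact .inr (up u hu t htype)
  · intro i hi j hj hS'
    obtain ⟨x, hx, y, hy, rfl, rfl, hne, u, hu, hf⟩ := hS i hi j hj hS'
    rcases hsplit u hu with hu | hu
    · exact .inl ⟨x, hx, y, hy, rfl, rfl, hne, u, hu, hf⟩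
    · right
      by_cases hboth : x ∈ earlier G num c ∧ y ∈ earlier G num c
      · exact .inl ⟨⟨x, hboth.1, rfl⟩, ⟨y, hboth.2, rfl⟩, x, earlier_subset_bag c hboth.1, y,
          earlier_subset_bag c hboth.2, rfl, rfl, hne, u, hu, hf⟩
      · right
        -- As the only nearest vertex in the bag of the parent, x is where paths from the cluster of
        -- c enter that bag, so it is an earlier neighbour of c. Hence y is not one, and the type
        -- {x} is enough to favour the pair.
        have hn := hf.near_eq (he.bag_clique (par c)) hx hy
        have hxE : x ∈ earlier G num c := by
          have hxn : x ∈ near (G.edist u) (bag G num (par c)) := by rw [hn]; rfl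
          rw [near_bag_par he hr hc (hrep₂ u hu)] at hxn
          exact hxn.1
        refine ⟨⟨x, hxE, rfl⟩, ⟨y, hy, rfl⟩, ?_, up u hu _ fun i _ => testBit_two_pow_iff hn⟩
        rintro ⟨w, hw, hwy⟩
        have := he.col_inj (he.bag_clique (par c)) (he.earlier_subset_bag_par c hw) hy hwy
        exact hboth ⟨hxE, this ▸ hw⟩
  · rintro i hi ⟨w, hw, rfl⟩
    constructor
    · rcases src' w c hw.1 (.inr hcm) with ⟨u, hu, hf⟩ | ⟨δ, ho, hf, hO⟩
      · exact .inl ⟨w, earlier_subset_bag c hw, c, mem_bag c, rfl, rfl, hw.1.ne, u, hu, hf⟩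
      · refine .inr (hO _ fun i _ => testBit_two_pow_iff ?_)
        exact hf.near_eq (he.bag_clique c) (earlier_subset_bag c hw) (mem_bag c)
    · rcases src' c w hw.1.symm (.inl hcm) with ⟨u, hu, hf⟩ | ⟨δ, ho, hf, hO⟩
      · exact ⟨c, mem_bag c, w, earlier_subset_bag c hw, rfl, rfl, hw.1.ne', u, hu, hf⟩
      · exact absurd hf (ho.not_favours_own he hr.rep_self hw)
  · refine ⟨M₁, le_rfl, hrep₁, fun _ _ h => h, fun _ _ _ _ h => h, fun x y hxy hor => ?_⟩
    have hor' : mergeRep rep c (par c) x = par c ∧ x ≠ par c ∨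
        mergeRep rep c (par c) y = par c ∧ y ≠ par c := by
      rw [mergeRep_eq_iff hpc, mergeRep_eq_iff hpc]; tauto
    rcases src x y hxy hor' with ⟨u, hu, hf⟩ | h | ⟨t, ht, hO, hf⟩
    · obtain ⟨t, ht, htype⟩ :=
        exists_hasType (G := G) (num := num) (col := col) (om := om) (par c) u
      refine .inr ⟨t, ht, .inr (up u hu t htype), ?_⟩
      rw [← he.near_eq_cls htype]
      exact (favours_rest he hr (isLip_edist u) (passes_rest_of_edist he hr fun hcc =>
            hpc (hcc.1.symm.trans (hrep₂ u hu))) hxy hor).2 hf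
    · exact .inl h
    · exact .inr ⟨t, ht, .inl hO, hf⟩
  · refine ⟨M₂, le_rfl, hrep₂, fun _ _ h => h, fun _ _ _ _ h => h, fun x y hxy hor => ?_⟩
    have hne : ∀ z, rep z = c → z ≠ par c := by
      rintro z hz rfl
      exact hpc (hpp.symm.trans hz)
    have hor' : mergeRep rep c (par c) x = par c ∧ x ≠ par c ∨
        mergeRep rep c (par c) y = par c ∧ y ≠ par c := by
      rw [mergeRep_eq_iff hpc, mergeRep_eq_iff hpc]
      rcases hor with h | h
      · exact .inl ⟨.inr ⟨h.1, rfl⟩, hne x h.1⟩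
      · exact .inr ⟨.inr ⟨h.1, rfl⟩, hne y h.1⟩
    rcases src' x y hxy hor' with h | ⟨δ, ho, hf, hO⟩
    · exact .inl h
    · obtain ⟨t, ht, htype⟩ := exists_testBit om fun i => ∃ x ∈ near δ (bag G num c), col x = i
      refine .inr ⟨t, ht, hO t htype, ?_⟩
      rw [← he.near_eq_cls htype]
      exact (favours_rest he hr ho.lip ho.passes_rest hxy hor).2 hf

/-! ### Initial and final clusters -/

/-- A single vertex. -/
theorem spec_id_iff (he : Elim G num par col om) (p : V) (I O : ℕ → Prop) (S : ℕ → ℕ → Prop)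
    (m : ℕ) : Spec G num col om id p I O S m ↔
      ((∀ t < 2 ^ om, ¬ I t) ∧ ∀ i < om, ∀ j < om, ¬ S i j) ∨
      (1 ≤ m ∧ (∀ t < 2 ^ om, I t → ∀ i < om, t.testBit i = true ↔ i = col p) ∧
        ∀ i < om, ∀ j < om, S i j → i = col p ∧ cols col (earlier G num p) j) := by
  classical
  have hnear : near (G.edist p) (bag G num p) = {p} := by
    ext x
    constructor
    · rintro ⟨hx, -, hmin⟩
      have := hmin p (mem_bag p)
      rw [SimpleGraph.edist_self, nonpos_iff_eq_zero, edist_eq_zero_iff] at this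
      exact this.symm
    · rintro rfl
      exact ⟨mem_bag x, by simp, fun z _ => by simp⟩
  have htype : ∀ t, HasType G num col om p p t ↔ ∀ i < om, t.testBit i = true ↔ i = col p := by
    intro t
    refine forall₂_congr fun i _ => ?_
    rw [hnear]
    simp only [Set.mem_singleton_iff, exists_eq_left]
    rw [eq_comm (a := col p)]
  constructor
  · rintro ⟨M, hM, hrep, hI, hS, -⟩
    rcases M.eq_empty_or_nonempty with rfl | ⟨v, hv⟩
    · left
      refine ⟨fun t ht h => ?_, fun i hi j hj h => ?_⟩
      · obtain ⟨u, hu, -⟩ := hI t ht h; simp at hu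
      · obtain ⟨x, -, y, -, -, -, -, u, hu, -⟩ := hS i hi j hj h; simp at hu
    · right
      refine ⟨(Finset.card_pos.mpr ⟨v, hv⟩).trans_le hM, fun t ht h => ?_, fun i hi j hj h => ?_⟩
      · obtain ⟨u, hu, h⟩ := hI t ht h
        obtain rfl : u = p := hrep u hu
        exact (htype t).1 h
      · obtain ⟨x, hx, y, hy, rfl, rfl, hne, u, hu, hf⟩ := hS i hi j hj h
        obtain rfl : u = p := hrep u hu
        have hxu : x = u := by
          have hn := hf.near_eq (he.bag_clique u) hx hy
          rw [hnear] at hn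
          exact (Set.singleton_eq_singleton_iff.mp hn).symm
        subst hxu
        refine ⟨rfl, y, hy.resolve_left hne.symm, rfl⟩
  -- A cluster consisting of p only has no other vertex, so the covering clause is vacuous. The set
  -- {p} favours p over each neighbour because p has distance 0 from itself only.
  · rintro (⟨hI, hS⟩ | ⟨hm, hI, hS⟩)
    · exact ⟨∅, by simp, by simp, fun t ht h => absurd h (hI t ht),
        fun i hi j hj h => absurd h (hS i hi j hj), fun x y _ hor => by simp at hor⟩
    · refine ⟨{p}, by simpa using hm, by simp, fun t ht h => ⟨p, by simp, (htype t).2 (hI t ht h)⟩,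
        fun i hi j hj h => ?_, fun x y _ hor => by simp at hor⟩
      obtain ⟨rfl, w, hw, rfl⟩ := hS i hi j hj h
      refine ⟨p, mem_bag p, w, earlier_subset_bag p hw, rfl, rfl, hw.1.ne', p, by simp, ?_⟩
      intro z hz
      rw [SimpleGraph.edist_self, pos_iff_ne_zero]
      intro hc
      rw [edist_eq_zero_iff] at hc
      subst hc
      rcases hz with rfl | hz
      · exact notMem_earlier p hw
      · exact G.loopless.irrefl _ hz.1

/-- A set of at most `m` vertices in the finished clusters that favours all pairs there. -/
def Done (G : SimpleGraph V) (num : V → ℕ) (rep : V → V) (j m : ℕ) : Prop :=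
  ∃ M : Finset V, M.card ≤ m ∧ (∀ u ∈ M, j ≤ num (rep u)) ∧
    ∀ x y, G.Adj x y → (j ≤ num (rep x) ∨ j ≤ num (rep y)) → ∃ u ∈ M, Favours G (G.edist u) x y

/-- The cluster of c moves into one with an earlier representative, which is not finished either;
the finished clusters stay as they are. -/
theorem done_mergeRep (he : Elim G num par col om) (hc : (earlier G num c).Nonempty) (m : ℕ) :
    Done G num (mergeRep rep c (par c)) (num c) m ↔ Done G num rep (num c + 1) m := by
  have h : ∀ u, num c ≤ num (mergeRep rep c (par c) u) ↔ num c + 1 ≤ num (rep u) := by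
    intro u
    have := (he.par_mem c hc).2
    unfold mergeRep
    split_ifs with hu
    · rw [hu]; omega
    · have : num (rep u) ≠ num c := fun hcc => hu (he.inj hcc)
      omega
  simp only [Done, h]

/-- Without earlier neighbours of c, its cluster is closed under adjacency and at infinite distance
from all other vertices, so the sizes add up. Every edge in the cluster has an end different from c,
so the covering clause accounts for all its pairs. -/
theorem done_root (he : Elim G num par col om) (hr : Clusters G num (num c + 1) rep)
    (hc : earlier G num c = ∅) (m : ℕ) :
    Done G num rep (num c) m ↔ ∃ m₁ m₂, m₁ + m₂ ≤ m ∧ Done G num rep (num c + 1) m₁ ∧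
      Spec G num col om rep c (fun _ => False) (fun _ => False) (fun _ _ => False) m₂ := by
  classical
  have hcl : ∀ a b, G.Adj a b → rep a = c → rep b = c := by
    intro a b hab ha
    by_contra hb
    have := hr.boundary he.inj a ha b hb hab
    rw [hc] at this
    exact this
  have hsep : ∀ u z, (rep u = c ∧ rep z ≠ c ∨ rep u ≠ c ∧ rep z = c) → G.edist u z = ⊤ := by
    rintro u z (⟨hu, hz⟩ | ⟨hu, hz⟩)
    · rcases passes_of_rep_eq he hr hu hz with h | ⟨k, hk, -⟩
      · exact h
      · rw [hc] at hk; exact absurd hk (by simp)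
    · rcases (outside_edist he hr hu).passes z hz with h | ⟨k, hk, -⟩
      · exact h
      · rw [hc] at hk; exact absurd hk (by simp)
  have hfav : ∀ u x y, Favours G (G.edist u) x y → (rep u = c ↔ rep x = c) := by
    intro u x y hf
    have hne : G.edist u x ≠ ⊤ := (lt_of_lt_of_le hf.lt le_top).ne
    constructor
    · intro hu; by_contra hx; exact hne (hsep u x (.inl ⟨hu, hx⟩))
    · intro hx; by_contra hu; exact hne (hsep u x (.inr ⟨hu, hx⟩))
  have hD : ∀ u, num c ≤ num (rep u) ↔ num c + 1 ≤ num (rep u) ∨ rep u = c := by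
    intro u
    by_cases hu : rep u = c
    · rw [hu]; simp
    · have : num (rep u) ≠ num c := fun hcc => hu (he.inj hcc)
      simp only [hu, or_false]; omega
  constructor
  · rintro ⟨M, hM, hrep, hV⟩
    refine ⟨(M.filter fun u => ¬ rep u = c).card, (M.filter fun u => rep u = c).card, ?_,
      ⟨_, le_rfl, ?_, ?_⟩, ⟨_, le_rfl, ?_, ?_, ?_, ?_⟩⟩
    · have := Finset.card_filter_add_card_filter_not (s := M) (fun u => rep u = c)
      omega
    · intro u hu
      rw [Finset.mem_filter] at hu
      exact ((hD u).1 (hrep u hu.1)).resolve_right hu.2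
    · intro x y hxy hor
      obtain ⟨u, hu, hf⟩ := hV x y hxy (hor.imp (by omega) (by omega))
      refine ⟨u, Finset.mem_filter.mpr ⟨hu, fun huc => ?_⟩, hf⟩
      have hx := (hfav u x y hf).1 huc
      have hy := hcl x y hxy hx
      rw [hx, hy] at hor
      omega
    · intro u hu; exact (Finset.mem_filter.mp hu).2
    · intro t _ h; exact h.elim
    · intro i _ j _ h; exact h.elim
    · intro x y hxy hor
      have hx : rep x = c := by
        rcases hor with h | h
        · exact h.1
        · exact hcl y x hxy.symm h.1
      obtain ⟨u, hu, hf⟩ := hV x y hxy (.inl (by rw [hx]))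
      exact .inl ⟨u, Finset.mem_filter.mpr ⟨hu, (hfav u x y hf).2 hx⟩, hf⟩
  · rintro ⟨m₁, m₂, hm, ⟨M₁, hM₁, hrep₁, hV₁⟩, ⟨M₂, hM₂, hrep₂, -, -, hV₂⟩⟩
    refine ⟨M₁ ∪ M₂, (Finset.card_union_le _ _).trans (by omega), ?_, ?_⟩
    · intro u hu
      rw [hD]
      rcases Finset.mem_union.mp hu with hu | hu
      · exact .inl (hrep₁ u hu)
      · exact .inr (hrep₂ u hu)
    · intro x y hxy hor
      rw [hD, hD] at hor
      by_cases hx : rep x = c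
      · have hy := hcl x y hxy hx
        have hor' : rep x = c ∧ x ≠ c ∨ rep y = c ∧ y ≠ c := by
          by_cases hxc : x = c
          · exact .inr ⟨hy, fun hyc => hxy.ne (hxc.trans hyc.symm)⟩
          · exact .inl ⟨hx, hxc⟩
        rcases hV₂ x y hxy hor' with ⟨u, hu, hf⟩ | ⟨t, -, hF, -⟩
        · exact ⟨u, Finset.mem_union_right _ hu, hf⟩
        · exact hF.elim
      · have hy : rep y ≠ c := fun hy => hx (hcl y x hxy.symm hy)
        simp only [hx, hy, or_false] at hor
        obtain ⟨u, hu, hf⟩ := hV₁ x y hxy hor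
        exact ⟨u, Finset.mem_union_left _ hu, hf⟩

theorem done_id {j : ℕ} (hj : ∀ u, num u < j) (m : ℕ) : Done G num id j m :=
  ⟨∅, by simp, by simp, fun x y _ hor => by
    have := hj x; have := hj y; simp only [id] at hor; omega⟩

theorem done_zero_iff (hG : IsChordal G) (m : ℕ) :
    Done G num rep 0 m ↔ ∃ M : Finset V, IsMEGSet G M ∧ M.card ≤ m := by
  simp only [Done, Nat.zero_le, implies_true, true_and, true_or, forall_const, isMEGSet_iff hG]
  exact exists_congr fun M => and_comm

theorem megNumber_le_iff [Fintype V] (m : ℕ) :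
    megNumber G ≤ m ↔ ∃ M : Finset V, IsMEGSet G M ∧ M.card ≤ m := by
  constructor
  · intro h
    have hne : {m : ℕ | ∃ M : Finset V, IsMEGSet G M ∧ M.card = m}.Nonempty :=
      ⟨_, Finset.univ, isMEGSet_univ G, rfl⟩
    obtain ⟨M, hM, hc⟩ := Nat.sInf_mem hne
    exact ⟨M, hM, hc.le.trans h⟩
  · rintro ⟨M, hM, hc⟩
    refine le_trans (Nat.sInf_le ?_) hc
    exact ⟨M, hM, rfl⟩

end Merge

end MEG

namespace RAM

open MEG

/-! ### Reading the input -/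

/-- The memory holds the graph given by the adjacency lists. -/
structure IsInput {n : ℕ} (adj : Fin n → List (Fin n)) (s : State) : Prop where
  card : s.var 0 = n
  succ : ∀ v : Fin n, s.arr 0 (v + 1) = s.arr 0 v + (adj v).length
  total : s.arr 0 n = ∑ v, (adj v).length
  le : ∀ v : Fin n, s.arr 0 v + (adj v).length ≤ s.arr 0 n
  get : ∀ (v : Fin n) (j : ℕ) (h : j < (adj v).length), s.arr 1 (s.arr 0 v + j) = (adj v)[j]

theorem isInput_input {n : ℕ} (adj : Fin n → List (Fin n)) (k : ℕ) :
    IsInput adj (input adj k) := by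
  have hoff : ∀ i ≤ n, (input adj k).arr 0 i = ((List.ofFn adj).take i).flatten.length := by
    intro i hi; simp [input, hi]
  have hsucc : ∀ v : Fin n, (input adj k).arr 0 (v + 1) =
      (input adj k).arr 0 v + (adj v).length := by
    intro v
    rw [hoff _ v.2, hoff _ v.2.le, List.take_add_one, List.flatten_append, List.length_append]
    simp
  have hsplit : ∀ v : Fin n, (List.ofFn adj).flatten =
      ((List.ofFn adj).take v).flatten ++ (adj v ++ ((List.ofFn adj).drop (v + 1)).flatten) := by
    intro v
    conv_lhs => rw [← List.take_append_drop v (List.ofFn adj), List.flatten_append,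
      List.drop_eq_getElem_cons (by simp), List.flatten_cons]
    simp
  refine ⟨by simp [input], hsucc, ?_, ?_, ?_⟩
  · rw [hoff n le_rfl, List.take_of_length_le (by simp), List.length_flatten, List.map_ofFn,
      List.sum_ofFn]
    rfl
  · intro v
    have h := congrArg List.length (hsplit v)
    simp only [List.length_append] at h
    rw [hoff n le_rfl, hoff v v.2.le, List.take_of_length_le (i := n) (by simp), h]
    omega
  · intro v j hj
    have h := congrArg List.length (hsplit v)
    simp only [List.length_append] at h
    have h1 : (input adj k).arr 1 ((input adj k).arr 0 v + j) =
        ((List.ofFn adj).flatten.map Fin.val).getD ((input adj k).arr 0 v + j) 0 := by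
      simp [input]
    have h2 : (List.ofFn adj).flatten[((List.ofFn adj).take v).flatten.length + j]? =
        some (adj v)[j] := by
      conv_lhs => rw [hsplit v]
      rw [List.getElem?_append_right (by omega), Nat.add_sub_cancel_left,
        List.getElem?_append_left hj, List.getElem?_eq_getElem hj]
    rw [h1, hoff v v.2.le, List.getD_eq_getElem?_getD, List.getElem?_map, h2]
    simp

theorem IsInput.congr {n : ℕ} {adj : Fin n → List (Fin n)} {s s' : State} (h : IsInput adj s)
    (h0 : s'.var 0 = s.var 0) (h1 : s'.arr 0 = s.arr 0) (h2 : s'.arr 1 = s.arr 1) :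
    IsInput adj s' := by
  obtain ⟨a, b, c, d, e⟩ := h
  exact ⟨h0.trans a, by rwa [h1], by rwa [h1], by rwa [h1], by rw [h1, h2]; exact e⟩

/-! ### Stacks of vertices by label -/

section Stacks

variable {n : ℕ}

/-- The stacks `stk` (with stride `B` and heights `top`) contain each unvisited vertex (`nu = 0`) at
its label `L`; `r` more pushes are possible. -/
structure Stacks (B bound : ℕ) (nu lab stk top : ℕ → ℕ) (L : Fin n → ℕ) (r : ℕ) : Prop where
  lab_eq : ∀ w : Fin n, nu w = 0 → lab w = L w
  mem : ∀ w : Fin n, nu w = 0 → ∃ i < top (L w), stk (L w * B + i) = w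
  entry : ∀ j ≤ n, ∀ i < top j, ∃ w : Fin n, stk (j * B + i) = w ∧ (nu w = 0 → j ≤ L w)
  sum_le : ∑ j ∈ Finset.range (n + 1), top j + r ≤ bound
  lt : bound < B

theorem Stacks.congr {B bound r r' : ℕ} {nu lab stk top : ℕ → ℕ} {L L' : Fin n → ℕ}
    (h : Stacks B bound nu lab stk top L r) (hL : ∀ w : Fin n, nu w = 0 → L' w = L w)
    (hr : r' ≤ r) : Stacks B bound nu lab stk top L' r' := by
  refine ⟨fun w hw => by rw [h.lab_eq w hw, hL w hw], fun w hw => by rw [hL w hw]; exact h.mem w hw,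
    fun j hj i hi => ?_, by have := h.sum_le; omega, h.lt⟩
  obtain ⟨w, hw, hw'⟩ := h.entry j hj i hi
  exact ⟨w, hw, fun h0 => by rw [hL w h0]; exact hw' h0⟩

theorem Stacks.top_le {B bound r : ℕ} {nu lab stk top : ℕ → ℕ} {L : Fin n → ℕ}
    (h : Stacks B bound nu lab stk top L r) {j : ℕ} (hj : j ≤ n) : top j + r ≤ bound := by
  have := Finset.single_le_sum (f := top) (fun _ _ => Nat.zero_le _)
    (Finset.mem_range.mpr (show j < n + 1 by omega))
  have := h.sum_le
  omega

theorem sum_update_range {top : ℕ → ℕ} {j m x : ℕ} (hj : j < m) :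
    ∑ i ∈ Finset.range m, Function.update top j x i + top j =
      ∑ i ∈ Finset.range m, top i + x := by
  rw [Finset.sum_update_of_mem (Finset.mem_range.mpr hj),
    ← Finset.add_sum_erase _ top (Finset.mem_range.mpr hj), Finset.sdiff_singleton_eq_erase]
  omega

theorem mul_add_inj {B a b i j : ℕ} (hi : i < B) (hj : j < B) (h : a * B + i = b * B + j) :
    a = b ∧ i = j := by
  have h1 : (a * B + i) / B = a := by
    rw [Nat.add_comm, Nat.add_mul_div_right _ _ (by omega), Nat.div_eq_of_lt hi]; omega
  have h2 : (b * B + j) / B = b := by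
    rw [Nat.add_comm, Nat.add_mul_div_right _ _ (by omega), Nat.div_eq_of_lt hj]; omega
  have : a = b := by rw [← h1, h, h2]
  subst this
  exact ⟨rfl, by omega⟩

/-- When the label of w grows, its old entry remains in a lower stack and is discarded later. So an
entry bounds the label of its vertex only from below, and the heights are limited by the budget of
pushes. Since `bound < B`, the rows of the array do not overlap. -/
theorem Stacks.push {B bound r : ℕ} {nu lab stk top : ℕ → ℕ} {L : Fin n → ℕ}
    (h : Stacks B bound nu lab stk top L (r + 1)) {w : Fin n} (hw : nu w = 0) (hL : L w + 1 ≤ n) :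
    Stacks B bound nu (Function.update lab w (L w + 1))
      (Function.update stk ((L w + 1) * B + top (L w + 1)) w)
      (Function.update top (L w + 1) (top (L w + 1) + 1)) (Function.update L w (L w + 1)) r := by
  have htop := h.top_le hL
  have hlt := h.lt
  have hold : ∀ j ≤ n, ∀ i < top j, Function.update stk ((L w + 1) * B + top (L w + 1)) (w : ℕ)
      (j * B + i) = stk (j * B + i) := by
    intro j hj i hi
    have := h.top_le hj
    rw [Function.update_of_ne]
    intro hc
    obtain ⟨rfl, rfl⟩ := mul_add_inj (by omega) (by omega) hc
    exact lt_irrefl _ hi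
  refine ⟨fun x hx => ?_, fun x hx => ?_, fun j hj i hi => ?_, ?_, hlt⟩
  · by_cases hxw : x = w
    · subst hxw; simp
    · rw [Function.update_of_ne hxw, Function.update_of_ne (fun hc => hxw (Fin.ext hc)),
        h.lab_eq x hx]
  · by_cases hxw : x = w
    · subst hxw
      exact ⟨top (L x + 1), by simp, by simp⟩
    · rw [Function.update_of_ne hxw]
      obtain ⟨i, hi, hs⟩ := h.mem x hx
      by_cases hLn : L x ≤ n
      · refine ⟨i, ?_, by rw [hold _ hLn i hi, hs]⟩
        by_cases hc : L x = L w + 1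
        · rw [hc] at hi ⊢; simp; omega
        · rwa [Function.update_of_ne hc]
      -- A label above n does not occur in the search, but the structure does not exclude it. Its
      -- row starts beyond the cell that is written.
      · refine ⟨i, by rwa [Function.update_of_ne (by omega)], ?_⟩
        by_cases hc : L x * B + i = (L w + 1) * B + top (L w + 1)
        · exfalso
          have h1 : (L w + 2) * B ≤ L x * B := Nat.mul_le_mul_right _ (by omega)
          have h2 : (L w + 2) * B = (L w + 1) * B + B := by ring
          omega
        · rwa [Function.update_of_ne hc]
  · have hcase : i < top j ∨ (j = L w + 1 ∧ i = top j) := by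
      by_cases hc : j = L w + 1
      · subst hc; simp at hi; omega
      · rw [Function.update_of_ne hc] at hi; exact .inl hi
    rcases hcase with hi' | ⟨rfl, rfl⟩
    · obtain ⟨x, hx, hx'⟩ := h.entry j hj i hi'
      refine ⟨x, by rw [hold j hj i hi', hx], fun h0 => (hx' h0).trans ?_⟩
      by_cases hxw : x = w
      · subst hxw; simp
      · rw [Function.update_of_ne hxw]
    · exact ⟨w, by simp, fun _ => by simp⟩
  · have := sum_update_range (top := top) (x := top (L w + 1) + 1) (show L w + 1 < n + 1 by omega)
    have := h.sum_le
    omega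

/-- The removed entry belongs to a vertex that counts as visited under `nu'`, so no unvisited vertex
loses its entry, and the budget gains one push. -/
theorem Stacks.pop {B bound r : ℕ} {nu nu' lab stk top : ℕ → ℕ} {L : Fin n → ℕ}
    (h : Stacks B bound nu lab stk top L r) {l : ℕ} (hl : l ≤ n) (htop : top l ≠ 0)
    (hnu : ∀ w : Fin n, nu' w = 0 → nu w = 0) (hpop : nu' (stk (l * B + (top l - 1))) ≠ 0)
    {r' : ℕ} (hr : r' ≤ r + 1) :
    Stacks B bound nu' lab stk (Function.update top l (top l - 1)) L r' := by
  refine ⟨fun w hw => h.lab_eq w (hnu w hw), fun w hw => ?_, fun j hj i hi => ?_, ?_, h.lt⟩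
  · obtain ⟨i, hi, hs⟩ := h.mem w (hnu w hw)
    refine ⟨i, ?_, hs⟩
    by_cases hc : L w = l
    · rw [hc] at hi hs ⊢
      rw [Function.update_self]
      refine lt_of_le_of_ne (by omega) fun hcc => hpop ?_
      rw [← hcc, hs]; exact hw
    · rwa [Function.update_of_ne hc]
  · obtain ⟨w, hw, hw'⟩ := h.entry j hj i (by
      by_cases hc : j = l
      · subst hc; simp at hi; omega
      · rwa [Function.update_of_ne hc] at hi)
    exact ⟨w, hw, fun h0 => hw' (hnu w h0)⟩
  · have := sum_update_range (top := top) (x := top l - 1) (show l < n + 1 by omega)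
    have := h.sum_le
    omega

end Stacks

end RAM

namespace RAM

open MEG

/-! ### Maximum cardinality search -/

section Search

variable {n : ℕ}

open Classical in
/-- The number of visited neighbours. -/
noncomputable def seen (G : SimpleGraph (Fin n)) (nu : ℕ → ℕ) (w : Fin n) : ℕ :=
  (Finset.univ.filter fun x : Fin n => G.Adj x w ∧ nu x ≠ 0).card

open Classical in
/-- The number of visited neighbours, where `v` is counted only for the vertices in `T`. -/
noncomputable def seenUpTo (G : SimpleGraph (Fin n)) (nu : ℕ → ℕ) (v : Fin n) (T : List (Fin n))
    (w : Fin n) : ℕ :=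
  (Finset.univ.filter fun x : Fin n => G.Adj x w ∧ nu x ≠ 0 ∧ (x = v → w ∈ T)).card

theorem seen_le (G : SimpleGraph (Fin n)) (nu : ℕ → ℕ) (w : Fin n) : seen G nu w ≤ n := by
  classical
  exact (Finset.card_le_univ _).trans (by simp)

theorem seenUpTo_le (G : SimpleGraph (Fin n)) (nu : ℕ → ℕ) (v : Fin n) (T : List (Fin n))
    (w : Fin n) : seenUpTo G nu v T w ≤ n := by
  classical
  exact (Finset.card_le_univ _).trans (by simp)

theorem seenUpTo_of_notMem {G : SimpleGraph (Fin n)} {nu : ℕ → ℕ} {v : Fin n}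
    {T : List (Fin n)} {w₀ : Fin n} (hadj : G.Adj v w₀) (hv : nu v ≠ 0) (h : w₀ ∉ T) :
    seenUpTo G nu v (T ++ [w₀]) w₀ = seenUpTo G nu v T w₀ + 1 := by
  classical
  unfold seenUpTo
  rw [← Finset.card_insert_of_notMem (a := v) (by simp [h])]
  congr 1
  ext x
  by_cases hx : x = v
  · subst hx; simp [hadj, hv]
  · simp [hx]

theorem seenUpTo_of_ne {G : SimpleGraph (Fin n)} {nu : ℕ → ℕ} {v : Fin n}
    {T : List (Fin n)} {w₀ w : Fin n} (h : w ≠ w₀) :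
    seenUpTo G nu v (T ++ [w₀]) w = seenUpTo G nu v T w := by
  classical
  unfold seenUpTo
  congr 1
  ext x
  simp [h]

theorem seenUpTo_adj {G : SimpleGraph (Fin n)} {adj : Fin n → List (Fin n)}
    (hadj : IsAdjList G adj) (nu : ℕ → ℕ) (v w : Fin n) :
    seenUpTo G nu v (adj v) w = seen G nu w := by
  classical
  unfold seenUpTo seen
  congr 1
  ext x
  simp only [Finset.mem_filter, Finset.mem_univ, true_and]
  constructor
  · rintro ⟨h1, h2, -⟩; exact ⟨h1, h2⟩
  · rintro ⟨h1, h2⟩; exact ⟨h1, h2, fun hx => ((hadj v).2 w).2 (hx ▸ h1)⟩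

theorem seenUpTo_nil {G : SimpleGraph (Fin n)} {nu : ℕ → ℕ} {v : Fin n} {x : ℕ}
    (hv : nu v = 0) (w : Fin n) :
    seenUpTo G (Function.update nu v x) v [] w = seen G nu w := by
  classical
  unfold seenUpTo seen
  congr 1
  ext y
  by_cases hy : y = v
  · subst hy; simp [hv]
  · simp [hy, Function.update_of_ne (fun hc => hy (Fin.ext hc) : (y : ℕ) ≠ v)]

/-- Increase the label of the unvisited neighbour at position `i`. -/
def scanBody : Cmd :=
  .seq (.assign 7 (.read 1 (.var 6)))
    (.cond (.read 3 (.var 7)) .skip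
      (.seq (.write 2 (.var 7) (.bin .add (.read 2 (.var 7)) (.const 1)))
        (.seq (.write 4 (.bin .add (.bin .mul (.read 2 (.var 7)) (.var 4))
            (.read 5 (.read 2 (.var 7)))) (.var 7))
          (.write 5 (.read 2 (.var 7)) (.bin .add (.read 5 (.read 2 (.var 7))) (.const 1))))))

def scanLoop : Cmd :=
  .forLoop 6 (.read 0 (.var 5)) (.read 0 (.bin .add (.var 5) (.const 1))) scanBody

theorem run_scanLoop {V B bound r : ℕ} {s : State} {G : SimpleGraph (Fin n)}
    {adj : Fin n → List (Fin n)} (hadj : IsAdjList G adj) (hin : IsInput adj s) (v : Fin n)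
    (hv : s.var 5 = v) (hB : s.var 4 = B) (hV : n + bound ≤ V) (hnv : s.arr 3 v ≠ 0)
    (hst : Stacks B bound (s.arr 3) (s.arr 2) (s.arr 4) (s.arr 5)
      (seenUpTo G (s.arr 3) v []) (r + (adj v).length)) :
    Run V ((adj v).length * 51 + 11) scanLoop s (fun s' =>
      Stacks B bound (s.arr 3) (s'.arr 2) (s'.arr 4) (s'.arr 5) (seen G (s.arr 3)) r ∧
      ∑ j ∈ Finset.range (n + 1), s'.arr 5 j ≤
        ∑ j ∈ Finset.range (n + 1), s.arr 5 j + (adj v).length) := by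
  refine Run.bdd fun hbd => ?_
  set nu := s.arr 3 with hnu
  refine Run.forLoop (s.arr 0 v) (adj v).length 40 (fun j s' =>
      Stacks B bound nu (s'.arr 2) (s'.arr 4) (s'.arr 5) (seenUpTo G nu v ((adj v).take j))
        (r + ((adj v).length - j)) ∧
      ∑ i ∈ Finset.range (n + 1), s'.arr 5 i ≤ ∑ i ∈ Finset.range (n + 1), s.arr 5 i + j)
    rfl rfl ?_ (by decide) ?_ ?_ ?_ ?_ ?_ ?_
  · simp [hv]
  · exact (hin.le v).trans (hbd.arr_le _ _)
  · intro s' hf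
    have h0 : s'.arr 0 = s.arr 0 := hf.arr 0 (by decide)
    have h5 : s'.var 5 = s.var 5 := hf.var 5 (by decide)
    simp [h0, h5, hv, hin.succ v]
  · refine ⟨by simpa only [State.setVar_arr, List.take_zero, Nat.sub_zero] using hst, ?_⟩
    simp [State.setVar_arr]
  · intro j s' hj hb hf hx ⟨hS, hsum⟩
    have h1 : s'.arr 1 = s.arr 1 := hf.arr 1 (by decide)
    have h3 : s'.arr 3 = nu := hf.arr 3 (by decide)
    have h4 : s'.var 4 = B := (hf.var 4 (by decide)).trans hB
    have hget : s'.arr 1 (s.arr 0 v + j) = (adj v)[j] := by rw [h1]; exact hin.get v j hj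
    generalize hw₀ : (adj v)[j] = w₀ at hget
    have hmem : w₀ ∈ adj v := hw₀ ▸ List.getElem_mem hj
    have htake : (adj v).take (j + 1) = (adj v).take j ++ [w₀] := by
      rw [List.take_add_one, List.getElem?_eq_getElem hj, hw₀]; rfl
    have hnot : w₀ ∉ (adj v).take j := by
      have := ((hadj v).1.sublist (List.take_sublist (j + 1) _))
      rw [htake, List.nodup_append] at this
      intro hc
      exact this.2.2 _ hc _ (by simp) rfl
    have hvw : G.Adj v w₀ := ((hadj v).2 w₀).1 hmem
    have hw₀n := w₀.2
    have hVV := hb.two_le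
    refine Run.seq 3 37 (Run.assign rfl ?_ ?_ (by simp [Expr.cost])) le_rfl
    · exact hb.arr_le _ _
    simp only [Expr.eval_read, Expr.eval_var, hx, hget]
    refine Run.cond 34 rfl ?_ ?_ (by simp [Expr.cost])
    · intro h
      simp only [Expr.eval_read, Expr.eval_var, State.setVar_var, State.setVar_arr, h3,
        if_true] at h
      refine Run.skip ⟨?_, ?_⟩ (by omega)
      · simp only [State.setVar_arr]
        refine hS.congr (fun w hw => ?_) (by omega)
        rw [htake, seenUpTo_of_ne]
        rintro rfl; exact h hw
      · simp only [State.setVar_arr]; omega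
    · intro h
      simp only [Expr.eval_read, Expr.eval_var, State.setVar_var, State.setVar_arr, h3,
        if_true] at h
      have hL1 := seenUpTo_of_notMem hvw hnv hnot
      have hLn := seenUpTo_le G nu v ((adj v).take j ++ [w₀]) w₀
      rw [hL1] at hLn
      have hlab : s'.arr 2 w₀ = seenUpTo G nu v ((adj v).take j) w₀ := hS.lab_eq w₀ h
      have htop := hS.top_le (j := seenUpTo G nu v ((adj v).take j) w₀ + 1) hLn
      have hpush := (hS.congr (r' := r + ((adj v).length - (j + 1)) + 1) (fun _ _ => rfl)
        (by omega)).push h hLn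
      have hsumu := sum_update_range (top := s'.arr 5)
        (x := s'.arr 5 (seenUpTo G nu v ((adj v).take j) w₀ + 1) + 1)
        (show seenUpTo G nu v ((adj v).take j) w₀ + 1 < n + 1 by omega)
      refine Run.seq 8 26 (Run.write rfl rfl ?_ ?_ (by simp [Expr.cost])) le_rfl
      · simp [State.setVar_var, State.setVar_arr, hlab]; omega
      refine Run.seq 12 14 (Run.write rfl rfl ?_ ?_ (by simp [Expr.cost])) le_rfl
      · simp [State.setVar_var, State.setVar_arr, State.setArr_var]; omega
      refine Run.write rfl rfl ?_ ?_ (by simp [Expr.cost])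
      · simp [State.setVar_var, State.setVar_arr, State.setArr_var, State.setArr_arr, hlab]; omega
      · simp only [Expr.eval_read, Expr.eval_var, Expr.eval_bin, Expr.eval_const, BinOp.apply_add,
          BinOp.apply_mul, State.setVar_var, State.setVar_arr, State.setArr_var, State.setArr_arr,
          if_true, hlab, Function.update_self, h4,
          Nat.reduceEqDiff, if_false]
        refine ⟨(hpush.congr (fun w hw => ?_) le_rfl), by omega⟩
        by_cases hww : w = w₀
        · subst hww; rw [htake, hL1, Function.update_self]
        · rw [htake, seenUpTo_of_ne hww, Function.update_of_ne hww]
  · rintro s' hb hf - ⟨hS, hsum⟩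
    rw [List.take_length] at hS
    exact ⟨hS.congr (fun w _ => (seenUpTo_adj hadj nu v w).symm) (by omega), hsum⟩
  · simp [Expr.cost]

end Search

end RAM

namespace RAM

open MEG

/-! ### Choosing and numbering the next vertex of the search -/

section Search

variable {n : ℕ}

open Classical in
/-- The number of neighbours of `c` visited before `b`. -/
noncomputable def seenBefore (G : SimpleGraph (Fin n)) (nu : ℕ → ℕ) (b c : Fin n) : ℕ :=
  (Finset.univ.filter fun x : Fin n => G.Adj x c ∧ nu x ≠ 0 ∧ nu x < nu b).card

/-- `cnt` vertices have been visited; `nu` numbers them from `1`, and `ord` lists them. -/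
structure Numbering (G : SimpleGraph (Fin n)) (cnt : ℕ) (nu ord : ℕ → ℕ) : Prop where
  le : ∀ v : Fin n, nu v ≤ cnt
  ord_eq : ∀ v : Fin n, nu v ≠ 0 → ord (nu v - 1) = v
  ex : ∀ i < cnt, ∃ v : Fin n, nu v = i + 1
  mcs : ∀ b c : Fin n, nu b ≠ 0 → (nu c = 0 ∨ nu b < nu c) →
    seenBefore G nu b c ≤ seenBefore G nu b b

theorem update_fin {nu : ℕ → ℕ} {v w : Fin n} {x : ℕ} (h : w ≠ v) :
    Function.update nu v x w = nu w := Function.update_of_ne (fun hc => h (Fin.ext hc)) _ _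

theorem Numbering.exists_unvisited {G : SimpleGraph (Fin n)} {cnt : ℕ} {nu ord : ℕ → ℕ}
    (h : Numbering G cnt nu ord) (hc : cnt < n) : ∃ v : Fin n, nu v = 0 := by
  by_contra! hcon
  have hinj : Function.Injective (fun v : Fin n =>
      (⟨nu v - 1, by have := h.le v; have := hcon v; omega⟩ : Fin cnt)) := by
    intro a b hab
    simp only [Fin.mk.injEq] at hab
    exact Fin.ext (by rw [← h.ord_eq a (hcon a), ← h.ord_eq b (hcon b), hab])
  have := Fintype.card_le_of_injective _ hinj
  simp at this
  omega

theorem Numbering.cnt_le {G : SimpleGraph (Fin n)} {cnt : ℕ} {nu ord : ℕ → ℕ}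
    (h : Numbering G cnt nu ord) : cnt ≤ n := by
  choose f hf using h.ex
  have hinj : Function.Injective (fun i : Fin cnt => f i i.2) := by
    intro a b hab
    have ha := hf a a.2
    have hb := hf b b.2
    simp only at hab
    rw [hab] at ha
    exact Fin.ext (by omega)
  have := Fintype.card_le_of_injective _ hinj
  simpa using this

/-- For the new vertex, the vertices numbered before it are exactly the visited ones, so its search
condition is the maximality of its label. For older vertices the new one counts on neither side. -/
theorem Numbering.visit {G : SimpleGraph (Fin n)} {cnt : ℕ} {nu ord : ℕ → ℕ}
    (h : Numbering G cnt nu ord) {v : Fin n} (hv : nu v = 0)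
    (hmax : ∀ w : Fin n, nu w = 0 → seen G nu w ≤ seen G nu v) :
    Numbering G (cnt + 1) (Function.update nu v (cnt + 1)) (Function.update ord cnt v) := by
  classical
  refine ⟨fun w => ?_, fun w hw => ?_, fun i hi => ?_, fun b c hb hbc => ?_⟩
  · by_cases hwv : w = v
    · subst hwv; simp
    · rw [update_fin hwv]; have := h.le w; omega
  · by_cases hwv : w = v
    · subst hwv; simp
    · rw [update_fin hwv] at hw ⊢
      have := h.le w
      rw [Function.update_of_ne (by omega), h.ord_eq w hw]
  · rcases Nat.lt_succ_iff_lt_or_eq.mp hi with hi | rfl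
    · obtain ⟨w, hw⟩ := h.ex i hi
      refine ⟨w, ?_⟩
      rw [update_fin, hw]
      rintro rfl; omega
    · exact ⟨v, by simp⟩
  · by_cases hbv : b = v
    · subst hbv
      have hs : ∀ c, seenBefore G (Function.update nu b (cnt + 1)) b c = seen G nu c := by
        intro c
        unfold seenBefore seen
        congr 1
        ext x
        by_cases hx : x = b
        · subst hx; simp [hv]
        · have := h.le x
          simp only [Finset.mem_filter, Finset.mem_univ, true_and, update_fin hx,
            Function.update_self]
          constructor
          · rintro ⟨h1, h2, -⟩; exact ⟨h1, h2⟩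
          · rintro ⟨h1, h2⟩; exact ⟨h1, h2, by omega⟩
      rw [hs, hs]
      by_cases hcb : c = b
      · rw [hcb]
      · rw [update_fin hcb, Function.update_self] at hbc
        have := h.le c
        exact hmax c (by omega)
    · rw [update_fin hbv] at hb hbc
      have hs : ∀ c, seenBefore G (Function.update nu v (cnt + 1)) b c = seenBefore G nu b c := by
        intro c
        unfold seenBefore
        congr 1
        ext x
        have := h.le b
        by_cases hx : x = v
        · subst hx
          simp only [Finset.mem_filter, Finset.mem_univ, true_and, update_fin hbv,
            Function.update_self, hv]
          constructor
          · rintro ⟨h1, h2, h3⟩; omega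
          · rintro ⟨h1, h2, h3⟩; omega
        · simp only [Finset.mem_filter, Finset.mem_univ, true_and, update_fin hx, update_fin hbv]
      rw [hs, hs]
      refine h.mcs b c hb ?_
      by_cases hcv : c = v
      · rw [hcv]; exact .inl hv
      · rwa [update_fin hcv] at hbc

theorem seen_update_le (G : SimpleGraph (Fin n)) (nu : ℕ → ℕ) (v w : Fin n) (x : ℕ) :
    seen G (Function.update nu v x) w ≤ seen G nu w + 1 := by
  classical
  unfold seen
  refine (Finset.card_le_card (t := insert v (Finset.univ.filter fun x : Fin n =>
    G.Adj x w ∧ nu x ≠ 0)) fun y hy => ?_).trans (Finset.card_insert_le _ _)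
  by_cases hyv : y = v
  · simp [hyv]
  · simpa [update_fin hyv, hyv] using hy

open Classical in
/-- The sum of `f` over the vertices that have not been visited. -/
noncomputable def restSum (nu : ℕ → ℕ) (f : Fin n → ℕ) : ℕ :=
  ∑ v : Fin n, if nu v = 0 then f v else 0

theorem restSum_update {nu : ℕ → ℕ} {f : Fin n → ℕ} {v : Fin n} {x : ℕ} (hv : nu v = 0)
    (hx : x ≠ 0) : restSum (Function.update nu v x) f + f v = restSum nu f := by
  classical
  unfold restSum
  rw [← Finset.add_sum_erase _ _ (Finset.mem_univ v),
    ← Finset.add_sum_erase _ (fun v : Fin n => if nu v = 0 then f v else 0)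
      (Finset.mem_univ v), Finset.sum_congr rfl fun w hw => by
      rw [update_fin (Finset.ne_of_mem_erase hw)]]
  simp [hv, hx, add_comm]

/-- Take a vertex from the highest nonempty stack. -/
def searchBody : Cmd :=
  .cond (.read 5 (.var 3))
    (.seq (.write 5 (.var 3) (.bin .sub (.read 5 (.var 3)) (.const 1)))
      (.seq (.assign 5 (.read 4 (.bin .add (.bin .mul (.var 3) (.var 4)) (.read 5 (.var 3)))))
        (.cond (.read 3 (.var 5)) .skip
          (.seq (.write 6 (.var 2) (.var 5))
            (.seq (.assign 2 (.bin .add (.var 2) (.const 1)))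
              (.seq (.write 3 (.var 5) (.var 2))
                (.seq (.assign 3 (.bin .add (.var 3) (.const 1))) scanLoop)))))))
    (.assign 3 (.bin .sub (.var 3) (.const 1)))

def searchLoop : Cmd := .loop (.bin .lt (.var 2) (.var 0)) searchBody

/-- The invariant of the search. -/
structure SearchInv (G : SimpleGraph (Fin n)) (adj : Fin n → List (Fin n)) (B bound : ℕ)
    (s : State) : Prop where
  num : Numbering G (s.var 2) (s.arr 3) (s.arr 6)
  stack_inv : Stacks B bound (s.arr 3) (s.arr 2) (s.arr 4) (s.arr 5) (seen G (s.arr 3))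
    (restSum (s.arr 3) fun v => (adj v).length)
  seen_le : ∀ w : Fin n, s.arr 3 w = 0 → seen G (s.arr 3) w ≤ s.var 3
  level_le : s.var 3 ≤ s.var 2

/-- The potential of the search. -/
noncomputable def searchPot (adj : Fin n → List (Fin n)) (s : State) : ℕ :=
  40 * ∑ j ∈ Finset.range (n + 1), s.arr 5 j + 40 * s.var 3 +
    restSum (s.arr 3) (fun v => 100 * (adj v).length + 200)

/-- Amortised cost: discarding an outdated entry or lowering the level is paid for by the 40 units
deposited on each entry and each level. A visit raises the level by one and pushes at most as many
entries as the degree, and it releases 100 · degree + 200 units for the deposits and the scan. -/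
theorem run_searchBody {V B bound : ℕ} {s : State} {G : SimpleGraph (Fin n)}
    {adj : Fin n → List (Fin n)} (hadj : IsAdjList G adj) (hin : IsInput adj s)
    (hB : s.var 4 = B) (hV : n + bound ≤ V) (hI : SearchInv G adj B bound s) (hlt : s.var 2 < n) :
    ∃ t, Run V t searchBody s (fun s' => SearchInv G adj B bound s' ∧
      searchPot adj s' + t + 4 ≤ searchPot adj s) := by
  obtain ⟨hnum, hst, hseen, hlev⟩ := hI
  have hln : s.var 3 ≤ n := by omega
  set l := s.var 3 with hl
  by_cases htop : s.arr 5 l = 0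
  · refine ⟨7, Run.cond 4 rfl (fun h => absurd htop h) (fun _ => ?_) (by simp [Expr.cost])⟩
    -- Some unvisited vertex has a label at most l, and none has label l as the stack is empty. So l
    -- is positive, and the truncated subtraction really lowers the potential.
    obtain ⟨w, hw⟩ := hnum.exists_unvisited hlt
    have hne : ∀ w : Fin n, s.arr 3 w = 0 → seen G (s.arr 3) w ≠ l := by
      intro w hw hc
      obtain ⟨i, hi, -⟩ := hst.mem w hw
      rw [hc, htop] at hi; omega
    have h1 := hseen w hw
    have h2 := hne w hw
    refine Run.bdd fun hb => Run.assign rfl ?_ ?_ (by simp [Expr.cost])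
    · exact (Nat.sub_le _ _).trans (hb.var_le 3)
    · refine ⟨⟨hnum, hst, fun w hw => ?_, ?_⟩, ?_⟩
      · have h1 := hseen w hw
        have h2 := hne w hw
        simp only [State.setVar_var, State.setVar_arr, Expr.eval_bin, Expr.eval_var,
          Expr.eval_const, BinOp.apply_sub, if_true]
        omega
      · simp [State.setVar_var]; omega
      · simp only [searchPot, State.setVar_var, State.setVar_arr, Expr.eval_bin, Expr.eval_var,
          Expr.eval_const, BinOp.apply_sub, if_true]
        omega
  · obtain ⟨v, hv, hvl⟩ := hst.entry l hln (s.arr 5 l - 1) (by omega)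
    have hsum := sum_update_range (top := s.arr 5) (x := s.arr 5 l - 1) (show l < n + 1 by omega)
    have hv2 := v.2
    by_cases hnv : s.arr 3 v = 0
    -- The entry shows that the label is at least l, and the level bounds all labels of unvisited
    -- vertices by l. So v has the largest label.
    · have hsl : seen G (s.arr 3) v = l := le_antisymm (hseen v hnv) (hvl hnv)
      have hd := restSum_update (f := fun v => (adj v).length) (x := s.var 2 + 1) hnv (by omega)
      have hd' := restSum_update (f := fun v => 100 * (adj v).length + 200) (x := s.var 2 + 1)
        hnv (by omega)
      have hpop := hst.pop (nu' := Function.update (s.arr 3) v (s.var 2 + 1)) hln htop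
        (fun w hw => by
          by_cases hwv : w = v
          · rw [hwv]; exact hnv
          · rwa [update_fin hwv] at hw) (by rw [hv]; simp) (Nat.le_succ _)
      refine ⟨(adj v).length * 51 + 60, Run.cond ((adj v).length * 51 + 50) rfl (fun _ => ?_)
        (fun h => absurd h htop) (by simp [Expr.cost]; omega)⟩
      refine Run.bdd fun hb => ?_
      have hb5 := hb.arr_le 5 l
      refine Run.seq 6 ((adj v).length * 51 + 44) (Run.write rfl rfl ?_ ?_ (by simp [Expr.cost]))
        (by omega)
      · simp only [Expr.eval_read, Expr.eval_bin, Expr.eval_var, Expr.eval_const, BinOp.apply_sub,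
          ← hl]
        omega
      simp only [Expr.eval_read, Expr.eval_bin, Expr.eval_var, Expr.eval_const, BinOp.apply_sub,
        ← hl]
      have hev : (Expr.read 4 (.bin .add (.bin .mul (.var 3) (.var 4)) (.read 5 (.var 3)))).eval
          (s.setArr 5 l (s.arr 5 l - 1)) = v := by
        simp [State.setArr_var, State.setArr_arr, ← hl, hB, hv]
      refine Run.seq 8 ((adj v).length * 51 + 36) (Run.assign rfl ?_ ?_ (by simp [Expr.cost]))
        (by omega)
      · rw [hev]; omega
      rw [hev]
      refine Run.cond ((adj v).length * 51 + 33) rfl (fun h => absurd hnv ?_) (fun _ => ?_)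
        (by simp [Expr.cost]; omega)
      · simpa [State.setVar_var, State.setVar_arr, State.setArr_arr] using h
      refine Run.seq 3 ((adj v).length * 51 + 30) (Run.write rfl rfl ?_ ?_ (by simp [Expr.cost]))
        (by omega)
      · simp [State.setVar_var]; omega
      refine Run.seq 4 ((adj v).length * 51 + 26) (Run.assign rfl ?_ ?_ (by simp [Expr.cost]))
        (by omega)
      · simp [State.setVar_var, State.setArr_var]; omega
      refine Run.seq 3 ((adj v).length * 51 + 23) (Run.write rfl rfl ?_ ?_ (by simp [Expr.cost]))
        (by omega)
      · simp [State.setVar_var, State.setArr_var]; omega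
      refine Run.seq 4 ((adj v).length * 51 + 11) (Run.assign rfl ?_ ?_ (by simp [Expr.cost]))
        (by omega)
      · simp [State.setVar_var, State.setArr_var, ← hl]; omega
      simp only [Expr.eval_bin, Expr.eval_var, Expr.eval_const, BinOp.apply_add,
        State.setVar_var, State.setArr_var, if_true,
        Nat.reduceEqDiff, if_false]
      set s1 := ((((((s.setArr 5 l (s.arr 5 l - 1)).setVar 5 v).setArr 6 (s.var 2) v).setVar 2
        (s.var 2 + 1)).setArr 3 v (s.var 2 + 1)).setVar 3 (l + 1)) with hs1
      have e3 : s1.arr 3 = Function.update (s.arr 3) v (s.var 2 + 1) := by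
        simp [hs1, State.setVar_arr, State.setArr_arr]
      have e2 : s1.arr 2 = s.arr 2 := by simp [hs1, State.setVar_arr, State.setArr_arr]
      have e4 : s1.arr 4 = s.arr 4 := by simp [hs1, State.setVar_arr, State.setArr_arr]
      have e5 : s1.arr 5 = Function.update (s.arr 5) l (s.arr 5 l - 1) := by
        simp [hs1, State.setVar_arr, State.setArr_arr]
      have e6 : s1.arr 6 = Function.update (s.arr 6) (s.var 2) v := by
        simp [hs1, State.setVar_arr, State.setArr_arr]
      have hin1 : IsInput adj s1 := hin.congr
        (by simp [hs1, State.setVar_var, State.setArr_var])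
        (by simp [hs1, State.setVar_arr, State.setArr_arr])
        (by simp [hs1, State.setVar_arr, State.setArr_arr])
      refine (run_scanLoop (B := B) (bound := bound)
        (r := restSum (Function.update (s.arr 3) v (s.var 2 + 1)) fun v => (adj v).length)
        hadj hin1 v (by simp [hs1, State.setVar_var, State.setArr_var])
        (by simp [hs1, State.setVar_var, State.setArr_var, hB]) hV
        (by rw [e3]; simp) ?_).mono le_rfl ?_
      · rw [e2, e3, e4, e5]
        exact hpop.congr (fun w _ => seenUpTo_nil hnv w) hd.le
      · intro s' hb' hf ⟨hst', hsum'⟩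
        have f2 : s'.var 2 = s.var 2 + 1 := (hf.var 2 (by decide)).trans (by
          simp [hs1, State.setVar_var, State.setArr_var])
        have f3 : s'.var 3 = l + 1 := (hf.var 3 (by decide)).trans (by
          simp [hs1, State.setVar_var])
        have g3 := (hf.arr 3 (by decide)).trans e3
        have g6 := (hf.arr 6 (by decide)).trans e6
        rw [e3] at hst'
        rw [e5] at hsum'
        refine ⟨⟨?_, ?_, ?_, ?_⟩, ?_⟩
        · rw [f2, g3, g6]
          exact hnum.visit hnv fun w hw => (hseen w hw).trans hsl.ge
        · rw [g3]; exact hst'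
        · rw [g3, f3]
          intro w hw
          refine (seen_update_le G _ _ _ _).trans (Nat.succ_le_succ (hseen w ?_))
          by_cases hwv : w = v
          · rw [hwv]; exact hnv
          · rwa [update_fin hwv] at hw
        · omega
        · simp only [searchPot, g3, f3, ← hl]
          omega
    · refine ⟨30, Run.cond 27 rfl (fun _ => ?_) (fun h => absurd h htop) (by simp [Expr.cost])⟩
      refine Run.bdd fun hb => ?_
      have hb5 := hb.arr_le 5 l
      refine Run.seq 6 21 (Run.write rfl rfl ?_ ?_ (by simp [Expr.cost])) (by omega)
      · simp only [Expr.eval_read, Expr.eval_bin, Expr.eval_var, Expr.eval_const, BinOp.apply_sub,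
          ← hl]
        omega
      simp only [Expr.eval_read, Expr.eval_bin, Expr.eval_var, Expr.eval_const, BinOp.apply_sub,
        ← hl]
      have hev : (Expr.read 4 (.bin .add (.bin .mul (.var 3) (.var 4)) (.read 5 (.var 3)))).eval
          (s.setArr 5 l (s.arr 5 l - 1)) = v := by
        simp [State.setArr_var, State.setArr_arr, ← hl, hB, hv]
      refine Run.seq 8 13 (Run.assign rfl ?_ ?_ (by simp [Expr.cost])) (by omega)
      · rw [hev]; omega
      rw [hev]
      refine Run.cond 5 rfl (fun _ => ?_) (fun h => absurd ?_ hnv) (by simp [Expr.cost])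
      swap
      · simpa [State.setVar_var, State.setVar_arr, State.setArr_arr] using h
      refine Run.skip ⟨⟨?_, ?_, ?_, ?_⟩, ?_⟩ (by omega)
      · simpa [State.setVar_var, State.setVar_arr, State.setArr_arr, State.setArr_var] using hnum
      · simpa [State.setVar_var, State.setVar_arr, State.setArr_arr, State.setArr_var] using
          hst.pop (nu' := s.arr 3) hln htop (fun _ h => h) (by rwa [hv]) (Nat.le_succ _)
      · simpa [State.setVar_var, State.setVar_arr, State.setArr_arr, State.setArr_var] using hseen
      · simpa [State.setVar_var, State.setVar_arr, State.setArr_arr, State.setArr_var] using hlev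
      · simp only [searchPot, State.setVar_var, State.setVar_arr, State.setArr_arr,
          State.setArr_var, if_true, Nat.reduceEqDiff, if_false]
        omega

theorem run_searchLoop {V B bound : ℕ} {s : State} {G : SimpleGraph (Fin n)}
    {adj : Fin n → List (Fin n)} (hadj : IsAdjList G adj) (hin : IsInput adj s)
    (hB : s.var 4 = B) (hV : n + bound ≤ V) (hI : SearchInv G adj B bound s) :
    Run V (searchPot adj s + 4) searchLoop s
      (fun s' => Numbering G n (s'.arr 3) (s'.arr 6)) := by
  refine Run.loop (SearchInv G adj B bound) (searchPot adj) rfl hI ?_ ?_ (by simp [Expr.cost])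
  · intro s' hb hf hI' he
    have h0 := hf.var 0 (by decide)
    have hin' : IsInput adj s' :=
      hin.congr h0 (hf.arr 0 (by decide)) (hf.arr 1 (by decide))
    have hlt : s'.var 2 < n := by
      by_contra hc
      simp [hin'.card, hc] at he
    exact run_searchBody hadj hin' ((hf.var 4 (by decide)).trans hB) hV hI' hlt
  · intro s' hb hf hI' he
    have h0 := hf.var 0 (by decide)
    have hin' : IsInput adj s' :=
      hin.congr h0 (hf.arr 0 (by decide)) (hf.arr 1 (by decide))
    have hge : s'.var 2 = n := by
      refine le_antisymm hI'.num.cnt_le ?_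
      by_contra hc
      simp [hin'.card, not_le.mp hc] at he
    have h := hI'.num
    rwa [hge] at h

/-- The stride exceeds the number of entries ever pushed, namely n at the start and at most one for
each position in the adjacency lists. All labels and numbers are 0 in fresh memory, so only stack 0
has to be filled. -/
def searchInit : Cmd :=
  .seq (.assign 4 (.bin .add (.bin .add (.var 0) (.read 0 (.var 0))) (.const 1)))
    (.seq (.forLoop 5 (.const 0) (.var 0) (.write 4 (.var 5) (.var 5)))
      (.write 5 (.const 0) (.var 0)))

/-- Maximum cardinality search. -/
def search : Cmd := .seq searchInit searchLoop

/-- The initial contents of memory. -/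
structure IsFresh (s : State) : Prop where
  var : ∀ x, 2 ≤ x → s.var x = 0
  arr : ∀ a, 2 ≤ a → s.arr a = fun _ => 0

theorem run_search {V : ℕ} {s : State} {G : SimpleGraph (Fin n)}
    {adj : Fin n → List (Fin n)} (hadj : IsAdjList G adj) (hin : IsInput adj s)
    (hs : IsFresh s) (hV : 2 * n + s.arr 0 n + 1 ≤ V) :
    Run V (100 * s.arr 0 n + 300 * n + 50) search s
      (fun s' => Numbering G n (s'.arr 3) (s'.arr 6)) := by
  refine Run.seq (12 * n + 20) (100 * s.arr 0 n + 240 * n + 4) ?_ (by omega)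
  have hn := hin.card
  refine Run.seq 8 (12 * n + 12) (Run.assign rfl ?_ ?_ (by simp [Expr.cost])) (by omega)
  · simp [hn]; omega
  simp only [Expr.eval_read, Expr.eval_bin, Expr.eval_var, Expr.eval_const, BinOp.apply_add, hn]
  refine Run.seq (12 * n + 9) 3 ?_ (by omega)
  refine Run.forLoop 0 n 4 (fun i s' => ∀ j < i, s'.arr 4 j = j) rfl rfl rfl (by decide)
    (by omega) ?_ (by simp) ?_ ?_ (by simp [Expr.cost]; omega)
  · intro s' hf
    rw [Expr.eval_var, hf.var 0 (by decide)]
    simp [State.setVar_var, hn]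
  · intro i s' hi hb hf hx hI
    refine Run.write rfl rfl ?_ ?_ (by simp [Expr.cost])
    · exact hb.var_le _
    · intro j hj
      simp only [State.setVar_arr, State.setArr_arr, if_true, Expr.eval_var, hx]
      by_cases hji : j = i
      · subst hji; simp
      · rw [Function.update_of_ne (by omega)]; exact hI j (by omega)
  · intro s' hb hf hx hI
    have h0 : s'.var 0 = n := (hf.var 0 (by decide)).trans (by simp [State.setVar_var, hn])
    have h2 : s'.var 2 = 0 := (hf.var 2 (by decide)).trans
      (by simp [State.setVar_var, hs.var])
    have h3 : s'.var 3 = 0 := (hf.var 3 (by decide)).trans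
      (by simp [State.setVar_var, hs.var])
    have h4 : s'.var 4 = n + s.arr 0 n + 1 := (hf.var 4 (by decide)).trans
      (by simp [State.setVar_var])
    have a0 : s'.arr 0 = s.arr 0 := (hf.arr 0 (by decide)).trans (by simp [State.setVar_arr])
    have a1 : s'.arr 1 = s.arr 1 := (hf.arr 1 (by decide)).trans (by simp [State.setVar_arr])
    have a2 : s'.arr 2 = fun _ => 0 := (hf.arr 2 (by decide)).trans (hs.arr 2 le_rfl)
    have a3 : s'.arr 3 = fun _ => 0 := (hf.arr 3 (by decide)).trans (hs.arr 3 (by omega))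
    have a5 : s'.arr 5 = fun _ => 0 := (hf.arr 5 (by decide)).trans (hs.arr 5 (by omega))
    have hseen0 : ∀ w : Fin n, seen G (fun _ => 0) w = 0 := by intro w; simp [seen]
    have hrest : (restSum (fun _ => 0) fun v : Fin n => (adj v).length) = s.arr 0 n := by
      simp [restSum, hin.total]
    have hrest' : (restSum (fun _ => 0) fun v : Fin n => 100 * (adj v).length + 200) =
        100 * s.arr 0 n + 200 * n := by
      simp [restSum, hin.total, Finset.sum_add_distrib, Finset.mul_sum, mul_comm]
    have hsum := sum_update_range (top := fun _ => 0) (x := n) (show 0 < n + 1 by omega)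
    refine Run.write rfl rfl (hb.var_le _) ?_ (by simp [Expr.cost])
    simp only [Expr.eval_var, Expr.eval_const, h0]
    have hin' : IsInput adj (s'.setArr 5 0 n) := hin.congr
      (by simp [State.setArr_var, h0, hn]) (by simp [State.setArr_arr, a0])
      (by simp [State.setArr_arr, a1])
    refine (run_searchLoop (B := n + s.arr 0 n + 1) (bound := n + s.arr 0 n) hadj hin'
      (by simp [State.setArr_var, h4]) (by omega) ⟨?_, ?_, ?_, ?_⟩).mono ?_ fun _ _ _ h => h
    · simp only [State.setArr_var, State.setArr_arr, h2, a3, Nat.reduceEqDiff,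
        if_false]
      exact ⟨fun _ => le_rfl, fun v h => absurd rfl h, fun i hi => absurd hi (by omega),
        fun b c h => absurd rfl h⟩
    · simp only [State.setArr_arr, a3, a2, a5, Nat.reduceEqDiff, if_false, if_true]
      refine ⟨fun w _ => (hseen0 w).symm, fun w _ => ⟨w, ?_, ?_⟩, fun j hj i hi => ?_, ?_, by omega⟩
      · rw [hseen0]; simp
      · rw [hseen0]; simp [hI w w.2]
      · have hj0 : j = 0 := by
          by_contra hc
          rw [Function.update_of_ne hc] at hi; omega
        subst hj0
        rw [Function.update_self] at hi
        exact ⟨⟨i, hi⟩, by simp [hI i hi], fun _ => Nat.zero_le _⟩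
      · rw [hrest]; simp at hsum ⊢; omega
    · intro w _
      simp only [State.setArr_arr, State.setArr_var, a3, Nat.reduceEqDiff, if_false, hseen0]
      exact Nat.zero_le _
    · simp [State.setArr_var, h2, h3]
    · simp only [searchPot, State.setArr_arr, State.setArr_var, a3, a5, Nat.reduceEqDiff, if_false,
        if_true, hrest', h3]
      simp at hsum ⊢; omega

end Search

end RAM

namespace RAM

open MEG

section Order

variable {n : ℕ}

/-! ### The elimination ordering -/

/-- The n numbers from 1 to n are carried by n distinct vertices, and there are no others. -/
theorem Numbering.ne_zero {G : SimpleGraph (Fin n)} {nu ord : ℕ → ℕ}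
    (h : Numbering G n nu ord) (v : Fin n) : nu v ≠ 0 := by
  choose f hf using h.ex
  have hinj : Function.Injective (fun i : Fin n => f i i.2) := by
    intro a b hab
    have ha := hf a a.2
    have hb := hf b b.2
    simp only at hab
    rw [hab] at ha
    exact Fin.ext (by omega)
  obtain ⟨i, hi⟩ := (Finite.injective_iff_surjective.mp hinj) v
  simp only at hi
  rw [← hi, hf]
  omega

/-- The numbering is stored in memory, together with its inverse. -/
structure IsOrder (num : Fin n → ℕ) (s : State) : Prop where
  nu : ∀ v : Fin n, s.arr 3 v = num v + 1
  ord : ∀ v : Fin n, s.arr 6 (num v) = v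
  ex : ∀ i < n, ∃ v : Fin n, num v = i
  lt : ∀ v, num v < n

theorem IsOrder.congr {num : Fin n → ℕ} {s s' : State} (h : IsOrder num s)
    (h3 : s'.arr 3 = s.arr 3) (h6 : s'.arr 6 = s.arr 6) : IsOrder num s' :=
  ⟨by rw [h3]; exact h.nu, by rw [h6]; exact h.ord, h.ex, h.lt⟩

theorem IsOrder.inj {num : Fin n → ℕ} {s : State} (h : IsOrder num s) :
    Function.Injective num := by
  intro a b hab
  exact Fin.ext (by rw [← h.ord a, ← h.ord b, hab])

theorem Numbering.isOrder {G : SimpleGraph (Fin n)} {s : State}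
    (h : Numbering G n (s.arr 3) (s.arr 6)) :
    IsOrder (fun v : Fin n => s.arr 3 v - 1) s := by
  have hp := h.ne_zero
  refine ⟨fun v => ?_, fun v => h.ord_eq v (hp v), fun i hi => ?_, fun v => ?_⟩
  · have := hp v; omega
  · obtain ⟨v, hv⟩ := h.ex i hi
    exact ⟨v, by omega⟩
  · have := hp v; have := h.le v; omega

theorem Numbering.isMCS {G : SimpleGraph (Fin n)} {nu ord : ℕ → ℕ}
    (h : Numbering G n nu ord) : IsMCS G (fun v : Fin n => nu v - 1) := by
  classical
  have hp := h.ne_zero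
  have hs : ∀ b c : Fin n, seenBefore G nu b c =
      (Finset.univ.filter fun x : Fin n => G.Adj x c ∧ nu x - 1 < nu b - 1).card := by
    intro b c
    unfold seenBefore
    congr 1
    ext x
    have := hp x
    have := hp b
    simp only [Finset.mem_filter, Finset.mem_univ, true_and]
    exact and_congr_right fun _ => by omega
  intro b c hbc
  have hbc' : nu b - 1 < nu c - 1 := hbc
  have := h.mcs b c (hp b) (.inr (by omega))
  rw [hs, hs] at this
  convert this

/-- The number of edges of a graph with small earlier neighbourhoods. -/
theorem sum_length_le {G : SimpleGraph (Fin n)} {adj : Fin n → List (Fin n)}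
    (hadj : IsAdjList G adj) {num : Fin n → ℕ} (hinj : Function.Injective num) {K : ℕ}
    (hK : ∀ v (Q : Finset (Fin n)), (∀ w ∈ Q, w ∈ earlier G num v) → Q.card ≤ K) :
    ∑ v, (adj v).length ≤ 2 * K * n := by
  classical
  have hle : ∀ v, (Finset.univ.filter fun w => G.Adj w v ∧ num w < num v).card ≤ K := fun v =>
    hK v _ fun w hw => by simpa [earlier] using hw
  have hlen : ∀ v, (adj v).length = (Finset.univ.filter fun w => G.Adj w v ∧ num w < num v).card +
      (Finset.univ.filter fun w => G.Adj w v ∧ num v < num w).card := by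
    intro v
    rw [← List.toFinset_card_of_nodup (hadj v).1, ← Finset.card_union_of_disjoint]
    · congr 1
      ext w
      simp only [List.mem_toFinset, (hadj v).2 w, Finset.mem_union, Finset.mem_filter,
        Finset.mem_univ, true_and, ← and_or_left, G.adj_comm v w]
      constructor
      · intro h
        exact ⟨h, lt_or_gt_of_ne fun hc => h.ne (hinj hc)⟩
      · exact fun h => h.1
    · rw [Finset.disjoint_filter]
      rintro w - ⟨-, h1⟩ ⟨-, h2⟩
      omega
  have hswap : ∑ v, (Finset.univ.filter fun w => G.Adj w v ∧ num v < num w).card =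
      ∑ v, (Finset.univ.filter fun w => G.Adj w v ∧ num w < num v).card := by
    simp only [Finset.card_filter]
    rw [Finset.sum_comm]
    simp only [G.adj_comm]
  rw [Finset.sum_congr rfl fun v _ => hlen v, Finset.sum_add_distrib, hswap]
  have : ∑ v : Fin n, (Finset.univ.filter fun w => G.Adj w v ∧ num w < num v).card ≤
      ∑ _v : Fin n, K := Finset.sum_le_sum fun v _ => hle v
  simp only [Finset.sum_const, Finset.card_univ, Fintype.card_fin, smul_eq_mul] at this
  nlinarith

theorem card_earlier_le {G : SimpleGraph (Fin n)} {num : Fin n → ℕ}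
    (hcl : ∀ v, IsCliqueSet G (earlier G num v)) (v : Fin n) (Q : Finset (Fin n))
    (hQ : ∀ w ∈ Q, w ∈ earlier G num v) : Q.card ≤ treewidth G := by
  classical
  have hv : v ∉ Q := fun h => notMem_earlier v (hQ v h)
  have : (insert v Q).card ≤ treewidth G + 1 := card_le_treewidth_add_one fun a ha b hb hab => by
    rw [Finset.mem_insert] at ha hb
    rcases ha with rfl | ha <;> rcases hb with rfl | hb
    · exact absurd rfl hab
    · exact (hQ b hb).1.symm
    · exact (hQ a ha).1
    · exact hcl v a (hQ a ha) b (hQ b hb) hab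
  rw [Finset.card_insert_of_notMem hv] at this
  omega

/-! ### Parents and colours -/

def parentBody : Cmd :=
  .seq (.assign 7 (.read 1 (.var 6)))
    (.cond (.bin .lt (.read 3 (.var 7)) (.read 3 (.var 5)))
      (.seq (.write 7 (.bin .add (.bin .mul (.var 5) (.var 8)) (.read 9 (.var 7))) (.const 1))
        (.cond (.bin .lt (.var 12) (.read 3 (.var 7))) (.assign 12 (.read 3 (.var 7))) .skip))
      .skip)

/-- Collect the colours of the earlier neighbours, and find the last one. -/
def parentScan : Cmd :=
  .forLoop 6 (.read 0 (.var 5)) (.read 0 (.bin .add (.var 5) (.const 1))) parentBody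

/-- The colours in `N` have been collected in row `v` of `KB'`, and `pm` is the largest number of an
element of `N`, counted from `1`. -/
structure Collected (num : Fin n → ℕ) (col KB KB' : ℕ → ℕ) (v : Fin n) (N : Set (Fin n)) (pm : ℕ) :
    Prop where
  other : ∀ u : Fin n, u ≠ v → ∀ c ≤ n, KB' (u * (n + 1) + c) = KB (u * (n + 1) + c)
  bits : ∀ c ≤ n, KB' (v * (n + 1) + c) ≠ 0 ↔ ∃ w ∈ N, col w = c
  le : ∀ w ∈ N, num w + 1 ≤ pm
  ex : pm = 0 ∨ ∃ w ∈ N, num w + 1 = pm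

theorem Collected.insert {num : Fin n → ℕ} {col KB KB' : ℕ → ℕ} {v : Fin n} {N : Set (Fin n)}
    {pm : ℕ} (h : Collected num col KB KB' v N pm) (w : Fin n) (hw : col w ≤ n) :
    Collected num col KB (Function.update KB' (v * (n + 1) + col w) 1) v (insert w N)
      (if pm < num w + 1 then num w + 1 else pm) := by
  refine ⟨fun u hu c hc => ?_, fun c hc => ?_, fun x hx => ?_, ?_⟩
  · rw [Function.update_of_ne, h.other u hu c hc]
    intro hcc
    exact hu (Fin.ext (mul_add_inj (by omega) (by omega) hcc).1)
  · by_cases hcw : c = col w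
    · subst hcw
      rw [Function.update_self]
      exact ⟨fun _ => ⟨w, Set.mem_insert _ _, rfl⟩, fun _ => one_ne_zero⟩
    · rw [Function.update_of_ne, h.bits c hc]
      · constructor
        · rintro ⟨x, hx, hxc⟩; exact ⟨x, Set.mem_insert_of_mem _ hx, hxc⟩
        · rintro ⟨x, rfl | hx, hxc⟩
          · exact absurd hxc.symm hcw
          · exact ⟨x, hx, hxc⟩
      · intro hcc
        exact hcw (mul_add_inj (by omega) (by omega) hcc).2
  · rcases hx with rfl | hx
    · split_ifs <;> omega
    · have := h.le x hx
      split_ifs <;> omega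
  · split_ifs with hlt
    · exact .inr ⟨w, Set.mem_insert _ _, rfl⟩
    · exact h.ex.imp_right fun ⟨x, hx, hxp⟩ => ⟨x, Set.mem_insert_of_mem _ hx, hxp⟩

theorem run_parentScan {V : ℕ} {s : State} {G : SimpleGraph (Fin n)}
    {adj : Fin n → List (Fin n)} (hadj : IsAdjList G adj) (hin : IsInput adj s)
    {num : Fin n → ℕ} (ho : IsOrder num s) (v : Fin n) (hv : s.var 5 = v) (h8 : s.var 8 = n + 1)
    (h12 : s.var 12 = 0) (hfresh : ∀ c ≤ n, s.arr 7 (v * (n + 1) + c) = 0)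
    (hcol : ∀ w ∈ earlier G num v, s.arr 9 w ≤ n) :
    Run V ((adj v).length * 36 + 11) parentScan s (fun s' =>
      Collected num (s.arr 9) (s.arr 7) (s'.arr 7) v (earlier G num v) (s'.var 12)) := by
  refine Run.bdd fun hbd => ?_
  have hV := hbd.two_le
  refine Run.forLoop (s.arr 0 v) (adj v).length 25 (fun j s' =>
      Collected num (s.arr 9) (s.arr 7) (s'.arr 7) v
        {w | w ∈ (adj v).take j ∧ num w < num v} (s'.var 12))
    rfl rfl ?_ (by decide) ?_ ?_ ?_ ?_ ?_ ?_
  · simp [hv]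
  · exact (hin.le v).trans (hbd.arr_le _ _)
  · intro s' hf
    have h0 : s'.arr 0 = s.arr 0 := hf.arr 0 (by decide)
    have h5 : s'.var 5 = s.var 5 := hf.var 5 (by decide)
    simp [h0, h5, hv, hin.succ v]
  · have e12 : (s.setVar 6 (s.arr 0 v)).var 12 = 0 := by simp [State.setVar_var, h12]
    rw [e12]
    exact ⟨fun _ _ _ _ => rfl, fun c hc => by simp [State.setVar_arr, hfresh c hc],
      by simp, .inl rfl⟩
  · intro j s' hj hb hf hx hI
    have a1 : s'.arr 1 = s.arr 1 := hf.arr 1 (by decide)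
    have a3 : s'.arr 3 = s.arr 3 := hf.arr 3 (by decide)
    have a9 : s'.arr 9 = s.arr 9 := hf.arr 9 (by decide)
    have v5 : s'.var 5 = v := (hf.var 5 (by decide)).trans hv
    have v8 : s'.var 8 = n + 1 := (hf.var 8 (by decide)).trans h8
    have hget : s'.arr 1 (s.arr 0 v + j) = (adj v)[j] := by rw [a1]; exact hin.get v j hj
    generalize hw₀ : (adj v)[j] = w at hget
    have hmem : w ∈ adj v := hw₀ ▸ List.getElem_mem hj
    have htake : (adj v).take (j + 1) = (adj v).take j ++ [w] := by
      rw [List.take_add_one, List.getElem?_eq_getElem hj, hw₀]; rfl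
    have hvw : G.Adj v w := ((hadj v).2 w).1 hmem
    have n3w := ho.nu w
    have n3v := ho.nu v
    have hbw := hb.arr_le 3 w
    rw [a3] at hbw
    refine Run.seq 3 22 (Run.assign rfl ?_ ?_ (by simp [Expr.cost])) le_rfl
    · exact hb.arr_le _ _
    simp only [Expr.eval_read, Expr.eval_var, hx, hget]
    refine Run.cond 16 rfl ?_ ?_ (by simp [Expr.cost])
    · intro h
      have hlt : num w < num v := by
        by_contra hc
        simp [State.setVar_var, State.setVar_arr, v5, a3, n3w, n3v, hc] at h
      have hset : {x | x ∈ (adj v).take (j + 1) ∧ num x < num v} =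
          insert w {x | x ∈ (adj v).take j ∧ num x < num v} := by
        ext x
        simp only [htake, List.mem_append, List.mem_singleton, Set.mem_ofPred_eq,
            Set.mem_insert_iff]
        constructor
        · rintro ⟨h | h, h'⟩
          · exact .inr ⟨h, h'⟩
          · exact .inl h
        · rintro (rfl | ⟨h, h'⟩)
          · exact ⟨.inr rfl, hlt⟩
          · exact ⟨.inl h, h'⟩
      have hins := hI.insert w (hcol w ⟨hvw.symm, hlt⟩)
      refine Run.seq 8 8 (Run.write rfl rfl ?_ ?_ (by simp [Expr.cost])) le_rfl
      · simp; omega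
      simp only [Expr.eval_read, Expr.eval_var, Expr.eval_bin, Expr.eval_const, BinOp.apply_add,
        BinOp.apply_mul, State.setVar_var, State.setVar_arr, if_true,
        Nat.reduceEqDiff, if_false, v5, v8, a9]
      refine Run.cond 3 rfl ?_ ?_ (by simp [Expr.cost])
      · intro h'
        have hpm : s'.var 12 < num w + 1 := by
          by_contra hc
          simp [State.setVar_var, State.setVar_arr, State.setArr_arr, State.setArr_var, a3, n3w,
            hc] at h'
        refine Run.assign rfl ?_ ?_ (by simp [Expr.cost])
        · simp [State.setVar_var, State.setVar_arr, State.setArr_arr, State.setArr_var, a3]; omega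
        · rw [if_pos hpm] at hins
          rw [hset]
          simpa [State.setVar_var, State.setVar_arr, State.setArr_arr, State.setArr_var, a3, n3w]
            using hins
      · intro h'
        have hpm : ¬ s'.var 12 < num w + 1 := by
          intro hc
          simp [State.setVar_var, State.setVar_arr, State.setArr_arr, State.setArr_var, a3, n3w,
            hc] at h'
        refine Run.skip ?_ (by omega)
        rw [if_neg hpm] at hins
        rw [hset]
        simpa [State.setVar_var, State.setVar_arr, State.setArr_arr, State.setArr_var, a3, n3w]
            using hins
    · intro h
      have hlt : ¬ num w < num v := by
        intro hc
        simp [State.setVar_var, State.setVar_arr, v5, a3, n3w, n3v, hc] at h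
      have hset : {x | x ∈ (adj v).take (j + 1) ∧ num x < num v} =
          {x | x ∈ (adj v).take j ∧ num x < num v} := by
        ext x
        simp only [htake, List.mem_append, List.mem_singleton, Set.mem_ofPred_eq]
        constructor
        · rintro ⟨h | rfl, h'⟩
          · exact ⟨h, h'⟩
          · exact absurd h' hlt
        · rintro ⟨h, h'⟩
          exact ⟨.inl h, h'⟩
      refine Run.skip ?_ (by omega)
      rw [hset]
      simpa [State.setVar_var, State.setVar_arr] using hI
  · rintro s' hb hf - hI
    rw [List.take_length] at hI
    convert hI using 1
    ext x
    simp [earlier, (hadj v).2, G.adj_comm]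
  · simp [Expr.cost]

/-- Find the least colour that does not occur in row `v`. -/
def colourSearch : Cmd :=
  .seq (.assign 9 (.const 0))
    (.loop (.read 7 (.bin .add (.bin .mul (.var 5) (.var 8)) (.var 9)))
      (.assign 9 (.bin .add (.var 9) (.const 1))))

/-- In `hK`, the clause c ≤ n + 1 keeps the cells under consideration within one row of stride n +
1. -/
theorem run_colourSearch {V K v : ℕ} {s : State} (hv : s.var 5 = v) (h8 : s.var 8 = n + 1)
    (hKn : K ≤ n)
    (hK : ∀ c, (∀ c' < c, s.arr 7 (v * (n + 1) + c') ≠ 0) → c ≤ n + 1 → c ≤ K) (hV : n + 1 ≤ V) :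
    Run V (11 * K + 9) colourSearch s
      (fun s' => s'.var 9 ≤ K ∧ s.arr 7 (v * (n + 1) + s'.var 9) = 0) := by
  refine Run.seq 2 (11 * K + 7) (Run.assign rfl (by simp) ?_ (by simp [Expr.cost])) (by omega)
  refine Run.loop (fun s' => ∀ c' < s'.var 9, s.arr 7 (v * (n + 1) + c') ≠ 0 ∧ s'.var 9 ≤ K)
    (fun s' => 11 * (K - s'.var 9)) rfl ?_ ?_ ?_ ?_
  · simp [State.setVar_var]
  · intro s' hb hf hI he
    have a7 : s'.arr 7 = s.arr 7 := hf.arr 7 (by decide)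
    have v5 : s'.var 5 = v := (hf.var 5 (by decide)).trans (by simp [State.setVar_var, hv])
    have v8 : s'.var 8 = n + 1 := (hf.var 8 (by decide)).trans (by simp [State.setVar_var, h8])
    simp only [Expr.eval_read, Expr.eval_bin, Expr.eval_var, BinOp.apply_add, BinOp.apply_mul, v5,
      v8, a7] at he
    have hle : s'.var 9 ≤ K := by
      rcases Nat.eq_zero_or_pos (s'.var 9) with h | h
      · omega
      · exact (hI 0 h).2
    have hall : ∀ c' < s'.var 9 + 1, s.arr 7 (v * (n + 1) + c') ≠ 0 := by
      intro c' hc'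
      rcases Nat.lt_succ_iff_lt_or_eq.mp hc' with h | rfl
      · exact (hI c' h).1
      · exact he
    have hle' := hK _ hall (by omega)
    refine ⟨4, Run.assign rfl ?_ ?_ (by simp [Expr.cost])⟩
    · simp; omega
    · simp only [State.setVar_var, Expr.eval_bin, Expr.eval_var, Expr.eval_const, BinOp.apply_add,
        if_true, Expr.cost]
      exact ⟨fun c' hc' => ⟨hall c' hc', hle'⟩, by omega⟩
  · intro s' hb hf hI he
    have a7 : s'.arr 7 = s.arr 7 := hf.arr 7 (by decide)
    have v5 : s'.var 5 = v := (hf.var 5 (by decide)).trans (by simp [State.setVar_var, hv])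
    have v8 : s'.var 8 = n + 1 := (hf.var 8 (by decide)).trans (by simp [State.setVar_var, h8])
    simp only [Expr.eval_read, Expr.eval_bin, Expr.eval_var, BinOp.apply_add, BinOp.apply_mul, v5,
      v8, a7] at he
    refine ⟨?_, he⟩
    rcases Nat.eq_zero_or_pos (s'.var 9) with h | h
    · omega
    · exact (hI 0 h).2
  · simp [State.setVar_var, Expr.cost]

/-- The vertices before `i` have been coloured with fewer than `om` colours. -/
structure Coloured (G : SimpleGraph (Fin n)) (num : Fin n → ℕ) (i om : ℕ) (KB PM col : ℕ → ℕ) :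
    Prop where
  fresh : ∀ v : Fin n, i ≤ num v → ∀ c ≤ n, KB (v * (n + 1) + c) = 0
  bits : ∀ v : Fin n, num v < i → ∀ c ≤ n,
    KB (v * (n + 1) + c) ≠ 0 ↔ ∃ w ∈ earlier G num v, col w = c
  le : ∀ v : Fin n, num v < i → ∀ w ∈ earlier G num v, num w + 1 ≤ PM v
  ex : ∀ v : Fin n, num v < i → PM v = 0 ∨ ∃ w ∈ earlier G num v, num w + 1 = PM v
  proper : ∀ v : Fin n, num v < i → ¬ ∃ w ∈ earlier G num v, col w = col v
  lt : ∀ v : Fin n, num v < i → col v < om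

theorem Coloured.step {G : SimpleGraph (Fin n)} {num : Fin n → ℕ} {om om' c pm : ℕ}
    {KB KB' PM col : ℕ → ℕ} {v : Fin n} (h : Coloured G num (num v) om KB PM col)
    (hinj : Function.Injective num)
    (hc : Collected num col KB KB' v (earlier G num v) pm) (hcn : c ≤ n)
    (h0 : KB' (v * (n + 1) + c) = 0) (hom : om ≤ om') (hcom : c < om') :
    Coloured G num (num v + 1) om' KB' (Function.update PM v pm) (Function.update col v c) := by
  have hcol : ∀ u : Fin n, num u ≤ num v → ∀ c', (∃ w ∈ earlier G num u,
      Function.update col v c w = c') ↔ ∃ w ∈ earlier G num u, col w = c' := by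
    intro u hu c'
    refine exists_congr fun w => and_congr_right fun hw => ?_
    rw [update_fin]
    rintro rfl
    have := hw.2; omega
  have hne : ∀ u : Fin n, u ≠ v → num u < num v + 1 → num u < num v := by
    intro u hu hlt
    exact lt_of_le_of_ne (by omega) fun hcc => hu (hinj hcc)
  refine ⟨fun u hu c' hc' => ?_, fun u hu c' hc' => ?_, fun u hu w hw => ?_, fun u hu => ?_,
    fun u hu => ?_, fun u hu => ?_⟩
  · have huv : u ≠ v := by rintro rfl; omega
    rw [hc.other u huv c' hc', h.fresh u (by omega) c' hc']
  · rw [hcol u (by omega)]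
    by_cases huv : u = v
    · subst huv; exact hc.bits c' hc'
    · rw [hc.other u huv c' hc']; exact h.bits u (hne u huv hu) c' hc'
  · by_cases huv : u = v
    · subst huv; rw [Function.update_self]; exact hc.le w hw
    · rw [update_fin huv]; exact h.le u (hne u huv hu) w hw
  · by_cases huv : u = v
    · subst huv; rw [Function.update_self]; exact hc.ex
    · rw [update_fin huv]; exact h.ex u (hne u huv hu)
  · rw [hcol u (by omega)]
    by_cases huv : u = v
    · subst huv; rw [Function.update_self]
      rw [← hc.bits c hcn]
      exact fun hcc => hcc h0
    · rw [update_fin huv]; exact h.proper u (hne u huv hu)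
  · by_cases huv : u = v
    · subst huv; rwa [Function.update_self]
    · rw [update_fin huv]; exact (h.lt u (hne u huv hu)).trans_le hom

def colourBody : Cmd :=
  .seq (.assign 5 (.read 6 (.var 11)))
    (.seq (.assign 12 (.const 0))
      (.seq parentScan
        (.seq (.write 8 (.var 5) (.var 12))
          (.seq colourSearch
            (.seq (.write 9 (.var 5) (.var 9))
              (.cond (.bin .lt (.var 10) (.bin .add (.var 9) (.const 1)))
                (.assign 10 (.bin .add (.var 9) (.const 1))) .skip))))))

theorem run_colourBody {V K om : ℕ} {s : State} {G : SimpleGraph (Fin n)}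
    {adj : Fin n → List (Fin n)} (hadj : IsAdjList G adj) (hin : IsInput adj s)
    {num : Fin n → ℕ} (ho : IsOrder num s) (v : Fin n) (h11 : s.var 11 = num v)
    (h8 : s.var 8 = n + 1) (hom : s.var 10 = om) (hom' : om ≤ K + 1) (hKn : K ≤ n)
    (hK : ∀ v (Q : Finset (Fin n)), (∀ w ∈ Q, w ∈ earlier G num v) → Q.card ≤ K)
    (hV : n + 1 ≤ V)
    (hI : Coloured G num (num v) om (s.arr 7) (s.arr 8) (s.arr 9)) :
    Run V (36 * (adj v).length + 11 * K + 50) colourBody s (fun s' => s'.var 10 ≤ K + 1 ∧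
      om ≤ s'.var 10 ∧
      Coloured G num (num v + 1) (s'.var 10) (s'.arr 7) (s'.arr 8) (s'.arr 9)) := by
  have hv2 := v.2
  refine Run.seq 3 (36 * (adj v).length + 11 * K + 47)
    (Run.assign rfl ?_ ?_ (by simp [Expr.cost])) (by omega)
  · simp [h11, ho.ord]; omega
  simp only [Expr.eval_read, Expr.eval_var, h11, ho.ord]
  refine Run.seq 2 (36 * (adj v).length + 11 * K + 45)
    (Run.assign rfl (by simp) ?_ (by simp [Expr.cost])) (by omega)
  simp only [Expr.eval_const]
  refine Run.seq ((adj v).length * 36 + 11) (11 * K + 34) ?_ (by omega)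
  refine (run_parentScan hadj (s := (s.setVar 5 v).setVar 12 0)
    (hin.congr (by simp [State.setVar_var]) rfl rfl) (ho.congr rfl rfl) v
    (by simp [State.setVar_var]) (by simp [State.setVar_var, h8]) (by simp [State.setVar_var])
    (hI.fresh v le_rfl) ?_).mono le_rfl ?_
  · intro w hw
    have := hI.lt w hw.2
    simp only [State.setVar_arr]
    omega
  intro s1 hb1 hf1 hc1
  simp only [State.setVar_arr] at hc1
  have a8 : s1.arr 8 = s.arr 8 := hf1.arr 8 (by decide)
  have a9 : s1.arr 9 = s.arr 9 := hf1.arr 9 (by decide)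
  have v5 : s1.var 5 = v := (hf1.var 5 (by decide)).trans (by simp [State.setVar_var])
  have v8 : s1.var 8 = n + 1 := (hf1.var 8 (by decide)).trans (by simp [State.setVar_var, h8])
  have v10 : s1.var 10 = om := (hf1.var 10 (by decide)).trans (by simp [State.setVar_var, hom])
  refine Run.seq 3 (11 * K + 31) (Run.write rfl rfl (hb1.var_le _) ?_ (by simp [Expr.cost]))
    (by omega)
  simp only [Expr.eval_var, v5]
  refine Run.seq (11 * K + 9) 22 ?_ (by omega)
  refine (run_colourSearch (n := n) (K := K) (v := v) (by simp [State.setArr_var, v5])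
    (by simp [State.setArr_var, v8]) hKn ?_ hV).mono le_rfl ?_
  · intro c hall hcn
    simp only [State.setArr_arr, Nat.reduceEqDiff, if_false] at hall
    -- Occupied colours are the colours of distinct earlier neighbours, and there are at most K of
    -- these.
    have hall' : ∀ c' : Fin c, ∃ w ∈ earlier G num v, s.arr 9 w = c' := fun c' =>
      (hc1.bits c' (by omega)).1 (hall c' c'.2)
    choose f hf hfc using hall'
    have hinj : Function.Injective f := by
      intro a b hab
      exact Fin.ext (by rw [← hfc a, ← hfc b, hab])
    have := hK v (Finset.univ.image f) (fun w hw => by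
      obtain ⟨a, -, rfl⟩ := Finset.mem_image.mp hw
      exact hf a)
    rwa [Finset.card_image_of_injective _ hinj, Finset.card_univ, Fintype.card_fin] at this
  rintro s2 hb2 hf2 ⟨hcK, hc0⟩
  simp only [State.setArr_arr, Nat.reduceEqDiff, if_false] at hc0
  have b7 : s2.arr 7 = s1.arr 7 := (hf2.arr 7 (by decide)).trans (by simp [State.setArr_arr])
  have b8 : s2.arr 8 = Function.update (s.arr 8) v (s1.var 12) :=
    (hf2.arr 8 (by decide)).trans (by simp [State.setArr_arr, a8])
  have b9 : s2.arr 9 = s.arr 9 := (hf2.arr 9 (by decide)).trans (by simp [State.setArr_arr, a9])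
  have w5 : s2.var 5 = v := (hf2.var 5 (by decide)).trans (by simp [State.setArr_var, v5])
  have w10 : s2.var 10 = om := (hf2.var 10 (by decide)).trans (by simp [State.setArr_var, v10])
  set c := s2.var 9 with hc
  refine Run.seq 3 19 (Run.write rfl rfl (hb2.var_le _) ?_ (by simp [Expr.cost])) (by omega)
  simp only [Expr.eval_var, w5, ← hc]
  refine Run.cond 4 rfl ?_ ?_ (by simp [Expr.cost])
  · intro h
    have hlt : om < c + 1 := by
      by_contra hcon
      simp [State.setArr_var, w10, ← hc, hcon] at h
    refine Run.assign rfl ?_ ?_ (by simp [Expr.cost])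
    · simp [State.setArr_var, ← hc]; omega
    · have := hI.step (om' := c + 1) ho.inj hc1 (show c ≤ n by omega) hc0 (by omega) (by omega)
      simp only [State.setVar_var, State.setVar_arr, State.setArr_var, State.setArr_arr,
        Expr.eval_bin, Expr.eval_var, Expr.eval_const, BinOp.apply_add, if_true, ← hc,
        Nat.reduceEqDiff, if_false, b7, b8, b9]
      exact ⟨by omega, by omega, this⟩
  · intro h
    have hlt : ¬ om < c + 1 := by
      intro hcon
      simp [State.setArr_var, w10, ← hc, hcon] at h
    refine Run.skip ?_ (by omega)
    have := hI.step (om' := om) ho.inj hc1 (show c ≤ n by omega) hc0 (by omega) (by omega)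
    simp only [State.setArr_var, State.setArr_arr, if_true,
        Nat.reduceEqDiff, if_false, b7, b8, b9, w10]
    exact ⟨by omega, by omega, this⟩

/-- Greedy colouring along the numbering. -/
def colour : Cmd :=
  .seq (.assign 8 (.bin .add (.var 0) (.const 1)))
    (.seq (.assign 10 (.const 1)) (.forLoop 11 (.const 0) (.var 0) colourBody))

/-- Array 7 is used as a matrix with n rows of length n + 1. Linear time is possible because it is
zero initially and only cells given by adjacency list entries are written. -/
theorem run_colour {V K : ℕ} {s : State} {G : SimpleGraph (Fin n)}
    {adj : Fin n → List (Fin n)} (hadj : IsAdjList G adj) (hin : IsInput adj s)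
    {num : Fin n → ℕ} (ho : IsOrder num s) (hKn : K ≤ n)
    (hK : ∀ v (Q : Finset (Fin n)), (∀ w ∈ Q, w ∈ earlier G num v) → Q.card ≤ K)
    (hV : n + 1 ≤ V) (h7 : s.arr 7 = fun _ => 0) :
    Run V (36 * s.arr 0 n + n * (11 * K + 58) + 20) colour s (fun s' => s'.var 8 = n + 1 ∧
      1 ≤ s'.var 10 ∧ s'.var 10 ≤ K + 1 ∧
      Coloured G num n (s'.var 10) (s'.arr 7) (s'.arr 8) (s'.arr 9)) := by
  classical
  refine Run.seq 4 (36 * s.arr 0 n + n * (11 * K + 58) + 16)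
    (Run.assign rfl ?_ ?_ (by simp [Expr.cost])) (by omega)
  · simp [hin.card]; omega
  simp only [Expr.eval_bin, Expr.eval_var, Expr.eval_const, BinOp.apply_add, hin.card]
  refine Run.seq 2 (36 * s.arr 0 n + n * (11 * K + 58) + 14)
    (Run.assign rfl (by simp; omega) ?_ (by simp [Expr.cost])) (by omega)
  simp only [Expr.eval_const]
  set s0 := (s.setVar 8 (n + 1)).setVar 10 1 with hs0
  have hin0 : IsInput adj s0 := hin.congr (by simp [hs0, State.setVar_var]) rfl rfl
  have ho0 : IsOrder num s0 := ho.congr rfl rfl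
  refine Run.forLoopSum 0 n
    -- The iteration for number i is charged the degree of the vertex with that number. Exchanging
    -- the two sums turns the total into the length of all lists.
    (fun i => (∑ v, if num v = i then 36 * (adj v).length else 0) + (11 * K + 50))
    (fun i s' => 1 ≤ s'.var 10 ∧ s'.var 10 ≤ K + 1 ∧
      Coloured G num i (s'.var 10) (s'.arr 7) (s'.arr 8) (s'.arr 9)) rfl rfl rfl (by decide)
    (by omega) ?_ ?_ ?_ ?_ ?_
  · intro s' hf
    rw [Expr.eval_var, hf.var 0 (by decide), hin0.card, zero_add]
  · have e10 : (s0.setVar 11 0).var 10 = 1 := by simp [hs0, State.setVar_var]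
    refine ⟨by omega, by omega, ?_⟩
    rw [e10]
    exact ⟨fun v _ c _ => by simp [hs0, State.setVar_arr, h7], fun v h => absurd h (by omega),
      fun v h => absurd h (by omega), fun v h => absurd h (by omega),
      fun v h => absurd h (by omega), fun v h => absurd h (by omega)⟩
  · rintro i s' hi hb hf hx ⟨h1, h2, hI⟩
    obtain ⟨v, rfl⟩ := ho.ex i hi
    have hin' : IsInput adj s' := hin0.congr (hf.var 0 (by decide)) (hf.arr 0 (by decide))
      (hf.arr 1 (by decide))
    have ho' : IsOrder num s' := ho0.congr (hf.arr 3 (by decide)) (hf.arr 6 (by decide))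
    have h8 : s'.var 8 = n + 1 := (hf.var 8 (by decide)).trans (by simp [hs0, State.setVar_var])
    have hsum : (∑ u, if num u = num v then 36 * (adj u).length else 0) = 36 * (adj v).length := by
      rw [Finset.sum_eq_single v]
      · simp
      · intro u _ huv
        rw [if_neg fun hc => huv (ho.inj hc)]
      · simp
    rw [hsum]
    refine (run_colourBody hadj hin' ho' v (by omega) h8 rfl h2 hKn hK hV hI).mono (by omega) ?_
    rintro s'' - - ⟨g1, g2, g3⟩
    simp only [State.setVar_var, State.setVar_arr, Nat.reduceEqDiff, if_false, Nat.zero_add]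
    exact ⟨by omega, g1, g3⟩
  · rintro s' hb hf hx ⟨h1, h2, hI⟩
    exact ⟨(hf.var 8 (by decide)).trans (by simp [hs0, State.setVar_var]), h1, h2, hI⟩
  · have hswap : ∑ i ∈ Finset.range n, (∑ v, if num v = i then 36 * (adj v).length else 0) =
        36 * s.arr 0 n := by
      rw [Finset.sum_comm, hin.total, Finset.mul_sum]
      refine Finset.sum_congr rfl fun v _ => ?_
      rw [Finset.sum_ite_eq, if_pos (Finset.mem_range.mpr (ho.lt v))]
    simp only [Finset.sum_add_distrib, hswap, Finset.sum_const, Finset.card_range, smul_eq_mul,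
      Expr.cost]
    nlinarith

theorem Coloured.exists_elim {G : SimpleGraph (Fin n)} {num : Fin n → ℕ} {om : ℕ}
    {KB PM col : ℕ → ℕ} (h : Coloured G num n om KB PM col) (hlt : ∀ v, num v < n)
    (hinj : Function.Injective num) (hcl : ∀ v, IsCliqueSet G (earlier G num v)) :
    ∃ par : Fin n → Fin n, Elim G num par (fun v => col v) om ∧
      ∀ v, ((earlier G num v).Nonempty → PM v = num (par v) + 1) ∧
        (earlier G num v = ∅ → PM v = 0) := by
  have hex : ∀ v, ∃ p : Fin n, (earlier G num v).Nonempty →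
      p ∈ earlier G num v ∧ num p + 1 = PM v := by
    intro v
    rcases h.ex v (hlt v) with h0 | ⟨p, hp, hpm⟩
    · refine ⟨v, fun ⟨w, hw⟩ => ?_⟩
      have := h.le v (hlt v) w hw
      omega
    · exact ⟨p, fun _ => ⟨hp, hpm⟩⟩
  choose par hpar using hex
  refine ⟨par, ⟨hinj, hcl, fun v hv => (hpar v hv).1, fun v w hw => ?_, fun u v huv => ?_,
    fun v => h.lt v (hlt v)⟩, fun v => ⟨fun hv => (hpar v hv).2.symm, fun hv => ?_⟩⟩
  · have h1 := (hpar v ⟨w, hw⟩).2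
    have h2 := h.le v (hlt v) w hw
    omega
  · rcases lt_trichotomy (num u) (num v) with hc | hc | hc
    · exact fun he => h.proper v (hlt v) ⟨u, ⟨huv, hc⟩, he⟩
    · exact absurd (hinj hc) huv.ne
    · exact fun he => h.proper u (hlt u) ⟨v, ⟨huv.symm, hc⟩, he.symm⟩
  · rcases h.ex v (hlt v) with h0 | ⟨w, hw, -⟩
    · exact h0
    · rw [hv] at hw; exact hw.elim

end Order

end RAM

namespace MEG

open SimpleGraph

/-! ### Tables of partial solutions -/

section Tables

variable {V : Type*} {G : SimpleGraph V} {num : V → ℕ} {par : V → V} {col : V → ℕ} {om : ℕ}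
  {rep : V → V}

/-- The types provided in the state `s`. -/
def stI (s t : ℕ) : Prop := s.testBit t = true

/-- The types promised in the state `s`. -/
def stO (om s t : ℕ) : Prop := s.testBit (2 ^ om + t) = true

/-- The pairs favoured in the state `s`. -/
def stS (om s i j : ℕ) : Prop := s.testBit (2 ^ om + 2 ^ om + (i * om + j)) = true

/-- The number of bits of a state. -/
def stateBits (om : ℕ) : ℕ := 2 ^ om + 2 ^ om + om * om

theorem mul_add_lt_mul_self {i j : ℕ} (hi : i < om) (hj : j < om) : i * om + j < om * om := by
  have : (i + 1) * om ≤ om * om := Nat.mul_le_mul_right _ hi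
  rw [Nat.add_mul] at this
  omega

theorem exists_state (om : ℕ) (I O : ℕ → Prop) (S : ℕ → ℕ → Prop) :
    ∃ s < 2 ^ stateBits om, (∀ t < 2 ^ om, stI s t ↔ I t) ∧ (∀ t < 2 ^ om, stO om s t ↔ O t) ∧
      ∀ i < om, ∀ j < om, stS om s i j ↔ S i j := by
  classical
  obtain ⟨s, hs, h⟩ := exists_testBit (stateBits om) fun b => if b < 2 ^ om then I b else
    if b < 2 ^ om + 2 ^ om then O (b - 2 ^ om) else
      S ((b - (2 ^ om + 2 ^ om)) / om) ((b - (2 ^ om + 2 ^ om)) % om)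
  refine ⟨s, hs, fun t ht => ?_, fun t ht => ?_, fun i hi j hj => ?_⟩
  · rw [stI, h t (by unfold stateBits; omega), if_pos ht]
  · rw [stO, h _ (by unfold stateBits; omega), if_neg (by omega), if_pos (by omega),
      Nat.add_sub_cancel_left]
  · have := mul_add_lt_mul_self hi hj
    have hd : (i * om + j) / om = i := by
      rw [mul_comm, Nat.mul_add_div (by omega), Nat.div_eq_of_lt hj, add_zero]
    have hm : (i * om + j) % om = j := by
      rw [mul_comm, Nat.mul_add_mod, Nat.mod_eq_of_lt hj]
    have hb := h (2 ^ om + 2 ^ om + (i * om + j)) (by unfold stateBits; omega)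
    rw [if_neg (Nat.not_lt.mpr ((Nat.le_add_right _ _).trans (Nat.le_add_right _ _))),
      if_neg (Nat.not_lt.mpr (Nat.le_add_right _ _)), Nat.add_sub_cancel_left, hd, hm] at hb
    exact hb

theorem Spec.mono {p : V} {I O : ℕ → Prop} {S : ℕ → ℕ → Prop} {m m' : ℕ}
    (h : Spec G num col om rep p I O S m) (hm : m ≤ m') : Spec G num col om rep p I O S m' := by
  obtain ⟨M, h1, h2⟩ := h
  exact ⟨M, h1.trans hm, h2⟩

/-- `Joins` reads the predicates only at types below 2 ^ om and colours below om, so they may be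
replaced by their encodings in states. The colour of c has to be in range because the field `own`
reads the pairs at it. -/
theorem Joins.congr {K Bp : ℕ → Prop} {cc : ℕ} {I O I₁ O₁ I₂ O₂ I₁' O₁' I₂' O₂' : ℕ → Prop}
    {S S₁ S₂ S₁' S₂' : ℕ → ℕ → Prop} (hcc : cc < om)
    (hI₁ : ∀ t < 2 ^ om, I₁' t ↔ I₁ t) (hO₁ : ∀ t < 2 ^ om, O₁' t ↔ O₁ t)
    (hS₁ : ∀ i < om, ∀ j < om, S₁' i j ↔ S₁ i j)
    (hI₂ : ∀ t < 2 ^ om, I₂' t ↔ I₂ t) (hO₂ : ∀ t < 2 ^ om, O₂' t ↔ O₂ t)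
    (hS₂ : ∀ i < om, ∀ j < om, S₂' i j ↔ S₂ i j)
    (h : Joins om K Bp cc I O S I₁ O₁ S₁ I₂ O₂ S₂) :
    Joins om K Bp cc I O S I₁' O₁' S₁' I₂' O₂' S₂' := by
  have hup : ∀ t, (∃ t' < 2 ^ om, I₂ t' ∧ Restr om K t' t) →
      ∃ t' < 2 ^ om, I₂' t' ∧ Restr om K t' t := by
    rintro t ⟨t', ht', h1, h2⟩
    exact ⟨t', ht', (hI₂ t' ht').2 h1, h2⟩
  refine ⟨fun t ht hI => (h.inner t ht hI).imp (hI₁ t ht).2 (hup t),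
    fun t ht hO => (h.outer₁ t ht ((hO₁ t ht).1 hO)).imp_right (hup t), fun t ht hO => ?_,
    fun i hi j hj hS => ?_, fun i hi hK => ?_⟩
  · obtain ⟨t', ht', h1, h2⟩ := h.outer₂ t ht ((hO₂ t ht).1 hO)
    exact ⟨t', ht', h1.imp_right (hI₁ t' ht').2, h2⟩
  · refine (h.hits i hi j hj hS).imp (hS₁ i hi j hj).2 (Or.imp ?_ ?_)
    · rintro ⟨a, b, c⟩
      exact ⟨a, b, (hS₂ i hi j hj).2 c⟩
    · rintro ⟨a, b, c, d⟩
      exact ⟨a, b, c, hup _ d⟩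
  · obtain ⟨h1, h2⟩ := h.own i hi hK
    exact ⟨h1.imp (hS₂ i hi cc hcc).2 (hO₂ _ (Nat.pow_lt_pow_right (by omega) hi)).2,
      (hS₂ cc hcc i hi).2 h2⟩

/-- The numbers `tab` are the least sizes of partial solutions in the cluster of `p`, where all
values above `n` are replaced by `n + 1`. -/
def IsTable (G : SimpleGraph V) (num col : V → ℕ) (om : ℕ) (rep : V → V) (n : ℕ) (p : V)
    (tab : ℕ → ℕ) : Prop :=
  ∀ s < 2 ^ stateBits om, tab s ≤ n + 1 ∧ ∀ m ≤ n,
    (tab s ≤ m ↔ Spec G num col om rep p (stI s) (stO om s) (stS om s) m)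

/-- The states `s₁` and `s₂` combine into `s`. -/
def Combine (G : SimpleGraph V) (num : V → ℕ) (par : V → V) (col : V → ℕ) (om : ℕ) (c : V)
    (s s₁ s₂ : ℕ) : Prop :=
  Joins om (cols col (earlier G num c)) (cols col (bag G num (par c))) (col c)
    (stI s) (stO om s) (stS om s) (stI s₁) (stO om s₁) (stS om s₁) (stI s₂) (stO om s₂) (stS om s₂)

/-- `best` is the least sum of entries for combining states. -/
structure IsBest (G : SimpleGraph V) (num : V → ℕ) (par : V → V) (col : V → ℕ) (om n : ℕ) (c : V)
    (tab₁ tab₂ : ℕ → ℕ) (s : ℕ) (P : ℕ → ℕ → Prop) (best : ℕ) : Prop where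
  le : best ≤ n + 1
  min : ∀ s₁ s₂, P s₁ s₂ → Combine G num par col om c s s₁ s₂ → best ≤ tab₁ s₁ + tab₂ s₂
  ex : best = n + 1 ∨ ∃ s₁ s₂, s₁ < 2 ^ stateBits om ∧ s₂ < 2 ^ stateBits om ∧
    Combine G num par col om c s s₁ s₂ ∧ best = tab₁ s₁ + tab₂ s₂

/-- An entry at most n comes from combining two states whose entries are attained, and
`spec_of_joins` applies. Conversely, `exists_joins` yields some predicates, which are encoded as
states and hence among the candidates of the minimum. Entries n + 1 stand for infinity and do no
harm, as only m ≤ n is claimed. -/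
theorem IsTable.merge {n : ℕ} {c : V} (he : Elim G num par col om)
    (hr : Clusters G num (num c + 1) rep) (hc : (earlier G num c).Nonempty) {tab₁ tab₂ tab : ℕ → ℕ}
    (h₁ : IsTable G num col om rep n (par c) tab₁) (h₂ : IsTable G num col om rep n c tab₂)
    (h : ∀ s < 2 ^ stateBits om, IsBest G num par col om n c tab₁ tab₂ s
      (fun s₁ s₂ => s₁ < 2 ^ stateBits om ∧ s₂ < 2 ^ stateBits om) (tab s)) :
    IsTable G num col om (mergeRep rep c (par c)) n (par c) tab := by
  intro s hs
  refine ⟨(h s hs).le, fun m hm => ⟨fun hle => ?_, fun hsp => ?_⟩⟩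
  · rcases (h s hs).ex with h' | ⟨s₁, s₂, hs₁, hs₂, hj, hsum⟩
    · omega
    · have sp₁ := ((h₁ s₁ hs₁).2 (tab₁ s₁) (by omega)).1 le_rfl
      have sp₂ := ((h₂ s₂ hs₂).2 (tab₂ s₂) (by omega)).1 le_rfl
      exact (spec_of_joins he hr hc hj sp₁ sp₂).mono (by omega)
  · obtain ⟨I₁, O₁, I₂, O₂, S₁, S₂, m₁, m₂, hj, hmm, sp₁, sp₂⟩ := exists_joins he hr hc hsp
    obtain ⟨s₁, hs₁, a₁, b₁, c₁⟩ := exists_state om I₁ O₁ S₁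
    obtain ⟨s₂, hs₂, a₂, b₂, c₂⟩ := exists_state om I₂ O₂ S₂
    have t₁ := ((h₁ s₁ hs₁).2 m₁ (by omega)).2 (sp₁.congr (fun _ => Iff.rfl) a₁ b₁ c₁)
    have t₂ := ((h₂ s₂ hs₂).2 m₂ (by omega)).2 (sp₂.congr (fun _ => Iff.rfl) a₂ b₂ c₂)
    have := (h s hs).min s₁ s₂ ⟨hs₁, hs₂⟩ (hj.congr (he.lt c) a₁ b₁ c₁ a₂ b₂ c₂)
    omega

theorem IsTable.congr {n : ℕ} {p : V} {rep' : V → V} {tab tab' : ℕ → ℕ}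
    (h : IsTable G num col om rep n p tab) (hrep : ∀ u, rep' u = p ↔ rep u = p)
    (htab : ∀ s < 2 ^ stateBits om, tab' s = tab s) :
    IsTable G num col om rep' n p tab' := by
  intro s hs
  rw [htab s hs]
  refine ⟨(h s hs).1, fun m hm => ((h s hs).2 m hm).trans ⟨fun hsp => ?_, fun hsp => ?_⟩⟩
  · exact hsp.congr hrep (fun _ _ => Iff.rfl) (fun _ _ => Iff.rfl) fun _ _ _ _ => Iff.rfl
  · exact hsp.congr (fun u => (hrep u).symm) (fun _ _ => Iff.rfl) (fun _ _ => Iff.rfl)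
      fun _ _ _ _ => Iff.rfl

end Tables

end MEG

namespace RAM

open MEG

/-! ### Formulas about states -/

theorem Expr.eval_setVar_of_scoped {d i : ℕ} {s : State} {e : Expr}
    (he : e.scoped (100 + d) = true) : e.eval (s.setVar (100 + d) i) = e.eval s := by
  have hA : Fm.Agree d s (s.setVar (100 + d) i) :=
    ⟨fun x hx _ => by rw [State.setVar_var, if_neg (by omega)], rfl⟩
  exact hA.eval he

namespace Fm

/-- Bit `x` of `a`. -/
def bit (a x : Expr) : Fm := .atom (.bin .mod (.bin .div a (.read 12 x)) (.const 2))

def inI (a : ℕ) (t : Expr) : Fm := bit (.var a) t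

def inO (a : ℕ) (t : Expr) : Fm := bit (.var a) (.bin .add (.var 13) t)

def inS (a : ℕ) (i j : Expr) : Fm :=
  bit (.var a) (.bin .add (.bin .add (.var 13) (.var 13)) (.bin .add (.bin .mul i (.var 10)) j))

/-- The colour `i` occurs among the earlier neighbours of the vertex in variable `18`. -/
def inK (i : Expr) : Fm := .atom (.read 7 (.bin .add (.bin .mul (.var 18) (.var 8)) i))

/-- The colour `i` occurs in the bag of the vertex in variable `19`. -/
def inB (i : Expr) : Fm :=
  .or (.atom (.bin .eq i (.read 9 (.var 19))))
    (.atom (.read 7 (.bin .add (.bin .mul (.var 19) (.var 8)) i)))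

/-- Restriction of types. -/
def restr (d : ℕ) (t' t : Expr) : Fm :=
  .all 10 (.iff (bit t (.var (100 + d))) (.and (inK (.var (100 + d)))
    (.or (bit t' (.var (100 + d)))
      (.all 10 (.not (.and (bit t' (.var (100 + (d + 1)))) (inK (.var (100 + (d + 1))))))))))

/-- The type `t` is provided by the child. -/
def up (d : ℕ) (t : Expr) : Fm :=
  .ex 13 (.and (inI 23 (.var (100 + d))) (restr (d + 1) (.var (100 + d)) t))

def inner : Fm := .all 13 (.imp (inI 21 (.var 100)) (.or (inI 22 (.var 100)) (up 1 (.var 100))))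

def outer₁ : Fm := .all 13 (.imp (inO 22 (.var 100)) (.or (inO 21 (.var 100)) (up 1 (.var 100))))

def outer₂ : Fm :=
  .all 13 (.imp (inO 23 (.var 100)) (.ex 13 (.and (.or (inO 21 (.var 101)) (inI 22 (.var 101)))
    (.and (.ex 10 (.and (bit (.var 101) (.var 102)) (inB (.var 102))))
      (restr 2 (.var 101) (.var 100))))))

def hits : Fm :=
  .all 10 (.all 10 (.imp (inS 21 (.var 100) (.var 101)) (.or (inS 22 (.var 100) (.var 101))
    (.or (.and (inK (.var 100)) (.and (inK (.var 101)) (inS 23 (.var 100) (.var 101))))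
      (.and (inK (.var 100)) (.and (inB (.var 101)) (.and (.not (inK (.var 101)))
        (up 2 (.read 12 (.var 100))))))))))

def own : Fm :=
  .all 10 (.imp (inK (.var 100)) (.and (.or (inS 23 (.var 100) (.read 9 (.var 18)))
    (inO 23 (.read 12 (.var 100)))) (inS 23 (.read 9 (.var 18)) (.var 100))))

/-- The states in variables `22` and `23` combine into the state in variable `21`. -/
def combine : Fm := .and inner (.and outer₁ (.and outer₂ (.and hits own)))

/-- No vertex is needed for the state in variable `21`. -/
def needsNone : Fm :=
  .and (.all 13 (.not (inI 21 (.var 100))))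
    (.all 10 (.all 10 (.not (inS 21 (.var 100) (.var 101)))))

/-- The vertex in variable `18` suffices for the state in variable `21`. -/
def needsOne : Fm :=
  .and (.all 13 (.imp (inI 21 (.var 100))
      (.all 10 (.iff (bit (.var 100) (.var 101))
          (.atom (.bin .eq (.var 101) (.read 9 (.var 18))))))))
    (.all 10 (.all 10 (.imp (inS 21 (.var 100) (.var 101))
      (.and (.atom (.bin .eq (.var 100) (.read 9 (.var 18)))) (inK (.var 101))))))

theorem wf_combine : combine.wf 0 = true := by decide

theorem wf_needsNone : needsNone.wf 0 = true := by decide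

theorem wf_needsOne : needsOne.wf 0 = true := by decide

/-- What the memory has to contain for the formulas. -/
structure Env (om : ℕ) (K Bp : ℕ → Prop) (s : State) : Prop where
  om_eq : s.var 10 = om
  q_eq : s.var 13 = 2 ^ om
  pw : ∀ x ≤ stateBits om, s.arr 12 x = 2 ^ x
  inK : ∀ i < om, s.arr 7 (s.var 18 * s.var 8 + i) ≠ 0 ↔ K i
  inB : ∀ i < om, (i = s.arr 9 (s.var 19) ∨ s.arr 7 (s.var 19 * s.var 8 + i) ≠ 0) ↔ Bp i
  lt : s.arr 9 (s.var 18) < om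

theorem Env.setVar {om : ℕ} {K Bp : ℕ → Prop} {s : State} (h : Env om K Bp s) (d v : ℕ) :
    Env om K Bp (s.setVar (100 + d) v) := by
  have hv : ∀ x < 100, (s.setVar (100 + d) v).var x = s.var x := fun x hx => by
    rw [State.setVar_var, if_neg (by omega)]
  obtain ⟨h1, h2, h3, h4, h5, h6⟩ := h
  refine ⟨?_, ?_, h3, ?_, ?_, ?_⟩
  · rw [hv _ (by omega), h1]
  · rw [hv _ (by omega), h2]
  · rw [hv _ (by omega), hv _ (by omega)]; exact h4
  · rw [hv _ (by omega), hv _ (by omega)]; exact h5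
  · rw [hv _ (by omega)]; exact h6

section

variable {om : ℕ} {K Bp : ℕ → Prop} {s : State} {d : ℕ}

theorem holds_bit (h : Env om K Bp s) {a x : Expr} (hx : x.eval s ≤ stateBits om) :
    (bit a x).Holds d s ↔ (a.eval s).testBit (x.eval s) = true := by
  simp only [bit, Holds, Expr.eval_bin, Expr.eval_read, Expr.eval_const, BinOp.apply_mod,
    BinOp.apply_div, h.pw _ hx, Nat.testBit_eq_decide_div_mod_eq, decide_eq_true_eq]
  omega

theorem holds_inI (h : Env om K Bp s) {a : ℕ} {t : Expr} (ht : t.eval s < 2 ^ om) :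
    (inI a t).Holds d s ↔ stI (s.var a) (t.eval s) :=
  holds_bit h (by unfold stateBits; omega)

theorem holds_inO (h : Env om K Bp s) {a : ℕ} {t : Expr} (ht : t.eval s < 2 ^ om) :
    (inO a t).Holds d s ↔ stO om (s.var a) (t.eval s) := by
  rw [inO, holds_bit h]
  · simp [stO, h.q_eq]
  · simp only [Expr.eval_bin, Expr.eval_var, BinOp.apply_add, h.q_eq]
    unfold stateBits; omega

theorem holds_inS (h : Env om K Bp s) {a : ℕ}
    {i j : Expr} (hi : i.eval s < om) (hj : j.eval s < om) :
    (inS a i j).Holds d s ↔ stS om (s.var a) (i.eval s) (j.eval s) := by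
  rw [inS, holds_bit h]
  · simp [stS, h.q_eq, h.om_eq]
  · simp only [Expr.eval_bin, Expr.eval_var, BinOp.apply_add, BinOp.apply_mul, h.q_eq, h.om_eq]
    have := mul_add_lt_mul_self hi hj
    unfold stateBits; omega

theorem holds_inK (h : Env om K Bp s)
    {i : Expr} (hi : i.eval s < om) : (Fm.inK i).Holds d s ↔ K (i.eval s) := by
  simpa [Fm.inK, Holds] using h.inK _ hi

theorem holds_inB (h : Env om K Bp s)
    {i : Expr} (hi : i.eval s < om) : (Fm.inB i).Holds d s ↔ Bp (i.eval s) := by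
  simpa [Fm.inB, Holds, holds_or] using h.inB _ hi

theorem holds_all_om (h : Env om K Bp s) {φ : Fm} :
    (Fm.all 10 φ).Holds d s ↔ ∀ i < om, φ.Holds (d + 1) (s.setVar (100 + d) i) := by
  simp only [Holds, h.om_eq]

theorem holds_all_q (h : Env om K Bp s) {φ : Fm} :
    (Fm.all 13 φ).Holds d s ↔ ∀ i < 2 ^ om, φ.Holds (d + 1) (s.setVar (100 + d) i) := by
  simp only [Holds, h.q_eq]

theorem holds_ex_om (h : Env om K Bp s) {φ : Fm} :
    (Fm.ex 10 φ).Holds d s ↔ ∃ i < om, φ.Holds (d + 1) (s.setVar (100 + d) i) := by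
  rw [holds_ex, h.om_eq]

theorem holds_ex_q (h : Env om K Bp s) {φ : Fm} :
    (Fm.ex 13 φ).Holds d s ↔ ∃ i < 2 ^ om, φ.Holds (d + 1) (s.setVar (100 + d) i) := by
  rw [holds_ex, h.q_eq]

theorem holds_restr (h : Env om K Bp s) {t' t : Expr} (ht' : t'.scoped (100 + d) = true)
    (ht : t.scoped (100 + d) = true) :
    (restr d t' t).Holds d s ↔ Restr om K (t'.eval s) (t.eval s) := by
  have hbits : ∀ i < om, i ≤ stateBits om := fun i hi => by
    have := Nat.lt_two_pow_self (n := om)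
    unfold stateBits; omega
  have hmono : ∀ e : Expr, e.scoped (100 + d) = true → e.scoped (100 + (d + 1)) = true := by
    intro e he
    induction e with
    | const c => rfl
    | var x =>
      simp only [Expr.scoped, Bool.and_eq_true, decide_eq_true_eq] at he ⊢
      omega
    | read a i ih => exact ih he
    | bin o a b iha ihb =>
      simp only [Expr.scoped, Bool.and_eq_true] at he ⊢
      exact ⟨iha he.1, ihb he.2⟩
  rw [restr, holds_all_om h]
  refine forall₂_congr fun i hi => ?_
  have h1 := h.setVar d i
  have e1 : (Expr.var (100 + d)).eval (s.setVar (100 + d) i) = i := by simp [State.setVar_var]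
  rw [holds_iff, holds_bit h1 (by rw [e1]; exact hbits i hi), Holds, holds_inK h1 (by rwa [e1]),
    holds_or, holds_bit h1 (by rw [e1]; exact hbits i hi), e1, Expr.eval_setVar_of_scoped ht,
    Expr.eval_setVar_of_scoped ht', holds_all_om h1]
  refine iff_congr Iff.rfl (and_congr_right fun _ => or_congr_right (forall₂_congr fun j hj => ?_))
  have h2 := h1.setVar (d + 1) j
  have e2 : (Expr.var (100 + (d + 1))).eval ((s.setVar (100 + d) i).setVar (100 + (d + 1)) j)
      = j := by
    simp [State.setVar_var]
  rw [Holds, Holds, holds_bit h2 (by rw [e2]; exact hbits j hj), holds_inK h2 (by rwa [e2]), e2,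
    Expr.eval_setVar_of_scoped (hmono _ ht'), Expr.eval_setVar_of_scoped ht']

theorem holds_up (h : Env om K Bp s) {t : Expr} (ht : t.scoped (100 + d) = true)
    (ht1 : t.scoped (100 + (d + 1)) = true) :
    (up d t).Holds d s ↔ ∃ t' < 2 ^ om, stI (s.var 23) t' ∧ Restr om K t' (t.eval s) := by
  rw [up, holds_ex_q h]
  refine exists_congr fun t' => and_congr_right fun ht' => ?_
  have h1 := h.setVar d t'
  have e1 : (Expr.var (100 + d)).eval (s.setVar (100 + d) t') = t' := by simp [State.setVar_var]
  rw [Holds, holds_inI h1 (by rwa [e1]), holds_restr h1 (by simp [Expr.scoped]; omega) ht1, e1,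
    Expr.eval_setVar_of_scoped ht]
  simp only [State.setVar_var]
  rw [if_neg (by omega)]

end

theorem holds_combine {om : ℕ} {K Bp : ℕ → Prop} {s : State} (h : Env om K Bp s) :
    combine.Holds 0 s ↔ Joins om K Bp (s.arr 9 (s.var 18))
      (stI (s.var 21)) (stO om (s.var 21)) (stS om (s.var 21))
      (stI (s.var 22)) (stO om (s.var 22)) (stS om (s.var 22))
      (stI (s.var 23)) (stO om (s.var 23)) (stS om (s.var 23)) := by
  have hin : inner.Holds 0 s ↔ ∀ t < 2 ^ om, stI (s.var 21) t → stI (s.var 22) t ∨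
      ∃ t' < 2 ^ om, stI (s.var 23) t' ∧ Restr om K t' t := by
    rw [inner, holds_all_q h]
    refine forall₂_congr fun t ht => ?_
    have h1 := h.setVar 0 t
    have e1 : (Expr.var 100).eval (s.setVar (100 + 0) t) = t := by simp [State.setVar_var]
    rw [holds_imp, holds_or, holds_inI h1 (by rwa [e1]), holds_inI h1 (by rwa [e1]),
      holds_up h1 rfl rfl, e1]
    simp [State.setVar_var]
  have ho₁ : outer₁.Holds 0 s ↔ ∀ t < 2 ^ om, stO om (s.var 22) t → stO om (s.var 21) t ∨
      ∃ t' < 2 ^ om, stI (s.var 23) t' ∧ Restr om K t' t := by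
    rw [outer₁, holds_all_q h]
    refine forall₂_congr fun t ht => ?_
    have h1 := h.setVar 0 t
    have e1 : (Expr.var 100).eval (s.setVar (100 + 0) t) = t := by simp [State.setVar_var]
    rw [holds_imp, holds_or, holds_inO h1 (by rwa [e1]), holds_inO h1 (by rwa [e1]),
      holds_up h1 rfl rfl, e1]
    simp [State.setVar_var]
  have hom : ∀ i < om, i ≤ stateBits om := fun i hi => by
    have := Nat.lt_two_pow_self (n := om)
    unfold stateBits; omega
  have ho₂ : outer₂.Holds 0 s ↔ ∀ t < 2 ^ om, stO om (s.var 23) t → ∃ t' < 2 ^ om,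
      (stO om (s.var 21) t' ∨ stI (s.var 22) t') ∧
      (∃ i < om, t'.testBit i = true ∧ Bp i) ∧ Restr om K t' t := by
    rw [outer₂, holds_all_q h]
    refine forall₂_congr fun t ht => ?_
    have h1 := h.setVar 0 t
    have e1 : (Expr.var 100).eval (s.setVar (100 + 0) t) = t := by simp [State.setVar_var]
    rw [holds_imp, holds_inO h1 (by rwa [e1]), e1, holds_ex_q h1]
    refine imp_congr (by simp [State.setVar_var]) (exists_congr fun t' => and_congr_right
      fun ht' => ?_)
    have h2 := h1.setVar (0 + 1) t'
    have e2 : (Expr.var 101).eval ((s.setVar (100 + 0) t).setVar (100 + (0 + 1)) t') = t' := by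
      simp [State.setVar_var]
    have e2' : (Expr.var 100).eval ((s.setVar (100 + 0) t).setVar (100 + (0 + 1)) t') = t := by
      simp [State.setVar_var]
    rw [Holds, Holds, holds_or, holds_inO h2 (by rwa [e2]), holds_inI h2 (by rwa [e2]),
      holds_restr h2 rfl rfl, e2, e2', holds_ex_om h2]
    refine and_congr (by simp [State.setVar_var]) (and_congr_left fun _ => exists_congr fun i =>
      and_congr_right fun hi => ?_)
    have h3 := h2.setVar (0 + 1 + 1) i
    rw [Holds, holds_bit h3 (by simpa [State.setVar_var] using hom i hi),
      holds_inB h3 (by simpa [State.setVar_var] using hi)]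
    simp [State.setVar_var]
  have hpow : ∀ i < om, 2 ^ i < 2 ^ om := fun i hi => Nat.pow_lt_pow_right (by omega) hi
  have hh : hits.Holds 0 s ↔ ∀ i < om, ∀ j < om, stS om (s.var 21) i j →
      stS om (s.var 22) i j ∨ (K i ∧ K j ∧ stS om (s.var 23) i j) ∨
      (K i ∧ Bp j ∧ ¬ K j ∧ ∃ t' < 2 ^ om, stI (s.var 23) t' ∧ Restr om K t' (2 ^ i)) := by
    rw [hits, holds_all_om h]
    refine forall₂_congr fun i hi => ?_
    have h1 := h.setVar 0 i
    rw [holds_all_om h1]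
    refine forall₂_congr fun j hj => ?_
    have h2 := h1.setVar (0 + 1) j
    have e1 : (Expr.var 101).eval ((s.setVar (100 + 0) i).setVar (100 + (0 + 1)) j) = j := by
      simp [State.setVar_var]
    have e2 : (Expr.var 100).eval ((s.setVar (100 + 0) i).setVar (100 + (0 + 1)) j) = i := by
      simp [State.setVar_var]
    have e3 : (Expr.read 12 (.var 100)).eval ((s.setVar (100 + 0) i).setVar (100 + (0 + 1)) j) =
        2 ^ i := by
      rw [Expr.eval_read, e2, h2.pw i (hom i hi)]
    rw [holds_imp, holds_or, holds_or, Holds, Holds, Holds, Holds, Holds, Holds,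
      holds_inS h2 (by rwa [e2]) (by rwa [e1]), holds_inS h2 (by rwa [e2]) (by rwa [e1]),
      holds_inS h2 (by rwa [e2]) (by rwa [e1]), holds_inK h2 (by rwa [e2]),
      holds_inK h2 (by rwa [e1]), holds_inB h2 (by rwa [e1]), holds_up h2 rfl rfl, e1, e2, e3]
    simp [State.setVar_var]
  have hown : own.Holds 0 s ↔ ∀ i < om, K i → (stS om (s.var 23) i (s.arr 9 (s.var 18)) ∨
      stO om (s.var 23) (2 ^ i)) ∧ stS om (s.var 23) (s.arr 9 (s.var 18)) i := by
    rw [own, holds_all_om h]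
    refine forall₂_congr fun i hi => ?_
    have h1 := h.setVar 0 i
    have e1 : (Expr.var 100).eval (s.setVar (100 + 0) i) = i := by simp [State.setVar_var]
    have e3 : (Expr.read 12 (.var 100)).eval (s.setVar (100 + 0) i) = 2 ^ i := by
      rw [Expr.eval_read, e1, h1.pw i (hom i hi)]
    have e4 : (Expr.read 9 (.var 18)).eval (s.setVar (100 + 0) i) = s.arr 9 (s.var 18) := by
      simp [State.setVar_var, State.setVar_arr]
    rw [holds_imp, Holds, holds_or, holds_inK h1 (by rwa [e1]),
      holds_inS h1 (by rwa [e1]) (by rw [e4]; exact h.lt),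
      holds_inS h1 (by rw [e4]; exact h.lt) (by rwa [e1]),
      holds_inO h1 (by rw [e3]; exact hpow i hi), e1, e3, e4]
    simp [State.setVar_var]
  rw [combine, Holds, Holds, Holds, Holds, hin, ho₁, ho₂, hh, hown]
  exact ⟨fun ⟨a, b, c, d, e⟩ => ⟨a, b, c, d, e⟩, fun ⟨a, b, c, d, e⟩ => ⟨a, b, c, d, e⟩⟩

theorem holds_needsNone {om : ℕ} {K Bp : ℕ → Prop} {s : State} (h : Env om K Bp s) :
    needsNone.Holds 0 s ↔ (∀ t < 2 ^ om, ¬ stI (s.var 21) t) ∧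
      ∀ i < om, ∀ j < om, ¬ stS om (s.var 21) i j := by
  rw [needsNone, Holds, holds_all_q h, holds_all_om h]
  refine and_congr (forall₂_congr fun t ht => ?_) (forall₂_congr fun i hi => ?_)
  · have h1 := h.setVar 0 t
    rw [Holds, holds_inI h1 (by simpa [State.setVar_var] using ht)]
    simp [State.setVar_var]
  · have h1 := h.setVar 0 i
    rw [holds_all_om h1]
    refine forall₂_congr fun j hj => ?_
    have h2 := h1.setVar (0 + 1) j
    rw [Holds, holds_inS h2 (by simpa [State.setVar_var] using hi)
      (by simpa [State.setVar_var] using hj)]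
    simp [State.setVar_var]

theorem holds_needsOne {om : ℕ} {K Bp : ℕ → Prop} {s : State} (h : Env om K Bp s) :
    needsOne.Holds 0 s ↔
      (∀ t < 2 ^ om, stI (s.var 21) t → ∀ i < om,
        t.testBit i = true ↔ i = s.arr 9 (s.var 18)) ∧
      ∀ i < om, ∀ j < om, stS om (s.var 21) i j → i = s.arr 9 (s.var 18) ∧ K j := by
  rw [needsOne, Holds, holds_all_q h, holds_all_om h]
  refine and_congr (forall₂_congr fun t ht => ?_) (forall₂_congr fun i hi => ?_)
  · have h1 := h.setVar 0 t
    rw [holds_imp, holds_inI h1 (by simpa [State.setVar_var] using ht), holds_all_om h1]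
    refine imp_congr (by simp [State.setVar_var]) (forall₂_congr fun i hi => ?_)
    have h2 := h1.setVar (0 + 1) i
    rw [holds_iff, holds_bit h2]
    · simp [State.setVar_var, State.setVar_arr, Holds]
    · have := Nat.lt_two_pow_self (n := om)
      simp [State.setVar_var]
      unfold stateBits; omega
  · have h1 := h.setVar 0 i
    rw [holds_all_om h1]
    refine forall₂_congr fun j hj => ?_
    have h2 := h1.setVar (0 + 1) j
    rw [holds_imp, Holds, holds_inS h2 (by simpa [State.setVar_var] using hi)
      (by simpa [State.setVar_var] using hj), holds_inK h2 (by simpa [State.setVar_var] using hj)]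
    simp [State.setVar_var, State.setVar_arr, Holds]

/-! ### Running times of formulas -/

/-- With `rank`, the depth of nested quantifiers, the running time is at most weight · (B + 1) ^
rank. The summand 22 covers the overhead 12 of a loop and 10 of each iteration. -/
def weight : Fm → ℕ
  | .atom _ => 55
  | .not φ => φ.weight + 4
  | .and φ ψ => φ.weight + ψ.weight + 3
  | .all _ φ => φ.weight + 22

def rank : Fm → ℕ
  | .atom _ => 0
  | .not φ => φ.rank
  | .and φ ψ => max φ.rank ψ.rank
  | .all _ φ => φ.rank + 1

theorem time_le (B : ℕ) (φ : Fm) : ∀ r, φ.rank ≤ r → φ.time B ≤ φ.weight * (B + 1) ^ r := by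
  have hp : ∀ r, 1 ≤ (B + 1) ^ r := fun r => Nat.one_le_pow _ _ (by omega)
  induction φ with
  | atom e => intro r _; simp only [time, weight]; nlinarith [hp r]
  | not φ ih => intro r hr; simp only [time, weight]; nlinarith [hp r, ih r hr]
  | and φ ψ ih1 ih2 =>
    intro r hr
    simp only [rank, max_le_iff] at hr
    simp only [time, weight]
    nlinarith [hp r, ih1 r hr.1, ih2 r hr.2]
  | all b φ ih =>
    intro r hr
    simp only [rank] at hr
    obtain ⟨r, rfl⟩ : ∃ k, r = k + 1 := ⟨r - 1, by omega⟩
    have h1 := ih r (by omega)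
    have h2 := hp r
    simp only [time, weight]
    calc 12 + B * (φ.time B + 10) ≤ 12 * (B + 1) ^ r + B * (φ.weight * (B + 1) ^ r +
        10 * (B + 1) ^ r) := by
          refine Nat.add_le_add (by omega) (Nat.mul_le_mul_left _ (by omega))
      _ ≤ (φ.weight + 22) * (B + 1) ^ (r + 1) := by rw [pow_succ]; nlinarith

end Fm

end RAM

namespace RAM

open MEG

/-! ### The dynamic program -/

namespace Fm

/-- All quantifiers are bounded by the variables `10` and `13`. -/
def std : Fm → Bool
  | .atom _ => true
  | .not φ => φ.std
  | .and φ ψ => φ.std && ψ.std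
  | .all b φ => (b == 10 || b == 13) && φ.std

theorem bd_of_std {φ : Fm} (h : φ.std = true) {B : ℕ} {s : State} (h10 : s.var 10 ≤ B)
    (h13 : s.var 13 ≤ B) : φ.Bd B s := by
  induction φ with
  | atom e => trivial
  | not φ ih => exact ih h
  | and φ ψ ih1 ih2 =>
    simp only [std, Bool.and_eq_true] at h
    exact ⟨ih1 h.1, ih2 h.2⟩
  | all b φ ih =>
    simp only [std, Bool.and_eq_true, Bool.or_eq_true, beq_iff_eq] at h
    refine ⟨?_, ih h.2⟩
    rcases h.1 with rfl | rfl
    · exact h10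
    · exact h13

theorem Env.run_compile {V om : ℕ} {K Bp : ℕ → Prop} {s : State} (h : Env om K Bp s) {φ : Fm}
    (hw : φ.wf 0 = true) (hs : φ.std = true) :
    Run V (φ.time (2 ^ om)) (φ.compile 0) s (fun s' => (∀ x < 99, s'.var x = s.var x) ∧
      s'.arr = s.arr ∧ (s'.var 99 ≠ 0 ↔ φ.Holds 0 s)) := by
  classical
  refine (Fm.run_compile hw (bd_of_std hs ?_ h.q_eq.le)).mono le_rfl ?_
  · rw [h.om_eq]; exact Nat.lt_two_pow_self.le
  · rintro s' - - ⟨hA, hv⟩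
    refine ⟨fun x hx => hA.1 x (by omega) (by omega), hA.2, ?_⟩
    rw [hv]
    split_ifs with hh <;> simp [hh]

theorem Env.congr {om : ℕ} {K Bp : ℕ → Prop} {s s' : State} (h : Env om K Bp s)
    (h8 : s'.var 8 = s.var 8) (h10 : s'.var 10 = s.var 10) (h13 : s'.var 13 = s.var 13)
    (h18 : s'.var 18 = s.var 18) (h19 : s'.var 19 = s.var 19)
    (a7 : s'.arr 7 = s.arr 7) (a9 : s'.arr 9 = s.arr 9) (a12 : s'.arr 12 = s.arr 12) :
    Env om K Bp s' := by
  obtain ⟨b1, b2, b3, b4, b5, b6⟩ := h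
  refine ⟨h10.trans b1, h13.trans b2, ?_, ?_, ?_, ?_⟩
  · rw [a12]; exact b3
  · rw [a7, h18, h8]; exact b4
  · rw [a7, a9, h19, h8]; exact b5
  · rw [a9, h18]; exact b6

end Fm

section Dynamic

variable {n : ℕ}

/-- What the dynamic program uses. -/
structure Ready (G : SimpleGraph (Fin n)) (num : Fin n → ℕ) (par : Fin n → Fin n)
    (col : Fin n → ℕ) (om : ℕ) (s : State) : Prop where
  card : s.var 0 = n
  stride : s.var 8 = n + 1
  om_eq : s.var 10 = om
  q_eq : s.var 13 = 2 ^ om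
  states : s.var 15 = 2 ^ stateBits om
  pw : ∀ x ≤ stateBits om, s.arr 12 x = 2 ^ x
  col_eq : ∀ v : Fin n, s.arr 9 v = col v
  bits : ∀ (v : Fin n), ∀ c ≤ n, s.arr 7 (v * (n + 1) + c) ≠ 0 ↔ cols col (earlier G num v) c
  ord : ∀ v : Fin n, s.arr 6 (num v) = v
  child : ∀ v, (earlier G num v).Nonempty → s.arr 8 v = num (par v) + 1
  root : ∀ v, earlier G num v = ∅ → s.arr 8 v = 0

variable {G : SimpleGraph (Fin n)} {num : Fin n → ℕ} {par : Fin n → Fin n} {col : Fin n → ℕ}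
  {om : ℕ} {s : State}

theorem Ready.congr {s' : State} (h : Ready G num par col om s) (h0 : s'.var 0 = s.var 0)
    (h8 : s'.var 8 = s.var 8) (h10 : s'.var 10 = s.var 10) (h13 : s'.var 13 = s.var 13)
    (h15 : s'.var 15 = s.var 15) (a6 : s'.arr 6 = s.arr 6) (a7 : s'.arr 7 = s.arr 7)
    (a8 : s'.arr 8 = s.arr 8) (a9 : s'.arr 9 = s.arr 9) (a12 : s'.arr 12 = s.arr 12) :
    Ready G num par col om s' := by
  obtain ⟨b1, b2, b3, b4, b5, b6, b7, b8, b9, b10, b11⟩ := h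
  exact ⟨h0.trans b1, h8.trans b2, h10.trans b3, h13.trans b4, h15.trans b5, by rwa [a12],
    by rwa [a9], by rwa [a7], by rwa [a6], by rwa [a8], by rwa [a8]⟩

/-- For single vertices no parent has been selected. The formulas used there do not mention the bag
of a parent, so its predicate may be whatever memory contains. -/
theorem Ready.env_one (h : Ready G num par col om s) (he : Elim G num par col om) {v : Fin n}
    (hv : s.var 18 = v) (hom : om ≤ n + 1) :
    Fm.Env om (cols col (earlier G num v))
      (fun i => i = s.arr 9 (s.var 19) ∨ s.arr 7 (s.var 19 * s.var 8 + i) ≠ 0) s := by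
  refine ⟨h.om_eq, h.q_eq, h.pw, fun i hi => ?_, fun _ _ => Iff.rfl, ?_⟩
  · rw [hv, h.stride]; exact h.bits v i (by omega)
  · rw [hv, h.col_eq]; exact he.lt v

theorem Ready.env (h : Ready G num par col om s) (he : Elim G num par col om) {v p : Fin n}
    (hv : s.var 18 = v) (hp : s.var 19 = p) (hom : om ≤ n + 1) :
    Fm.Env om (cols col (earlier G num v)) (cols col (bag G num p)) s := by
  obtain ⟨b1, b2, b3, b4, -, b6⟩ := h.env_one he hv hom
  refine ⟨b1, b2, b3, b4, fun i hi => ?_, b6⟩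
  rw [hp, h.stride, h.bits p i (by omega), h.col_eq]
  constructor
  · rintro (rfl | ⟨w, hw, rfl⟩)
    · exact ⟨p, mem_bag p, rfl⟩
    · exact ⟨w, earlier_subset_bag p hw, rfl⟩
  · rintro ⟨w, rfl | hw, rfl⟩
    · exact .inl rfl
    · exact .inr ⟨w, hw, rfl⟩

/-- There is no exponentiation and programs use constants up to 2 only, so powers of two come from
repeated doubling. Dividing by them gives access to the bits of states and types. -/
def powers : Cmd :=
  .seq (.assign 13 (.const 1))
    (.seq (.forLoop 11 (.const 0) (.var 10) (.assign 13 (.bin .add (.var 13) (.var 13))))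
      (.seq (.assign 14 (.bin .add (.bin .add (.var 13) (.var 13))
          (.bin .mul (.var 10) (.var 10))))
        (.seq (.write 12 (.const 0) (.const 1))
          (.seq (.forLoop 11 (.const 0) (.var 14)
              (.write 12 (.bin .add (.var 11) (.const 1))
                (.bin .add (.read 12 (.var 11)) (.read 12 (.var 11)))))
            (.assign 15 (.read 12 (.var 14)))))))

theorem run_powers {V om : ℕ} {s : State} (hom : s.var 10 = om) (hV : 2 ^ stateBits om ≤ V) :
    Run V (50 * 2 ^ stateBits om + 50) powers s (fun s' => s'.var 13 = 2 ^ om ∧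
      s'.var 15 = 2 ^ stateBits om ∧ ∀ x ≤ stateBits om, s'.arr 12 x = 2 ^ x) := by
  have hlt := Nat.lt_two_pow_self (n := stateBits om)
  have hlt' := Nat.lt_two_pow_self (n := om)
  have hN : 2 ^ om + 2 ^ om ≤ stateBits om := by unfold stateBits; omega
  have h1 : 1 ≤ 2 ^ om := Nat.one_le_two_pow
  refine Run.seq 2 (50 * 2 ^ stateBits om + 48)
    (Run.assign rfl (by simp; omega) ?_ (by simp [Expr.cost])) (by omega)
  refine Run.seq (om * 12 + 6) (38 * 2 ^ stateBits om + 42) ?_ (by omega)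
  refine Run.forLoop 0 om 4 (fun i s' => s'.var 13 = 2 ^ i) rfl rfl rfl (by decide) (by omega)
    ?_ ?_ ?_ ?_ (by simp [Expr.cost])
  · intro s' hf
    rw [Expr.eval_var, hf.var 10 (by decide)]
    simp [State.setVar_var, hom]
  · simp [State.setVar_var]
  · intro i s' hi hb hf hx hI
    have hpow : 2 ^ (i + 1) ≤ 2 ^ om := Nat.pow_le_pow_right (by omega) hi
    rw [pow_succ] at hpow
    refine Run.assign rfl ?_ ?_ (by simp [Expr.cost])
    · simp [hI]; omega
    · simp [State.setVar_var, hI, pow_succ]; omega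
  intro s1 hb1 hf1 hx1 h13
  have v10 : s1.var 10 = om := (hf1.var 10 (by decide)).trans (by simp [State.setVar_var, hom])
  refine Run.seq 8 (38 * 2 ^ stateBits om + 34)
    (Run.assign rfl ?_ ?_ (by simp [Expr.cost])) (by omega)
  · simp only [Expr.eval_bin, Expr.eval_var, BinOp.apply_add, BinOp.apply_mul, h13, v10]
    exact hlt.le.trans hV
  have e14 : (Expr.bin .add (.bin .add (.var 13) (.var 13)) (.bin .mul (.var 10) (.var 10))).eval
      s1 = stateBits om := by
    simp [h13, v10, stateBits]
  rw [e14]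
  refine Run.seq 3 (38 * 2 ^ stateBits om + 31)
    (Run.write rfl rfl (by simp; omega) ?_ (by simp [Expr.cost])) (by omega)
  refine Run.seq (stateBits om * 20 + 10) 3 ?_ (by omega)
  refine Run.forLoop 0 (stateBits om) 12 (fun i s' => ∀ x ≤ i, s'.arr 12 x = 2 ^ x) rfl rfl rfl
    (by decide) (by omega) ?_ ?_ ?_ ?_ (by simp [Expr.cost])
  · intro s' hf
    rw [Expr.eval_var, hf.var 14 (by decide)]
    simp [State.setVar_var, State.setArr_var]
  · intro x hx
    obtain rfl : x = 0 := by omega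
    simp [State.setVar_arr, State.setArr_arr]
  · intro i s' hi hb hf hx hI
    have hpow : 2 ^ (i + 1) ≤ 2 ^ stateBits om := Nat.pow_le_pow_right (by omega) hi
    rw [pow_succ] at hpow
    have h11 : s'.var 11 = i := by omega
    refine Run.write rfl rfl ?_ ?_ (by simp [Expr.cost])
    · simp [h11, hI i le_rfl]; omega
    · intro x hx
      simp only [State.setVar_arr, State.setArr_arr, if_true, Expr.eval_bin, Expr.eval_var,
        Expr.eval_const, Expr.eval_read, BinOp.apply_add, h11, hI i le_rfl]
      by_cases hxi : x = i + 1
      · subst hxi; rw [Function.update_self, pow_succ]; omega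
      · rw [Function.update_of_ne hxi]; exact hI x (by omega)
  intro s2 hb2 hf2 hx2 hI
  have w14 : s2.var 14 = stateBits om := (hf2.var 14 (by decide)).trans
    (by simp [State.setVar_var, State.setArr_var])
  have w13 : s2.var 13 = 2 ^ om := (hf2.var 13 (by decide)).trans
    (by simp [State.setVar_var, State.setArr_var, h13])
  refine Run.assign rfl (hb2.arr_le _ _) ?_ (by simp [Expr.cost])
  simp only [State.setVar_var, State.setVar_arr, Expr.eval_read, Expr.eval_var, w14, if_true,
    Nat.reduceEqDiff, if_false, w13, hI _ le_rfl]
  exact ⟨trivial, trivial, hI⟩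

def initEntry : Cmd :=
  .seq (Fm.needsNone.compile 0)
    (.seq (.cond (.var 99) (.assign 27 (.const 0))
      (.seq (Fm.needsOne.compile 0)
        (.cond (.var 99) (.assign 27 (.const 1)) (.assign 27 (.bin .add (.var 0) (.const 1))))))
      (.write 10 (.bin .add (.bin .mul (.var 18) (.var 15)) (.var 21)) (.var 27)))

theorem run_initEntry {V : ℕ} (hr : Ready G num par col om s) (he : Elim G num par col om)
    (hom : om ≤ n + 1) {v : Fin n} (hv : s.var 18 = v) (hV : n + 1 ≤ V) :
    Run V (Fm.needsNone.time (2 ^ om) + Fm.needsOne.time (2 ^ om) + 20) initEntry s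
      (fun s' => ∃ x, s'.arr 10 = Function.update (s.arr 10) (v * 2 ^ stateBits om + s.var 21) x ∧
        x ≤ n + 1 ∧ ∀ m ≤ n, (x ≤ m ↔ Spec G num col om id v (stI (s.var 21))
          (stO om (s.var 21)) (stS om (s.var 21)) m)) := by
  have hv2 := v.2
  have henv := hr.env_one he hv hom
  have hnone := Fm.holds_needsNone henv
  have hone := Fm.holds_needsOne henv
  have hspec := spec_id_iff he v (stI (s.var 21)) (stO om (s.var 21)) (stS om (s.var 21))
  rw [hv, hr.col_eq] at hone
  refine Run.seq (Fm.needsNone.time (2 ^ om)) (Fm.needsOne.time (2 ^ om) + 20) ?_ (by omega)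
  refine (henv.run_compile Fm.wf_needsNone (by decide)).mono le_rfl ?_
  rintro s1 hb1 - ⟨hvar1, harr1, h1⟩
  have henv1 : Fm.Env om _ _ s1 := henv.congr (hvar1 8 (by omega)) (hvar1 10 (by omega))
    (hvar1 13 (by omega)) (hvar1 18 (by omega)) (hvar1 19 (by omega)) (by rw [harr1])
    (by rw [harr1]) (by rw [harr1])
  have hone1 := Fm.holds_needsOne henv1
  rw [harr1, hvar1 18 (by omega), hvar1 21 (by omega), hv, hr.col_eq] at hone1
  -- The final write is common to the three outcomes 0, 1 and n + 1; the last one means that no set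
  -- in the cluster serves the state.
  have hlast : ∀ s2 : State, (∀ x < 27, s2.var x = s.var x) → s2.arr = s.arr →
      s2.var 27 ≤ n + 1 → (∀ m ≤ n, (s2.var 27 ≤ m ↔ Spec G num col om id v (stI (s.var 21))
          (stO om (s.var 21)) (stS om (s.var 21)) m)) →
      Run V 7 (.write 10 (.bin .add (.bin .mul (.var 18) (.var 15)) (.var 21)) (.var 27)) s2
      (fun s' => ∃ x, s'.arr 10 = Function.update (s.arr 10) (v * 2 ^ stateBits om + s.var 21) x ∧
        x ≤ n + 1 ∧ ∀ m ≤ n, (x ≤ m ↔ Spec G num col om id v (stI (s.var 21))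
          (stO om (s.var 21)) (stS om (s.var 21)) m)) := by
    intro s2 hv2 ha2 hle hiff
    refine Run.write rfl rfl ?_ ⟨s2.var 27, ?_, hle, hiff⟩ (by simp [Expr.cost])
    · exact hle.trans hV
    · simp [State.setArr_arr, ha2, hv2, hv, hr.states]
  refine Run.seq (Fm.needsOne.time (2 ^ om) + 13) 7 ?_ (by omega)
  refine Run.cond (Fm.needsOne.time (2 ^ om) + 10) rfl ?_ ?_ (by simp [Expr.cost]; omega)
  · intro hh
    have hN := hnone.1 (h1.1 hh)
    refine Run.assign rfl (by simp) ?_ (by simp [Expr.cost])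
    refine hlast _ (fun x hx => ?_) harr1 (by simp [State.setVar_var]) fun m hm => ?_
    · rw [State.setVar_var, if_neg (by omega), hvar1 x (by omega)]
    · simp only [State.setVar_var, if_true, Expr.eval_const, Nat.zero_le, true_iff]
      exact (hspec m).2 (.inl hN)
  · intro hh
    have hN : ¬ _ := fun hc => (h1.2 (hnone.2 hc)) hh
    refine Run.seq (Fm.needsOne.time (2 ^ om)) 9 ?_ (by omega)
    refine (henv1.run_compile Fm.wf_needsOne (by decide)).mono le_rfl ?_
    rintro s3 hb3 - ⟨hvar3, harr3, h3⟩
    have hvar : ∀ x < 99, s3.var x = s.var x := fun x hx => (hvar3 x hx).trans (hvar1 x hx)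
    have harr : s3.arr = s.arr := harr3.trans harr1
    rw [hone1] at h3
    refine Run.cond 4 rfl ?_ ?_ (by simp [Expr.cost])
    · intro hh'
      have hO := h3.1 hh'
      refine Run.assign rfl (by simp; omega) ?_ (by simp [Expr.cost])
      refine hlast _ (fun x hx => ?_) harr (by simp [State.setVar_var]) fun m hm => ?_
      · rw [State.setVar_var, if_neg (by omega), hvar x (by omega)]
      · simp only [State.setVar_var, if_true, Expr.eval_const]
        rw [hspec]
        exact ⟨fun h => .inr ⟨h, hO⟩, fun h => (h.resolve_left hN).1⟩
    · intro hh'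
      have hO : ¬ _ := fun hc => h3.2 hc hh'
      have h0 : s3.var 0 = n := (hvar 0 (by omega)).trans hr.card
      refine Run.assign rfl (by simp [h0]; omega) ?_ (by simp [Expr.cost])
      refine hlast _ (fun x hx => ?_) harr (by simp [State.setVar_var, h0]) fun m hm => ?_
      · rw [State.setVar_var, if_neg (by omega), hvar x (by omega)]
      · simp only [State.setVar_var, if_true, Expr.eval_bin, Expr.eval_var, Expr.eval_const,
          BinOp.apply_add, h0]
        rw [hspec]
        exact ⟨fun h => absurd h (by omega), fun h => absurd (h.resolve_left hN).2 hO⟩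

def initTables : Cmd :=
  .forLoop 18 (.const 0) (.var 0)
    (.seq (.write 11 (.var 18) (.var 18)) (.forLoop 21 (.const 0) (.var 15) initEntry))

/-- The tables of the vertices before `j` in blocks below `nb`. -/
def Blocks (G : SimpleGraph (Fin n)) (num : Fin n → ℕ) (col : Fin n → ℕ) (om : ℕ)
    (rep : Fin n → Fin n) (j nb : ℕ) (base tab : ℕ → ℕ) : Prop :=
  ∀ v : Fin n, num v < j → base v < nb ∧
    IsTable G num col om rep n v fun x => tab (base v * 2 ^ stateBits om + x)

theorem run_initTables {V : ℕ} (hr : Ready G num par col om s) (he : Elim G num par col om)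
    (hom : om ≤ n + 1) (hV : n + 1 ≤ V) (hZ : 2 ^ stateBits om ≤ V) :
    Run V (n * (2 ^ stateBits om *
      (Fm.needsNone.time (2 ^ om) + Fm.needsOne.time (2 ^ om) + 28) + 20) + 10) initTables s
      (fun s' => ∀ j, Blocks G num col om id j n (s'.arr 11) (s'.arr 10)) := by
  set Z := 2 ^ stateBits om with hZ'
  set t0 := Fm.needsNone.time (2 ^ om) + Fm.needsOne.time (2 ^ om) with ht0
  refine Run.forLoop 0 n (Z * (t0 + 28) + 10) (fun i s' => ∀ v : Fin n, v < i →
      s'.arr 11 v = v ∧ IsTable G num col om id n v fun x => s'.arr 10 (v * Z + x))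
    rfl rfl rfl (by decide) (by omega) ?_ ?_ ?_ ?_ ?_
  · intro s' hf
    rw [Expr.eval_var, hf.var 0 (by decide), hr.card, zero_add]
  · intro v hv; omega
  · intro i s' hi hb hf hx hI
    have hx' : s'.var 18 = i := by omega
    have hr' : Ready G num par col om s' := hr.congr (hf.var 0 (by decide)) (hf.var 8 (by decide))
      (hf.var 10 (by decide)) (hf.var 13 (by decide)) (hf.var 15 (by decide))
      (hf.arr 6 (by decide)) (hf.arr 7 (by decide)) (hf.arr 8 (by decide)) (hf.arr 9 (by decide))
      (hf.arr 12 (by decide))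
    refine Run.seq 3 (Z * (t0 + 28) + 6) (Run.write rfl rfl (hb.var_le _) ?_ (by simp [Expr.cost]))
      (by omega)
    simp only [Expr.eval_var, hx']
    set s1 := s'.setArr 11 i i with hs1
    have hr1 : Ready G num par col om s1 := hr'.congr rfl rfl rfl rfl rfl
      (by simp [hs1, State.setArr_arr]) (by simp [hs1, State.setArr_arr])
      (by simp [hs1, State.setArr_arr]) (by simp [hs1, State.setArr_arr])
      (by simp [hs1, State.setArr_arr])
    refine Run.forLoop 0 Z (t0 + 20) (fun j s'' =>
        (∀ v : Fin n, v < i → ∀ x < Z, s''.arr 10 (v * Z + x) = s'.arr 10 (v * Z + x)) ∧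
        ∀ x < j, s''.arr 10 (i * Z + x) ≤ n + 1 ∧ ∀ m ≤ n, (s''.arr 10 (i * Z + x) ≤ m ↔
          Spec G num col om id ⟨i, hi⟩ (stI x) (stO om x) (stS om x) m))
      rfl rfl rfl (by decide) (by omega) ?_ ?_ ?_ ?_ ?_
    · intro s'' hf'
      rw [Expr.eval_var, hf'.var 15 (by decide), hr1.states, zero_add]
    · refine ⟨fun v _ x _ => by simp [hs1, State.setVar_arr, State.setArr_arr], ?_⟩
      intro x hx; omega
    · rintro j s'' hj hb'' hf' hx'' ⟨hI1, hI2⟩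
      have hr'' : Ready G num par col om s'' := hr1.congr (hf'.var 0 (by decide))
        (hf'.var 8 (by decide)) (hf'.var 10 (by decide)) (hf'.var 13 (by decide))
        (hf'.var 15 (by decide)) (hf'.arr 6 (by decide)) (hf'.arr 7 (by decide))
        (hf'.arr 8 (by decide)) (hf'.arr 9 (by decide)) (hf'.arr 12 (by decide))
      have h18 : s''.var 18 = (⟨i, hi⟩ : Fin n) := (hf'.var 18 (by decide)).trans
        (by simp [hs1, State.setArr_var, hx'])
      have h21 : s''.var 21 = j := by omega
      refine (run_initEntry hr'' he hom h18 hV).mono le_rfl ?_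
      rintro s3 - - ⟨x₀, hup, hle, hiff⟩
      rw [h21] at hup hiff
      simp only [State.setVar_arr, hup, ← hZ']
      refine ⟨fun v hv x hx => ?_, fun x hx => ?_⟩
      · rw [Function.update_of_ne, hI1 v hv x hx]
        intro hc
        have := (mul_add_inj hx hj hc).1
        omega
      · by_cases hxj : x = j
        · subst hxj
          rw [Function.update_self]
          exact ⟨hle, hiff⟩
        · rw [Function.update_of_ne (by omega)]
          exact hI2 x (by omega)
    · rintro s'' hb'' hf' - ⟨hI1, hI2⟩
      have h11 : s''.arr 11 = Function.update (s'.arr 11) i i := (hf'.arr 11 (by decide)).trans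
        (by simp [hs1, State.setArr_arr])
      intro v hv
      simp only [State.setVar_arr, h11]
      by_cases hvi : (v : ℕ) = i
      · refine ⟨by rw [hvi, Function.update_self], fun x hx => ?_⟩
        have := hI2 x hx
        have hv' : v = ⟨i, hi⟩ := Fin.ext hvi
        subst hv'
        exact this
      · have hvlt : (v : ℕ) < i := by omega
        refine ⟨by rw [Function.update_of_ne hvi, (hI v hvlt).1], ?_⟩
        exact (hI v hvlt).2.congr (fun _ => Iff.rfl) fun x hx => hI1 v hvlt x hx
    · simp only [Expr.cost]
      nlinarith
  · intro s' hb hf hx hI j v _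
    obtain ⟨h1, h2⟩ := hI v v.2
    rw [h1]
    exact ⟨v.2, h2⟩
  · simp only [Expr.cost]
    nlinarith

end Dynamic

end RAM

namespace MEG

/-! ### Minimising over pairs of states -/

section Best

variable {V : Type*} {G : SimpleGraph V} {num : V → ℕ} {par : V → V} {col : V → ℕ} {om n : ℕ}
  {c : V} {tab₁ tab₂ : ℕ → ℕ} {s best : ℕ} {P : ℕ → ℕ → Prop}

open Classical in
theorem IsBest.step (h : IsBest G num par col om n c tab₁ tab₂ s P best) {s₁ s₂ : ℕ}
    (h₁ : s₁ < 2 ^ stateBits om) (h₂ : s₂ < 2 ^ stateBits om) {P' : ℕ → ℕ → Prop}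
    (hP : ∀ a b, P' a b → P a b ∨ (a = s₁ ∧ b = s₂)) :
    IsBest G num par col om n c tab₁ tab₂ s P'
      (if Combine G num par col om c s s₁ s₂ ∧ tab₁ s₁ + tab₂ s₂ < best then tab₁ s₁ + tab₂ s₂
        else best) := by
  have hle := h.le
  by_cases hc : Combine G num par col om c s s₁ s₂ ∧ tab₁ s₁ + tab₂ s₂ < best
  · rw [if_pos hc]
    refine ⟨by omega, fun a b hab hj => ?_, .inr ⟨s₁, s₂, h₁, h₂, hc.1, rfl⟩⟩
    rcases hP a b hab with hab | ⟨rfl, rfl⟩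
    · have := h.min a b hab hj; omega
    · exact le_rfl
  · rw [if_neg hc]
    refine ⟨hle, fun a b hab hj => ?_, h.ex⟩
    rcases hP a b hab with hab | ⟨rfl, rfl⟩
    · exact h.min a b hab hj
    · rw [not_and, not_lt] at hc
      exact hc hj

theorem IsBest.imp (h : IsBest G num par col om n c tab₁ tab₂ s P best) {P' : ℕ → ℕ → Prop}
    (hP : ∀ a b, P' a b → P a b) : IsBest G num par col om n c tab₁ tab₂ s P' best :=
  ⟨h.le, fun a b hab => h.min a b (hP a b hab), h.ex⟩

end Best

end MEG

namespace RAM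

open MEG

/-! ### Merging tables and processing the vertices in reverse order -/

section Dynamic

variable {n : ℕ} {G : SimpleGraph (Fin n)} {num : Fin n → ℕ} {par : Fin n → Fin n}
  {col : Fin n → ℕ} {om : ℕ} {s : State}

/-- Improve the value in variable `27` by the states in variables `22` and `23`. -/
def mergePair : Cmd :=
  .seq (Fm.combine.compile 0)
    (.cond (.var 99)
      (.seq (.assign 29 (.bin .add (.read 10 (.bin .add (.var 26) (.var 22)))
          (.read 10 (.bin .add (.var 25) (.var 23)))))
        (.cond (.bin .lt (.var 29) (.var 27)) (.assign 27 (.var 29)) .skip)) .skip)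

open Classical in
theorem run_mergePair {V : ℕ} (hr : Ready G num par col om s) (he : Elim G num par col om)
    (hom : om ≤ n + 1) {c : Fin n} (hc : s.var 18 = c) (hp : s.var 19 = par c)
    {tab₁ tab₂ : ℕ → ℕ} (h₁ : s.arr 10 (s.var 26 + s.var 22) = tab₁ (s.var 22))
    (h₂ : s.arr 10 (s.var 25 + s.var 23) = tab₂ (s.var 23))
    (hV : tab₁ (s.var 22) + tab₂ (s.var 23) ≤ V) :
    Run V (Fm.combine.time (2 ^ om) + 18) mergePair s (fun s' => s'.var 27 =
      if Combine G num par col om c (s.var 21) (s.var 22) (s.var 23) ∧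
        tab₁ (s.var 22) + tab₂ (s.var 23) < s.var 27 then tab₁ (s.var 22) + tab₂ (s.var 23)
      else s.var 27) := by
  have henv := hr.env he hc hp hom
  have hcomb := Fm.holds_combine henv
  rw [hc, hr.col_eq] at hcomb
  refine Run.seq (Fm.combine.time (2 ^ om)) 18 ?_ (by omega)
  refine (henv.run_compile Fm.wf_combine (by decide)).mono le_rfl ?_
  rintro s1 hb1 - ⟨hvar1, harr1, h1⟩
  rw [hcomb] at h1
  refine Run.cond 16 rfl ?_ ?_ (by simp [Expr.cost])
  · intro hh
    have hj : Combine G num par col om c (s.var 21) (s.var 22) (s.var 23) := h1.1 hh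
    have hev : (Expr.bin .add (.read 10 (.bin .add (.var 26) (.var 22)))
          (.read 10 (.bin .add (.var 25) (.var 23)))).eval s1 =
        tab₁ (s.var 22) + tab₂ (s.var 23) := by
      simp [harr1, hvar1, h₁, h₂]
    refine Run.seq 10 6 (Run.assign rfl ?_ ?_ (by simp [Expr.cost])) (by omega)
    · rwa [hev]
    rw [hev]
    refine Run.cond 2 rfl ?_ ?_ (by simp [Expr.cost])
    · intro h'
      have hlt : tab₁ (s.var 22) + tab₂ (s.var 23) < s.var 27 := by
        by_contra hcon
        simp [State.setVar_var, hvar1, hcon] at h'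
      rw [if_pos ⟨hj, hlt⟩]
      refine Run.assign rfl ?_ ?_ (by simp [Expr.cost])
      · simpa [State.setVar_var] using hV
      · simp [State.setVar_var]
    · intro h'
      have hlt : ¬ tab₁ (s.var 22) + tab₂ (s.var 23) < s.var 27 := by
        intro hcon
        simp [State.setVar_var, hvar1, hcon] at h'
      rw [if_neg fun hcon => hlt hcon.2]
      refine Run.skip ?_ (by omega)
      simp [State.setVar_var, hvar1]
  · intro hh
    rw [if_neg fun hcon => (h1.2 hcon.1) hh]
    exact Run.skip (hvar1 27 (by omega)) (by omega)

def mergeEntry : Cmd :=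
  .seq (.assign 27 (.bin .add (.var 0) (.const 1)))
    (.seq (.forLoop 22 (.const 0) (.var 15) (.forLoop 23 (.const 0) (.var 15) mergePair))
      (.write 10 (.bin .add (.var 28) (.var 21)) (.var 27)))

/-- A bound for the time per entry. -/
def mergeTime (om : ℕ) : ℕ :=
  2 ^ stateBits om * (2 ^ stateBits om * (Fm.combine.time (2 ^ om) + 26) + 14)

theorem Ready.congr_frame (h : Ready G num par col om s) {p : Cmd} {s' : State}
    (hf : Frame p s s')
    (hv : (0 ∉ p.wv ∧ 8 ∉ p.wv ∧ 10 ∉ p.wv) ∧ 13 ∉ p.wv ∧ 15 ∉ p.wv)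
    (ha : (6 ∉ p.wa ∧ 7 ∉ p.wa ∧ 8 ∉ p.wa) ∧ 9 ∉ p.wa ∧ 12 ∉ p.wa) :
    Ready G num par col om s' :=
  h.congr (hf.var 0 hv.1.1) (hf.var 8 hv.1.2.1) (hf.var 10 hv.1.2.2) (hf.var 13 hv.2.1)
    (hf.var 15 hv.2.2) (hf.arr 6 ha.1.1) (hf.arr 7 ha.1.2.1) (hf.arr 8 ha.1.2.2)
    (hf.arr 9 ha.2.1) (hf.arr 12 ha.2.2)

theorem run_mergeEntry {V : ℕ} (hr : Ready G num par col om s) (he : Elim G num par col om)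
    (hom : om ≤ n + 1) {c : Fin n} (hc : s.var 18 = c) (hp : s.var 19 = par c)
    {tab₁ tab₂ : ℕ → ℕ} (h₁ : ∀ x < 2 ^ stateBits om, s.arr 10 (s.var 26 + x) = tab₁ x)
    (h₂ : ∀ x < 2 ^ stateBits om, s.arr 10 (s.var 25 + x) = tab₂ x)
    (hle₁ : ∀ x < 2 ^ stateBits om, tab₁ x ≤ n + 1)
    (hle₂ : ∀ x < 2 ^ stateBits om, tab₂ x ≤ n + 1) (hV : 2 * n + 2 ≤ V)
    (hZ : 2 ^ stateBits om ≤ V) :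
    Run V (mergeTime om + 15) mergeEntry s (fun s' => ∃ best,
      s'.arr 10 = Function.update (s.arr 10) (s.var 28 + s.var 21) best ∧
      IsBest G num par col om n c tab₁ tab₂ (s.var 21)
        (fun a b => a < 2 ^ stateBits om ∧ b < 2 ^ stateBits om) best) := by
  classical
  set Z := 2 ^ stateBits om with hZ'
  set t0 := Fm.combine.time (2 ^ om) with ht0
  have hT : mergeTime om = Z * (Z * (t0 + 26) + 14) := rfl
  refine Run.seq 4 (mergeTime om + 11) (Run.assign rfl ?_ ?_ (by simp [Expr.cost])) (by omega)
  · simp [hr.card]; omega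
  simp only [Expr.eval_bin, Expr.eval_var, Expr.eval_const, BinOp.apply_add, hr.card]
  set s0 := s.setVar 27 (n + 1) with hs0
  have hr0 : Ready G num par col om s0 := hr.congr (by simp [hs0, State.setVar_var])
    (by simp [hs0, State.setVar_var]) (by simp [hs0, State.setVar_var])
    (by simp [hs0, State.setVar_var]) (by simp [hs0, State.setVar_var]) rfl rfl rfl rfl rfl
  refine Run.seq (mergeTime om + 6) 5 ?_ (by omega)
  refine Run.forLoop 0 Z (Z * (t0 + 26) + 6)
    (fun i s' => IsBest G num par col om n c tab₁ tab₂ (s.var 21) (fun a b => a < i ∧ b < Z)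
      (s'.var 27)) rfl rfl rfl (by decide) (by omega) ?_ ?_ ?_ ?_ ?_
  · intro s' hf
    rw [Expr.eval_var, hf.var 15 (by decide), hr0.states, zero_add]
  · have e27 : (s0.setVar 22 0).var 27 = n + 1 := by simp [hs0, State.setVar_var]
    rw [e27]
    exact ⟨le_rfl, fun a b h => absurd h.1 (by omega), .inl rfl⟩
  · intro i s' hi hb hf hx hI
    have hx' : s'.var 22 = i := by omega
    have hr' := hr0.congr_frame hf (by decide) (by decide)
    -- The predicate in `IsBest` describes the pairs tried so far: those with first component below
    -- i, and those with first component i and second component below j.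
    refine Run.forLoop 0 Z (t0 + 18)
      (fun j s'' => IsBest G num par col om n c tab₁ tab₂ (s.var 21)
        (fun a b => (a < i ∧ b < Z) ∨ (a = i ∧ b < j))
        (s''.var 27)) rfl rfl rfl (by decide) (by omega) ?_ ?_ ?_ ?_ ?_
    · intro s'' hf'
      rw [Expr.eval_var, hf'.var 15 (by decide), hr'.states, zero_add]
    · have e27 : (s'.setVar 23 0).var 27 = s'.var 27 := by simp [State.setVar_var]
      rw [e27]
      exact hI.imp fun a b h => by omega
    · intro j s'' hj hb'' hf' hx'' hI'
      have hr'' := hr'.congr_frame hf' (by decide) (by decide)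
      have e18 : s''.var 18 = c := by
        rw [hf'.var 18 (by decide), hf.var 18 (by decide)]; simpa [hs0, State.setVar_var] using hc
      have e19 : s''.var 19 = par c := by
        rw [hf'.var 19 (by decide), hf.var 19 (by decide)]; simpa [hs0, State.setVar_var] using hp
      have e21 : s''.var 21 = s.var 21 := by
        rw [hf'.var 21 (by decide), hf.var 21 (by decide)]; simp [hs0, State.setVar_var]
      have e25 : s''.var 25 = s.var 25 := by
        rw [hf'.var 25 (by decide), hf.var 25 (by decide)]; simp [hs0, State.setVar_var]
      have e26 : s''.var 26 = s.var 26 := by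
        rw [hf'.var 26 (by decide), hf.var 26 (by decide)]; simp [hs0, State.setVar_var]
      have e22 : s''.var 22 = i := (hf'.var 22 (by decide)).trans hx'
      have e23 : s''.var 23 = j := by omega
      have a10 : s''.arr 10 = s.arr 10 := by
        rw [hf'.arr 10 (by decide), hf.arr 10 (by decide)]; rfl
      refine (run_mergePair (tab₁ := tab₁) (tab₂ := tab₂) hr'' he hom e18 e19
        (by rw [a10, e26, e22]; exact h₁ i hi) (by rw [a10, e25, e23]; exact h₂ j hj) ?_).mono
        le_rfl ?_
      · rw [e22, e23]
        have := hle₁ i hi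
        have := hle₂ j hj
        omega
      · intro s3 _ _ h3
        rw [e21, e22, e23] at h3
        have e27 : (s3.setVar 23 (0 + j + 1)).var 27 = s3.var 27 := by simp [State.setVar_var]
        rw [e27, h3]
        exact hI'.step hi hj fun a b h => by omega
    · rintro s'' hb'' hf' - hI'
      have e27 : (s''.setVar 22 (0 + i + 1)).var 27 = s''.var 27 := by simp [State.setVar_var]
      rw [e27]
      exact hI'.imp fun a b h => by omega
    · simp [Expr.cost]
  · intro s' hb hf hx hI
    have e28 : s'.var 28 = s.var 28 := by
      rw [hf.var 28 (by decide)]; simp [hs0, State.setVar_var]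
    have e21 : s'.var 21 = s.var 21 := by
      rw [hf.var 21 (by decide)]; simp [hs0, State.setVar_var]
    have a10 : s'.arr 10 = s.arr 10 := by
      rw [hf.arr 10 (by decide)]; rfl
    refine Run.write rfl rfl (hb.var_le _) ⟨s'.var 27, ?_, hI⟩ (by simp [Expr.cost])
    simp [State.setArr_arr, e28, e21, a10]
  · simp [Expr.cost, hT]

/-- Merge the table of the vertex in variable `18` into that of its parent in variable `19`. -/
def mergeTables : Cmd :=
  .seq (.assign 25 (.bin .mul (.read 11 (.var 18)) (.var 15)))
    (.seq (.assign 26 (.bin .mul (.read 11 (.var 19)) (.var 15)))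
      (.seq (.assign 28 (.bin .mul (.var 16) (.var 15)))
        (.seq (.forLoop 21 (.const 0) (.var 15) mergeEntry)
          (.seq (.write 11 (.var 19) (.var 16))
            (.assign 16 (.bin .add (.var 16) (.const 1)))))))

/-- Both old tables are still read while the new one is computed, so it goes to an unused block.
Besides the n initial blocks there is one for each merge, hence the factor 2n + 1 in later bounds.
Clusters other than those of c and its parent are unchanged and keep their tables. -/
theorem run_mergeTables {V nb : ℕ} (hr : Ready G num par col om s) (he : Elim G num par col om)
    (hom : om ≤ n + 1) {c : Fin n} (hc : s.var 18 = c) (hp : s.var 19 = par c)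
    {rep : Fin n → Fin n} (hrep : Clusters G num (num c + 1) rep)
    (hce : (earlier G num c).Nonempty) (hnb : s.var 16 = nb)
    (hI : Blocks G num col om rep (num c + 1) nb (s.arr 11) (s.arr 10)) (hV : 2 * n + 2 ≤ V)
    (hZ : (nb + 1) * 2 ^ stateBits om ≤ V) :
    Run V (2 ^ stateBits om * (mergeTime om + 23) + 27) mergeTables s (fun s' =>
      s'.var 16 = nb + 1 ∧
      Blocks G num col om (mergeRep rep c (par c)) (num c) (nb + 1) (s'.arr 11) (s'.arr 10)) := by
  have hpar := he.par_mem c hce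
  have hpc : par c ≠ c := hpar.1.ne
  obtain ⟨hb₂, ht₂⟩ := hI c (by omega)
  obtain ⟨hb₁, ht₁⟩ := hI (par c) (by have := hpar.2; omega)
  set Z := 2 ^ stateBits om with hZ'
  have hZ1 : 1 ≤ Z := Nat.one_le_two_pow
  have hblk : ∀ b < nb, b * Z ≤ V ∧ ∀ x < Z, b * Z + x < nb * Z := by
    intro b hb
    have h1 : (b + 1) * Z ≤ nb * Z := Nat.mul_le_mul_right _ hb
    rw [Nat.add_mul] at h1 hZ
    exact ⟨by omega, fun x hx => by omega⟩
  have hnbZ : nb * Z ≤ V ∧ Z ≤ V ∧ nb + 1 ≤ V := by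
    rw [Nat.add_mul] at hZ
    have := Nat.le_mul_of_pos_right nb (show 0 < Z by omega)
    exact ⟨by omega, by omega, by omega⟩
  refine Run.seq 5 (Z * (mergeTime om + 23) + 22) (Run.assign rfl ?_ ?_ (by simp [Expr.cost]))
    (by omega)
  · simp [hc, hr.states]; exact (hblk _ hb₂).1
  simp only [Expr.eval_bin, Expr.eval_var, Expr.eval_read, BinOp.apply_mul, hc, hr.states]
  refine Run.seq 5 (Z * (mergeTime om + 23) + 17) (Run.assign rfl ?_ ?_ (by simp [Expr.cost]))
    (by omega)
  · simp [State.setVar_var, State.setVar_arr, hp, hr.states]; exact (hblk _ hb₁).1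
  refine Run.seq 4 (Z * (mergeTime om + 23) + 13) (Run.assign rfl ?_ ?_ (by simp [Expr.cost]))
    (by omega)
  · simp [State.setVar_var, hnb, hr.states]; exact hnbZ.1
  simp only [Expr.eval_bin, Expr.eval_var, Expr.eval_read, BinOp.apply_mul, State.setVar_var,
    State.setVar_arr, Nat.reduceEqDiff, if_false, hp, hr.states, hnb, ← hZ']
  set s0 := ((s.setVar 25 (s.arr 11 c * Z)).setVar 26 (s.arr 11 (par c) * Z)).setVar 28 (nb * Z)
    with hs0
  have hr0 : Ready G num par col om s0 := hr.congr (by simp [hs0, State.setVar_var])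
    (by simp [hs0, State.setVar_var]) (by simp [hs0, State.setVar_var])
    (by simp [hs0, State.setVar_var]) (by simp [hs0, State.setVar_var]) rfl rfl rfl rfl rfl
  refine Run.seq (Z * (mergeTime om + 23) + 6) 7 ?_ (by omega)
  refine Run.forLoop 0 Z (mergeTime om + 15) (fun i s' =>
      (∀ x < nb * Z, s'.arr 10 x = s.arr 10 x) ∧
      ∀ x < i, IsBest G num par col om n c (fun x => s.arr 10 (s.arr 11 (par c) * Z + x))
        (fun x => s.arr 10 (s.arr 11 c * Z + x)) x (fun a b => a < Z ∧ b < Z)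
        (s'.arr 10 (nb * Z + x))) rfl rfl rfl (by decide) (by omega) ?_ ?_ ?_ ?_ ?_
  · intro s' hf
    rw [Expr.eval_var, hf.var 15 (by decide), hr0.states, zero_add]
  · exact ⟨fun x _ => rfl, fun x hx => absurd hx (by omega)⟩
  · rintro i s' hi hb hf hx ⟨hI1, hI2⟩
    have hr' := hr0.congr_frame hf (by decide) (by decide)
    have e18 : s'.var 18 = c := by
      rw [hf.var 18 (by decide)]; simpa [hs0, State.setVar_var] using hc
    have e19 : s'.var 19 = par c := by
      rw [hf.var 19 (by decide)]; simpa [hs0, State.setVar_var] using hp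
    have e25 : s'.var 25 = s.arr 11 c * Z := by
      rw [hf.var 25 (by decide)]; simp [hs0, State.setVar_var]
    have e26 : s'.var 26 = s.arr 11 (par c) * Z := by
      rw [hf.var 26 (by decide)]; simp [hs0, State.setVar_var]
    have e28 : s'.var 28 = nb * Z := by
      rw [hf.var 28 (by decide)]; simp [hs0, State.setVar_var]
    have e21 : s'.var 21 = i := by omega
    refine (run_mergeEntry hr' he hom e18 e19
      (tab₁ := fun x => s.arr 10 (s.arr 11 (par c) * Z + x))
      (tab₂ := fun x => s.arr 10 (s.arr 11 c * Z + x))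
      (fun x hx => by rw [e26]; exact hI1 _ ((hblk _ hb₁).2 x hx))
      (fun x hx => by rw [e25]; exact hI1 _ ((hblk _ hb₂).2 x hx))
      (fun x hx => (ht₁ x hx).1) (fun x hx => (ht₂ x hx).1) hV hnbZ.2.1).mono le_rfl ?_
    rintro s'' - - ⟨best, hup, hbest⟩
    rw [e28, e21] at hup
    rw [e21] at hbest
    simp only [State.setVar_arr, hup]
    refine ⟨fun x hx => ?_, fun x hx => ?_⟩
    · rw [Function.update_of_ne (by omega)]; exact hI1 x hx
    · by_cases hxi : x = i
      · subst hxi; rw [Function.update_self]; exact hbest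
      · rw [Function.update_of_ne (by omega)]; exact hI2 x (by omega)
  · rintro s' hb hf hx ⟨hI1, hI2⟩
    have e19 : s'.var 19 = par c := by
      rw [hf.var 19 (by decide)]; simpa [hs0, State.setVar_var] using hp
    have e16 : s'.var 16 = nb := by
      rw [hf.var 16 (by decide)]; simpa [hs0, State.setVar_var] using hnb
    have a11 : s'.arr 11 = s.arr 11 := by
      rw [hf.arr 11 (by decide)]; rfl
    refine Run.seq 3 4 (Run.write rfl rfl (hb.var_le _) ?_ (by simp [Expr.cost])) (by omega)
    refine Run.assign rfl ?_ ?_ (by simp [Expr.cost])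
    · simp [State.setArr_var, e16]; exact hnbZ.2.2
    · simp only [State.setVar_var, State.setVar_arr, State.setArr_var, State.setArr_arr, if_true,
        Expr.eval_bin, Expr.eval_var, Expr.eval_const, BinOp.apply_add, e16, e19, a11,
        Nat.reduceEqDiff, if_false, true_and]
      intro v hv
      by_cases hvp : v = par c
      · subst hvp
        rw [Function.update_self]
        exact ⟨by omega, ht₁.merge he hrep hce ht₂ fun x hx => hI2 x hx⟩
      · obtain ⟨hbv, htv⟩ := hI v (by omega)
        rw [update_fin hvp]
        refine ⟨by omega, htv.congr (fun u => ?_) fun x hx => hI1 _ ((hblk _ hbv).2 x hx)⟩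
        rw [mergeRep_eq_iff (by rintro rfl; omega)]
        exact ⟨fun h => h.resolve_right fun h' => hvp h'.2.symm, .inl⟩
  · simp only [Expr.cost]
    nlinarith

/-- Process the vertices from the last to the first. -/
def processBody : Cmd :=
  .seq (.assign 18 (.read 6 (.bin .sub (.var 0) (.bin .add (.var 20) (.const 1)))))
    (.cond (.read 8 (.var 18))
      (.seq (.assign 19 (.read 6 (.bin .sub (.read 8 (.var 18)) (.const 1)))) mergeTables)
      (.seq (.assign 17 (.bin .add (.var 17) (.read 10 (.bin .mul (.read 11 (.var 18)) (.var 15)))))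
        (.cond (.bin .lt (.bin .add (.var 0) (.const 1)) (.var 17))
          (.assign 17 (.bin .add (.var 0) (.const 1))) .skip)))

/-- The vertices from `j` on have been processed, and at most `nb` blocks are in use. -/
def Progress (G : SimpleGraph (Fin n)) (num : Fin n → ℕ) (col : Fin n → ℕ) (om j nb : ℕ)
    (s : State) : Prop :=
  ∃ rep : Fin n → Fin n, Clusters G num j rep ∧ s.var 16 ≤ nb ∧
    Blocks G num col om rep j (s.var 16) (s.arr 11) (s.arr 10) ∧ s.var 17 ≤ n + 1 ∧
    ∀ m ≤ n, s.var 17 ≤ m ↔ Done G num rep j m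

theorem run_processBody {V nb : ℕ} (hr : Ready G num par col om s) (he : Elim G num par col om)
    (hom : om ≤ n + 1) {c : Fin n} (hc : s.arr 6 (s.var 0 - (s.var 20 + 1)) = c)
    (hI : Progress G num col om (num c + 1) nb s) (hV : 2 * n + 2 ≤ V)
    (hZ : (nb + 1) * 2 ^ stateBits om ≤ V) :
    Run V (2 ^ stateBits om * (mergeTime om + 23) + 50) processBody s
      (Progress G num col om (num c) (nb + 1)) := by
  obtain ⟨rep, hrep, hnb, hblk, hans, hdone⟩ := hI
  have hc2 := c.2
  refine Run.seq 8 (2 ^ stateBits om * (mergeTime om + 23) + 42)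
    (Run.assign rfl ?_ ?_ (by simp [Expr.cost])) (by omega)
  · simp [hc]; omega
  have hev : (Expr.read 6 (.bin .sub (.var 0) (.bin .add (.var 20) (.const 1)))).eval s = c := hc
  rw [hev]
  refine Run.cond (2 ^ stateBits om * (mergeTime om + 23) + 35) rfl ?_ ?_
    (by simp [Expr.cost]; omega)
  · intro h
    have hne : (earlier G num c).Nonempty := by
      rw [Set.nonempty_iff_ne_empty]
      intro hcc
      simp [State.setVar_var, State.setVar_arr, hr.root c hcc] at h
    have hp2 := (par c).2
    have hev : (Expr.read 6 (.bin .sub (.read 8 (.var 18)) (.const 1))).eval (s.setVar 18 c) =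
        par c := by
      simp [State.setVar_var, State.setVar_arr, hr.child c hne, hr.ord]
    refine Run.seq 6 (2 ^ stateBits om * (mergeTime om + 23) + 27)
      (Run.assign rfl ?_ ?_ (by simp [Expr.cost])) (by omega)
    · rw [hev]; omega
    rw [hev]
    set s0 := (s.setVar 18 c).setVar 19 (par c) with hs0
    have hr0 : Ready G num par col om s0 := hr.congr (by simp [hs0, State.setVar_var])
      (by simp [hs0, State.setVar_var]) (by simp [hs0, State.setVar_var])
      (by simp [hs0, State.setVar_var]) (by simp [hs0, State.setVar_var]) rfl rfl rfl rfl rfl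
    refine (run_mergeTables (nb := s.var 16) hr0 he hom (c := c) (by simp [hs0, State.setVar_var])
      (by simp [hs0, State.setVar_var]) hrep hne (by simp [hs0, State.setVar_var]) hblk hV
      (le_trans (Nat.mul_le_mul_right _ (by omega)) hZ)).mono le_rfl ?_
    rintro s' hb hf ⟨h16, hblk'⟩
    have e17 : s'.var 17 = s.var 17 := by
      rw [hf.var 17 (by decide)]; simp [hs0, State.setVar_var]
    refine ⟨mergeRep rep c (par c), hrep.merge he hne, by omega, by rwa [h16], by omega, ?_⟩
    intro m hm
    rw [e17, hdone m hm, done_mergeRep he hne]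
  · intro h
    have hroot : earlier G num c = ∅ := by
      by_contra hcc
      have := hr.child c (Set.nonempty_iff_ne_empty.mpr hcc)
      simp [State.setVar_var, State.setVar_arr, this] at h
    obtain ⟨hbc, htc⟩ := hblk c (by omega)
    obtain ⟨hle, hiff⟩ := htc 0 Nat.one_le_two_pow
    simp only [add_zero] at hle hiff
    set x := s.arr 10 (s.arr 11 c * 2 ^ stateBits om) with hx
    have hev : (Expr.bin .add (.var 17) (.read 10 (.bin .mul (.read 11 (.var 18))
        (.var 15)))).eval (s.setVar 18 c) = s.var 17 + x := by
      simp [State.setVar_var, State.setVar_arr, hr.states, hx]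
    have hspec : ∀ m ≤ n, (x ≤ m ↔ Spec G num col om rep c (fun _ => False) (fun _ => False)
        (fun _ _ => False) m) := by
      intro m hm
      -- State 0 demands no types, expects none and demands no pairs, as is right for a finished
      -- cluster.
      have h0I : stI 0 = fun _ => False := by ext t; simp [stI]
      have h0O : stO om 0 = fun _ => False := by ext t; simp [stO]
      have h0S : stS om 0 = fun _ _ => False := by ext i j; simp [stS]
      rw [hiff m hm, h0I, h0O, h0S]
    -- It suffices that the stored value compares with all m ≤ n as the true sum does, so the sum
    -- may be cut off at n + 1.
    have hmin : ∀ y, y ≤ n + 1 → (∀ m ≤ n, (y ≤ m ↔ s.var 17 + x ≤ m)) →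
        ∀ m ≤ n, (y ≤ m ↔ Done G num rep (num c) m) := by
      intro y _ hy m hm
      rw [hy m hm, done_root he hrep hroot]
      constructor
      · intro h
        exact ⟨s.var 17, x, h, (hdone _ (by omega)).1 le_rfl, (hspec _ (by omega)).1 le_rfl⟩
      · rintro ⟨m₁, m₂, hmm, h1, h2⟩
        have := (hdone m₁ (by omega)).2 h1
        have := (hspec m₂ (by omega)).2 h2
        omega
    have hblk' : Blocks G num col om rep (num c) (s.var 16) (s.arr 11) (s.arr 10) :=
      fun v hv => hblk v (by omega)
    refine Run.seq 8 10 (Run.assign rfl ?_ ?_ (by simp [Expr.cost])) (by omega)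
    · rw [hev]; omega
    rw [hev]
    refine Run.cond 4 rfl ?_ ?_ (by simp [Expr.cost])
    · intro h'
      have hlt : n + 1 < s.var 17 + x := by
        by_contra hcon
        simp [State.setVar_var, hr.card, hcon] at h'
      refine Run.assign rfl ?_ ?_ (by simp [Expr.cost])
      · simp [State.setVar_var, hr.card]; omega
      refine ⟨rep, hrep.finish he.inj hroot, ?_, ?_, ?_, ?_⟩
      · simp [State.setVar_var]; omega
      · simpa [State.setVar_var, State.setVar_arr] using hblk'
      · simp [State.setVar_var, hr.card]
      · simp only [State.setVar_var, if_true, Expr.eval_bin, Expr.eval_var, Expr.eval_const,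
          BinOp.apply_add, Nat.reduceEqDiff, if_false, hr.card, reduceCtorEq]
        exact hmin _ le_rfl fun m hm => by omega
    · intro h'
      have hlt : ¬ n + 1 < s.var 17 + x := by
        intro hcon
        simp [State.setVar_var, hr.card, hcon] at h'
      refine Run.skip ⟨rep, hrep.finish he.inj hroot, ?_, ?_, ?_, ?_⟩ (by omega)
      · simp [State.setVar_var]; omega
      · simpa [State.setVar_var, State.setVar_arr] using hblk'
      · simp [State.setVar_var]; omega
      · simp only [State.setVar_var, if_true]
        exact hmin _ (by omega) fun m hm => Iff.rfl

def process : Cmd :=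
  .seq (.assign 16 (.var 0)) (.forLoop 20 (.const 0) (.var 0) processBody)

theorem run_process {V : ℕ} (hr : Ready G num par col om s) (he : Elim G num par col om)
    (hom : om ≤ n + 1) (hlt : ∀ v, num v < n) (hex : ∀ i < n, ∃ v, num v = i)
    (h17 : s.var 17 = 0) (hI : ∀ j, Blocks G num col om id j n (s.arr 11) (s.arr 10))
    (hV : 2 * n + 2 ≤ V) (hZ : (2 * n + 1) * 2 ^ stateBits om ≤ V) :
    Run V (n * (2 ^ stateBits om * (mergeTime om + 23) + 60) + 10) process s (fun s' =>
      ∃ rep : Fin n → Fin n, s'.var 17 ≤ n + 1 ∧ ∀ m ≤ n, s'.var 17 ≤ m ↔ Done G num rep 0 m) := by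
  refine Run.bdd fun hb => ?_
  refine Run.seq 2 (n * (2 ^ stateBits om * (mergeTime om + 23) + 60) + 8)
    (Run.assign rfl (hb.var_le _) ?_ (by simp [Expr.cost])) (by omega)
  simp only [Expr.eval_var, hr.card]
  set s0 := s.setVar 16 n with hs0
  have hr0 : Ready G num par col om s0 := hr.congr (by simp [hs0, State.setVar_var])
    (by simp [hs0, State.setVar_var]) (by simp [hs0, State.setVar_var])
    (by simp [hs0, State.setVar_var]) (by simp [hs0, State.setVar_var]) rfl rfl rfl rfl rfl
  refine Run.forLoop 0 n (2 ^ stateBits om * (mergeTime om + 23) + 50)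
    (fun i s' => Progress G num col om (n - i) (n + i) s') rfl rfl rfl (by decide) (by omega)
    ?_ ?_ ?_ ?_ ?_
  · intro s' hf
    rw [Expr.eval_var, hf.var 0 (by decide), hr0.card, zero_add]
  · refine ⟨id, clusters_id fun u => ?_, ?_, ?_, ?_, fun m hm => ?_⟩
    · have := hlt u; omega
    · simp [hs0, State.setVar_var]
    · simpa [hs0, State.setVar_var, State.setVar_arr] using hI n
    · simp [hs0, State.setVar_var, h17]
    · simp only [hs0, State.setVar_var, Nat.reduceEqDiff, if_false, h17, Nat.zero_le, true_iff]
      exact done_id (fun u => by have := hlt u; omega) m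
  · intro i s' hi hb' hf hx hI'
    have hr' := hr0.congr_frame hf (by decide) (by decide)
    obtain ⟨c, hc⟩ := hex (n - (i + 1)) (by omega)
    have hc6 : s'.arr 6 (s'.var 0 - (s'.var 20 + 1)) = c := by
      rw [hr'.card, hx, zero_add, ← hc, hr'.ord]
    rw [show n - i = num c + 1 by omega] at hI'
    refine (run_processBody hr' he hom hc6 hI' hV
      (le_trans (Nat.mul_le_mul_right _ (by omega)) hZ)).mono le_rfl ?_
    rintro s'' - - ⟨rep, g1, g2, g3, g4, g5⟩
    rw [hc] at g1 g3 g5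
    refine ⟨rep, g1, ?_, ?_, ?_, ?_⟩
    · simp only [State.setVar_var, Nat.reduceEqDiff, if_false]; omega
    · simpa [State.setVar_var, State.setVar_arr] using g3
    · simpa [State.setVar_var] using g4
    · simpa [State.setVar_var] using g5
  · rintro s' hb' hf - ⟨rep, -, -, -, g4, g5⟩
    rw [Nat.sub_self] at g5
    exact ⟨rep, g4, g5⟩
  · simp only [Expr.cost]
    nlinarith

end Dynamic

end RAM

namespace RAM

open MEG

/-! ### The algorithm -/

/-- Arrays: 2 labels, 3 numbers counted from 1, 4 and 5 stacks and their heights, 6 vertices by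
number, 7 colours of the earlier neighbours, 8 number of the parent counted from 1 (0 for a root), 9
colours, 10 tables, 11 block of each vertex, 12 powers of two. Variables: 8 the stride n + 1, 10 the
number ω of colours, 13 the number of types, 15 the number of states, 16 the number of blocks in
use, 17 the size found so far, 18 and 19 the current vertex and its parent, 21 to 23 the states to
be combined, 99 truth values. -/
def algorithm : Cmd :=
  .seq search (.seq colour (.seq powers (.seq initTables (.seq process
    (.assign 0 (.bin .eq (.bin .lt (.var 1) (.var 17)) (.const 0)))))))

theorem isFresh_input {n : ℕ} (adj : Fin n → List (Fin n)) (k : ℕ) : IsFresh (input adj k) := by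
  refine ⟨fun x hx => ?_, fun a ha => ?_⟩
  · simp only [input]
    rw [if_neg (by omega), if_neg (by omega)]
  · funext i
    simp only [input]
    rw [if_neg (by omega), if_neg (by omega)]

theorem input_bdd {n V : ℕ} (adj : Fin n → List (Fin n)) (k : ℕ)
    (hV : n + k + ∑ v, (adj v).length + 2 ≤ V) : (input adj k).Bdd V := by
  have hlen : (List.ofFn adj).flatten.length = ∑ v, (adj v).length := by
    rw [List.length_flatten, List.map_ofFn, List.sum_ofFn]; rfl
  refine ⟨by omega, fun x => ?_, fun a i => ?_⟩
  · simp only [input]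
    split_ifs <;> omega
  · simp only [input]
    split_ifs
    · have h : ((List.ofFn adj).take i).flatten.length ≤ (List.ofFn adj).flatten.length := by
        conv_rhs => rw [← List.take_append_drop i (List.ofFn adj), List.flatten_append,
          List.length_append]
        omega
      omega
    · omega
    · rw [List.getD_eq_getElem?_getD, List.getElem?_map]
      cases (List.ofFn adj).flatten[i]? with
      | none => simp
      | some w => have := w.2; simp; omega
    · omega

theorem Numbering.isCliqueSet {n : ℕ} {G : SimpleGraph (Fin n)} (hG : IsChordal G) {s : State}
    (h : Numbering G n (s.arr 3) (s.arr 6)) (v : Fin n) :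
    IsCliqueSet G (earlier G (fun v : Fin n => s.arr 3 v - 1) v) :=
  fun _ ha _ hb hab => h.isMCS.adj hG h.isOrder.inj ha.1 hb.1 ha.2 hb.2 hab

/-- An elimination ordering is needed to count the edges, and the search program itself supplies
one: it is run with a memory bound in terms of the list lengths, which does not presuppose the
estimate. -/
theorem sum_length_le_treewidth {n : ℕ} {G : SimpleGraph (Fin n)} {adj : Fin n → List (Fin n)}
    (hG : IsChordal G) (hadj : IsAdjList G adj) : ∑ v, (adj v).length ≤ 2 * treewidth G * n := by
  have hin := isInput_input adj 0
  obtain ⟨s, -, -, -, -, hnum⟩ := run_search (V := 2 * n + ∑ v, (adj v).length + 2) hadj hin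
    (isFresh_input adj 0) (by rw [hin.total]; omega) (input_bdd adj 0 (by omega))
  exact sum_length_le hadj hnum.isOrder.inj (card_earlier_le (Numbering.isCliqueSet hG hnum))

namespace Fm

theorem time_mono {B B' : ℕ} (h : B ≤ B') (φ : Fm) : φ.time B ≤ φ.time B' := by
  induction φ with
  | atom e => exact le_rfl
  | not φ ih => simp only [time]; omega
  | and φ ψ ih1 ih2 => simp only [time]; omega
  | all b φ ih => simp only [time]; gcongr

end Fm

theorem stateBits_mono {a b : ℕ} (h : a ≤ b) : stateBits a ≤ stateBits b := by
  have : 2 ^ a ≤ 2 ^ b := Nat.pow_le_pow_right (by omega) h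
  unfold stateBits
  gcongr

theorem two_pow_stateBits_mono {a b : ℕ} (h : a ≤ b) : 2 ^ stateBits a ≤ 2 ^ stateBits b :=
  Nat.pow_le_pow_right (by omega) (stateBits_mono h)

theorem mergeTime_mono {a b : ℕ} (h : a ≤ b) : mergeTime a ≤ mergeTime b := by
  have h1 := two_pow_stateBits_mono h
  have h2 := Fm.time_mono (Nat.pow_le_pow_right (show 0 < 2 by omega) h) Fm.combine
  unfold mergeTime
  gcongr

/-- A bound for the running time of the dynamic program. -/
def dynamicTime (n om : ℕ) : ℕ :=
  (50 * 2 ^ stateBits om + 50) + ((n * (2 ^ stateBits om *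
    (Fm.needsNone.time (2 ^ om) + Fm.needsOne.time (2 ^ om) + 28) + 20) + 10) +
    ((n * (2 ^ stateBits om * (mergeTime om + 23) + 60) + 10) + 6))

theorem dynamicTime_mono {n a b : ℕ} (h : a ≤ b) : dynamicTime n a ≤ dynamicTime n b := by
  have h1 := two_pow_stateBits_mono h
  have h2 := mergeTime_mono h
  have h3 := Fm.time_mono (Nat.pow_le_pow_right (show 0 < 2 by omega) h) Fm.needsNone
  have h4 := Fm.time_mono (Nat.pow_le_pow_right (show 0 < 2 by omega) h) Fm.needsOne
  unfold dynamicTime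
  gcongr

/-- A bound for the running time of the algorithm. -/
def totalTime (n K : ℕ) : ℕ :=
  (100 * (2 * K * n) + 300 * n + 50) + ((36 * (2 * K * n) + n * (11 * K + 58) + 20) +
    dynamicTime n (K + 1))

theorem run_algorithm {n V : ℕ} {G : SimpleGraph (Fin n)} {adj : Fin n → List (Fin n)} {k : ℕ}
    (hG : IsChordal G) (hadj : IsAdjList G adj)
    (hV : 2 * n + 2 * treewidth G * n + 2 ≤ V)
    (hZ : (2 * n + 1) * 2 ^ stateBits (treewidth G + 1) ≤ V) :
    Run V (totalTime n (treewidth G)) algorithm (input adj k)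
      (fun s => s.var 0 ≠ 0 ↔ megNumber G ≤ k) := by
  have hin := isInput_input adj k
  have hfresh := isFresh_input adj k
  have hoff : (input adj k).arr 0 n ≤ 2 * treewidth G * n := by
    rw [hin.total]; exact sum_length_le_treewidth hG hadj
  have hZ1 : 1 ≤ 2 ^ stateBits (treewidth G + 1) := Nat.one_le_two_pow
  have hZV : 2 ^ stateBits (treewidth G + 1) ≤ V :=
      le_trans (Nat.le_mul_of_pos_left _ (by omega)) hZ
  refine Run.seq _ _ ?_ le_rfl
  refine (run_search hadj hin hfresh (by omega)).mono (by omega) ?_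
  intro s1 hb1 hf1 hnum
  have hin1 : IsInput adj s1 :=
    hin.congr (hf1.var 0 (by decide)) (hf1.arr 0 (by decide)) (hf1.arr 1 (by decide))
  have ho1 := hnum.isOrder
  have hcl := Numbering.isCliqueSet hG hnum
  generalize hnumeq : (fun v : Fin n => s1.arr 3 v - 1) = num at ho1 hcl
  -- The minimum with n keeps the colours within the rows of stride n + 1.
  have hK : ∀ v (Q : Finset (Fin n)), (∀ w ∈ Q, w ∈ earlier G num v) →
      Q.card ≤ min (treewidth G) n := fun v Q hQ =>
    le_min (card_earlier_le hcl v Q hQ) ((Finset.card_le_univ Q).trans (by simp))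
  refine Run.seq _ _ ?_ le_rfl
  refine (run_colour hadj hin1 ho1 (min_le_right _ _) hK (by omega)
    ((hf1.arr 7 (by decide)).trans (hfresh.arr 7 (by omega)))).mono ?_ ?_
  · have h0 : s1.arr 0 n ≤ 2 * treewidth G * n := by rw [hf1.arr 0 (by decide)]; exact hoff
    have h1 : min (treewidth G) n ≤ treewidth G := min_le_left _ _
    gcongr
  rintro s2 hb2 hf2 ⟨h8, hom1, hom2, hcol⟩
  have hin2 : IsInput adj s2 :=
    hin1.congr (hf2.var 0 (by decide)) (hf2.arr 0 (by decide)) (hf2.arr 1 (by decide))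
  have ho2 : IsOrder num s2 := ho1.congr (hf2.arr 3 (by decide)) (hf2.arr 6 (by decide))
  generalize hom : s2.var 10 = om at hom1 hom2 hcol
  have homw : om ≤ treewidth G + 1 := hom2.trans (by have := min_le_left (treewidth G) n; omega)
  have homn : om ≤ n + 1 := hom2.trans (by have := min_le_right (treewidth G) n; omega)
  obtain ⟨par, he, hpar⟩ := hcol.exists_elim ho2.lt ho2.inj hcl
  have hZom := two_pow_stateBits_mono homw
  -- The program works with the number of colours that it has found. Monotonicity replaces it by
  -- treewidth + 1 in the time bound.
  refine Run.mono (T := dynamicTime n om) ?_ (dynamicTime_mono homw) fun _ _ _ h => h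
  refine Run.seq _ _ ?_ le_rfl
  refine (run_powers hom (hZom.trans hZV)).mono le_rfl ?_
  rintro s3 hb3 hf3 ⟨h13, h15, hpw⟩
  have hr3 : Ready G num par (fun v => s2.arr 9 v) om s3 := by
    refine ⟨(hf3.var 0 (by decide)).trans hin2.card, (hf3.var 8 (by decide)).trans h8,
      (hf3.var 10 (by decide)).trans hom, h13, h15, hpw, fun v => ?_, fun v c hc => ?_,
      fun v => ?_, fun v hv => ?_, fun v hv => ?_⟩
    · rw [hf3.arr 9 (by decide)]
    · rw [hf3.arr 7 (by decide)]; exact hcol.bits v (ho2.lt v) c hc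
    · rw [hf3.arr 6 (by decide)]; exact ho2.ord v
    · rw [hf3.arr 8 (by decide)]; exact (hpar v).1 hv
    · rw [hf3.arr 8 (by decide)]; exact (hpar v).2 hv
  refine Run.seq _ _ ?_ le_rfl
  refine (run_initTables hr3 he homn (by omega) (hZom.trans hZV)).mono le_rfl ?_
  intro s4 hb4 hf4 hblk
  have hr4 := hr3.congr_frame hf4 (by decide) (by decide)
  have h17 : s4.var 17 = 0 := by
    rw [hf4.var 17 (by decide), hf3.var 17 (by decide), hf2.var 17 (by decide),
      hf1.var 17 (by decide)]
    exact hfresh.var 17 (by omega)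
  refine Run.seq _ _ ?_ le_rfl
  refine (run_process hr4 he homn ho2.lt ho2.ex h17 hblk (by omega)
    (le_trans (Nat.mul_le_mul_left _ hZom) hZ)).mono le_rfl ?_
  rintro s5 hb5 hf5 ⟨rep, hle, hdone⟩
  have h1 : s5.var 1 = k := by
    rw [hf5.var 1 (by decide), hf4.var 1 (by decide), hf3.var 1 (by decide),
      hf2.var 1 (by decide), hf1.var 1 (by decide)]
    simp [input]
  refine Run.assign rfl ((BinOp.apply_eq_le _ _).trans (by omega)) ?_ (by simp [Expr.cost])
  have hiff : s5.var 17 ≤ k ↔ megNumber G ≤ k := by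
    by_cases hk : k ≤ n
    · rw [hdone k hk, done_zero_iff hG, megNumber_le_iff]
    -- For k > n both sides are true, as the stored value is at most n + 1.
    · have hmeg : megNumber G ≤ n :=
        (megNumber_le_iff n).2 ⟨Finset.univ, isMEGSet_univ G, by simp⟩
      exact ⟨fun _ => by omega, fun _ => by omega⟩
  rw [← hiff]
  simp only [State.setVar_var, if_true, Expr.eval_bin, Expr.eval_var, Expr.eval_const,
    BinOp.apply_eq, BinOp.apply_lt, h1]
  by_cases h : k < s5.var 17
  · simp [h]
  · simp [h]; omega

/-- D bounds the number of states and also the range of the quantifiers. At each merge, three nested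
loops over states contribute D ^ 3 and the formula with at most five nested quantifiers contributes
D ^ 5. The remaining D ^ 4 absorbs the factor 10000, since already one colour gives 2 ^ 5 = 32
states. -/
theorem totalTime_le {n w D : ℕ} (hD : 2 ^ stateBits (w + 1) ≤ D) :
    totalTime n w ≤ D ^ 12 * (n + 1) := by
  have hw : w + 1 < 2 ^ (w + 1) := Nat.lt_two_pow_self
  have hbits : 2 ^ (w + 1) + 2 ^ (w + 1) + (w + 1) * (w + 1) < 2 ^ stateBits (w + 1) :=
    Nat.lt_two_pow_self (n := stateBits (w + 1))
  have h32 : 32 ≤ D := by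
    refine le_trans ?_ hD
    calc 32 = 2 ^ stateBits 1 := by decide
      _ ≤ _ := two_pow_stateBits_mono (by omega)
  have hB : 2 ^ (w + 1) + 1 ≤ D := by nlinarith
  have hwD : w ≤ D := by omega
  have htime : ∀ φ : Fm, φ.rank ≤ 5 → φ.time (2 ^ (w + 1)) ≤ φ.weight * D ^ 5 := fun φ hφ =>
    (Fm.time_le _ φ 5 hφ).trans (Nat.mul_le_mul_left _ (Nat.pow_le_pow_left hB 5))
  have ht₁ := htime Fm.combine (by decide)
  have ht₂ := htime Fm.needsNone (by decide)
  have ht₃ := htime Fm.needsOne (by decide)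
  rw [show Fm.combine.weight = 4703 by decide] at ht₁
  rw [show Fm.needsNone.weight = 187 by decide] at ht₂
  rw [show Fm.needsOne.weight = 581 by decide] at ht₃
  have hp : ∀ i, 1 ≤ D ^ i := fun i => Nat.one_le_pow _ _ (by omega)
  have hmt : mergeTime (w + 1) ≤ 4743 * D ^ 7 := by
    have h5 := hp 5
    have h6 := hp 6
    calc mergeTime (w + 1) ≤ D * (D * (4703 * D ^ 5 + 26) + 14) := by unfold mergeTime; gcongr
      _ ≤ D * (D * (4703 * D ^ 5 + 26 * D ^ 5) + 14 * D ^ 6) := by gcongr <;> omega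
      _ = 4743 * D ^ 7 := by ring
  have h7 := hp 7
  have h8 := hp 8
  have hD8 : D ≤ D ^ 8 := by
    calc D = D ^ 1 := (pow_one D).symm
      _ ≤ D ^ 8 := Nat.pow_le_pow_right (by omega) (by omega)
  have hm : 2 ^ stateBits (w + 1) * (mergeTime (w + 1) + 23) ≤ 4766 * D ^ 8 := by
    calc _ ≤ D * (4743 * D ^ 7 + 23 * D ^ 7) := by gcongr; omega
      _ = 4766 * D ^ 8 := by ring
  have hi : 2 ^ stateBits (w + 1) * (Fm.needsNone.time (2 ^ (w + 1)) +
      Fm.needsOne.time (2 ^ (w + 1)) + 28) ≤ 796 * D ^ 8 := by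
    have h5 := hp 5
    calc _ ≤ D * (187 * D ^ 5 + 581 * D ^ 5 + 28 * D ^ 5) := by gcongr; omega
      _ = 796 * D ^ 6 := by ring
      _ ≤ 796 * D ^ 8 := by gcongr <;> omega
  have hE : D ^ 12 = D ^ 8 * D ^ 4 := by ring
  have h4 : 32 ^ 4 ≤ D ^ 4 := Nat.pow_le_pow_left h32 4
  have hmain : totalTime n w ≤ D ^ 8 * (10000 * (n + 1)) := by
    unfold totalTime dynamicTime
    generalize 2 ^ stateBits (w + 1) * (mergeTime (w + 1) + 23) = x at hm
    generalize 2 ^ stateBits (w + 1) * (Fm.needsNone.time (2 ^ (w + 1)) +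
      Fm.needsOne.time (2 ^ (w + 1)) + 28) = y at hi
    generalize D ^ 8 = E at hm hi hD8 h8
    have g1 : w * n ≤ E * n := Nat.mul_le_mul_right _ (by omega)
    have g2 : n * x ≤ n * (4766 * E) := Nat.mul_le_mul_left _ hm
    have g3 : n * y ≤ n * (796 * E) := Nat.mul_le_mul_left _ hi
    have g4 : n ≤ E * n := Nat.le_mul_of_pos_left _ h8
    have g5 := hD.trans hD8
    linarith
  rw [hE, mul_assoc]
  refine hmain.trans (Nat.mul_le_mul_left _ (Nat.mul_le_mul_right _ (le_trans (by norm_num) h4)))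

end RAM

/-! ### The constants of the theorem -/

theorem theorem3p2 :
    ∃ (P : RAM.Cmd) (f : ℕ → ℕ) (d : ℕ), Computable f ∧
      (∃ c : ℕ, ∀ t : ℕ, f t ≤ 2 ^ (2 ^ (c * (t + 1)))) ∧
      ∀ (n : ℕ) (G : SimpleGraph (Fin n)) (adj : Fin n → List (Fin n)) (k : ℕ),
        MEG.IsChordal G → MEG.IsAdjList G adj →
        ∃ (s : RAM.State) (T : ℕ),
          RAM.Exec ((f (MEG.treewidth G) * (n + 1) + k) ^ d) P (RAM.input adj k) s T ∧
          T ≤ f (MEG.treewidth G) * (n + 1) ∧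
          (s.var 0 ≠ 0 ↔ MEG.megNumber G ≤ k) := by
  refine ⟨RAM.algorithm, fun t => 2 ^ (2 ^ (8 * (t + 1))), 60, ?_, ⟨8, fun t => le_rfl⟩, ?_⟩
  · have h : ∀ g : ℕ → ℕ, Primrec g → Primrec (fun t => 2 ^ g t) := by
      intro g hg
      have : Primrec (fun n : ℕ => 2 ^ n) := by
        refine (Primrec.nat_rec₁ 1 ((Primrec.nat_mul.comp Primrec.snd
          (Primrec.const 2)).to₂)).of_eq fun n => ?_
        induction n with
        | zero => rfl
        | succ n ih => simp only [pow_succ, ← ih]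
      exact this.comp hg
    exact (h _ (h _ (Primrec.nat_mul.comp (Primrec.const 8) Primrec.succ))).to_comp
  · intro n G adj k hG hadj
    set w := MEG.treewidth G with hw
    set D := 2 ^ MEG.stateBits (w + 1) with hD
    -- With a = 2 ^ (w + 1), a state has at most 2 a² bits, and 12 · 2 a² ≤ 2 ^ 6 · a² ≤ a ^ 8 since
    -- a ≥ 2. This is where the constant 8 comes from.
    have hf : D ^ 12 ≤ 2 ^ (2 ^ (8 * (w + 1))) := by
      rw [hD, ← pow_mul]
      refine Nat.pow_le_pow_right (by omega) ?_
      rw [mul_comm 8, pow_mul]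
      have h1 : w + 1 < 2 ^ (w + 1) := Nat.lt_two_pow_self
      have h2 : 2 ≤ 2 ^ (w + 1) := by rw [pow_succ]; have := Nat.one_le_two_pow (n := w); omega
      unfold MEG.stateBits
      generalize 2 ^ (w + 1) = a at h1 h2
      have h6 : 2 ^ 6 ≤ a ^ 6 := Nat.pow_le_pow_left h2 6
      calc (a + a + (w + 1) * (w + 1)) * 12 ≤ (a * a + a * a) * 12 := by
            gcongr
            nlinarith
        _ ≤ 2 ^ 6 * (a * a) := by nlinarith
        _ ≤ a ^ 6 * (a * a) := Nat.mul_le_mul_right _ h6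
        _ = a ^ 8 := by ring
    have htime := RAM.totalTime_le (n := n) (w := w) (D := D) le_rfl
    have hsum := RAM.sum_length_le_treewidth hG hadj
    have hT : RAM.totalTime n w ≤ 2 ^ (2 ^ (8 * (w + 1))) * (n + 1) :=
      htime.trans (Nat.mul_le_mul_right _ hf)
    set F := 2 ^ (2 ^ (8 * (w + 1))) * (n + 1) with hF
    have hV : 2 * n + 2 * w * n + 2 ≤ F := by
      refine le_trans ?_ hT
      unfold RAM.totalTime
      nlinarith
    have hZ : (2 * n + 1) * 2 ^ MEG.stateBits (w + 1) ≤ F := by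
      have h1 : 2 ≤ D := by
        rw [hD]
        exact le_trans (by decide) (RAM.two_pow_stateBits_mono (show 1 ≤ w + 1 by omega))
      have h2 : 2 * D ≤ D ^ 12 := by
        calc 2 * D ≤ D * D := Nat.mul_le_mul_right _ h1
          _ = D ^ 2 := by ring
          _ ≤ D ^ 12 := Nat.pow_le_pow_right (by omega) (by omega)
      calc (2 * n + 1) * D ≤ 2 * D * (n + 1) := by nlinarith
        _ ≤ F := Nat.mul_le_mul_right _ (h2.trans hf)
    rw [← hw] at hsum
    -- The memory bound includes k because k is stored in the input; the time bound does not depend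
    -- on it.
    obtain ⟨s, T, h1, h2, -, h3⟩ := RAM.run_algorithm (V := F + k) (k := k) hG hadj
      (by rw [← hw]; omega) (by rw [← hw]; omega) (RAM.input_bdd adj k (by omega))
    exact ⟨s, T, h1, h2.trans hT, h3⟩
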